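/- Let $d\ge 1$ and let $\rho_{\rm d}$ be a probability density on $\mathbb{R}^d$ with $\rho_{\rm d}>0$ and $\ln\rho_{\rm d}\in L^\infty_{\rm loc}(\mathbb{R}^d)$, such that the weak gradient $\nabla\ln\rho_{\rm d}$ exists and lies in $L^2(\mathbb{R}^d,\mu_{\rm d})$, where $\mu_{\rm d}(dy)=\rho_{\rm d}(y)\,dy$. For $\varphi\in C^2(\mathbb{R}^d)$ put $\Delta_{\mu_{\rm d}}\varphi:=\Delta\varphi+\nabla\ln\rho_{\rm d}\cdot\nabla\varphi$. Let $H^1_0(\mathbb{R}^d,\mu_{\rm d})$ be the closure of $C_c^\infty(\mathbb{R}^d)$ under the $W^{1,2}(\mathbb{R}^d,\mu_{\rm d})$-norm. Fix $\beta>0$ and let $Av:=-\tfrac12\Delta_{\mu_{\rm d}}\ln(1+v)$ with domain $$D(A)=\{v\in L^1(\mathbb{R}^d,\mu_{\rm d})\cap H^1_0(\mathbb{R}^d,\mu_{\rm d}):\ 0\le v\le\beta,\ Av\in L^1(\mathbb{R}^d,\mu_{\rm d})\},$$ where $Av=g\in L^1(\mathbb{R}^d,\mu_{\rm d})$ is understood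 weakly: $\int g\varphi\,d\mu_{\rm d}=-\tfrac12\int\ln(1+v)\,\Delta_{\mu_{\rm d}}\varphi\,d\mu_{\rm d}$ for all $\varphi\in C^2_c(\mathbb{R}^d)$. For $\lambda>0$ and $f\in L^1(\mathbb{R}^d,\mu_{\rm d})$, $v\in D(A)$ is a weak solution of $(I+\lambda A)v=f$ if $$\int\Big(v\varphi-\tfrac{\lambda}{2}\ln(1+v)\,\Delta_{\mu_{\rm d}}\varphi\Big)d\mu_{\rm d}=\int f\varphi\,d\mu_{\rm d}\qquad\forall\varphi\in C_c^2(\mathbb{R}^d),$$ and $R(I+\lambda A)$ is the set of all $f\in L^1(\mathbb{R}^d,\mu_{\rm d})$ for which such a $v$ exists. Closures are taken in $L^1(\mathbb{R}^d,\mu_{\rm d})$. Then: 1. $A$ is accretive in $L^1(\mathbb{R}^d,\mu_{\rm d})$: $\|v_1-v_2\|_{L^1(\mu_{\rm d})}\le\|(I+\lambda A)v_1-(I+\lambda A)v_2\|_{L^1(\mu_{\rm d})}$ for all $v_1,v_2\in D(A)$ and $\lambda>0$. 2. $\overline{D(A)}\subseteq R(I+\lambda A)$ for all $\lambda>0$.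 3. For all $\lambda>0$ and $f\in L^1(\mathbb{R}^d,\mu_{\rm d})$, $(I+\lambda A)v=f$ has at most one weak solution $v\in D(A)$; it is denoted $(I+\lambda A)^{-1}f$ when it exists, and $(I+0A)^{-1}:=I$. 4. For every probability density $\rho_0$ on $\mathbb{R}^d$ with $\rho_0\le\beta\rho_{\rm d}$ a.e., there is $v\in C([0,\infty);L^1(\mathbb{R}^d,\mu_{\rm d}))$ with $v(0)=\rho_0/\rho_{\rm d}$ and $v(t)\in\overline{D(A)}$ for all $t\ge0$ that is a weak solution of $v_t=\tfrac12\Delta_{\mu_{\rm d}}\ln(1+v)$, i.e. $$\int_0^\infty\!\!\int_{\mathbb{R}^d}\Big(v\,\varphi_t+\tfrac12\ln(1+v)\,\Delta_{\mu_{\rm d}}\varphi\Big)d\mu_{\rm d}\,dt=0\qquad\forall\varphi\in C_c^{1,2}((0,\infty)\times\mathbb{R}^d)$$ (all integrals being well defined), and $$v(t)=\lim_{n\to\infty}\Big(I+\frac tn A\Big)^{-n}v(0)\quad\text{in }L^1(\mathbb{R}^d,\mu_{\rm d}),\qquad t\ge0,$$ uniformly in $t$ on compact subintervals of $[0,\infty)$.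 -/

import Mathlib

open MeasureTheory Filter Topology Set
open scoped ContDiff

noncomputable section

/-- The Euclidean space `ℝ^d`. -/
abbrev Ed (d : ℕ) : Type := EuclideanSpace ℝ (Fin d)

/-- `ρ` is a probability density function on `ℝ^d`. -/
structure IsProbDensity {d : ℕ} (ρ : Ed d → ℝ) : Prop where
  measurable : Measurable ρ
  nonneg : ∀ y, 0 ≤ ρ y
  lintegral_eq_one : ∫⁻ y, ENNReal.ofReal (ρ y) = 1

/-- The measure `μ(dy) = ρ(y) dy` with Lebesgue density `ρ`. -/
def densityMeasure {d : ℕ} (ρ : Ed d → ℝ) : Measure (Ed d) :=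
  volume.withDensity (fun y => ENNReal.ofReal (ρ y))

/-- The Banach space `L¹(ℝ^d, μ)` with `μ(dy) = ρ(y) dy`. -/
abbrev L1 {d : ℕ} (ρ : Ed d → ℝ) : Type := Lp ℝ 1 (densityMeasure ρ)

/-- `G` is a weak gradient of `f` on `ℝ^d` (in the usual sense, with respect to Lebesgue measure). -/
structure HasWeakGradient {d : ℕ} (f : Ed d → ℝ) (G : Ed d → Ed d) : Prop where
  locallyIntegrable : LocallyIntegrable f volume
  locallyIntegrable_grad : LocallyIntegrable G volume
  integral_eq : ∀ ψ : Ed d → ℝ, ContDiff ℝ ∞ ψ → HasCompactSupport ψ →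
    ∫ y, f y • gradient ψ y = - ∫ y, ψ y • G y

open Classical in
/-- The weak gradient `∇f` (unique up to Lebesgue-null sets when it exists). -/
def weakGradient {d : ℕ} (f : Ed d → ℝ) : Ed d → Ed d :=
  if h : ∃ G : Ed d → Ed d, HasWeakGradient f G then h.choose else 0

/-- A weak gradient is unique up to Lebesgue-null sets. -/
theorem HasWeakGradient.ae_eq_weakGradient {d : ℕ} {f : Ed d → ℝ} {G : Ed d → Ed d}
    (h : HasWeakGradient f G) : weakGradient f =ᵐ[volume] G := by
  have h' : ∃ G : Ed d → Ed d, HasWeakGradient f G := ⟨G, h⟩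
  have hc : HasWeakGradient f (weakGradient f) := by
    rw [weakGradient, dif_pos h']; exact h'.choose_spec
  refine ae_eq_of_integral_contDiff_smul_eq hc.locallyIntegrable_grad h.locallyIntegrable_grad ?_
  intro φ hφ hs
  exact neg_injective ((hc.integral_eq φ hφ hs).symm.trans (h.integral_eq φ hφ hs))

/-- The weak first derivatives of `f` exist and lie in `L²(ℝ^d, ν)`. -/
def MemH1 {d : ℕ} (ν : Measure (Ed d)) (f : Ed d → ℝ) : Prop :=
  ∃ G : Ed d → Ed d, HasWeakGradient f G ∧ MemLp G 2 ν

/-- `f ∈ H¹₀(ℝ^d, ν)`: `f` is in the closure of `C_c^∞(ℝ^d)` under the norm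
`‖f‖_{L²(ν)} + ‖∇f‖_{L²(ν)}`. -/
def MemH10 {d : ℕ} (ν : Measure (Ed d)) (f : Ed d → ℝ) : Prop :=
  ∃ G : Ed d → Ed d, MemLp f 2 ν ∧ HasWeakGradient f G ∧ MemLp G 2 ν ∧
    ∀ ε : ENNReal, 0 < ε → ∃ φ : Ed d → ℝ, ContDiff ℝ ∞ φ ∧ HasCompactSupport φ ∧
      eLpNorm (fun y => f y - φ y) 2 ν < ε ∧ eLpNorm (fun y => G y - gradient φ y) 2 ν < ε

/-- `f ∈ L^∞_loc(ℝ^d)`. -/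
def LocallyEssBounded {d : ℕ} (f : Ed d → ℝ) : Prop :=
  AEStronglyMeasurable f volume ∧
    ∀ K : Set (Ed d), IsCompact K → ∃ C : ℝ, ∀ᵐ y ∂(volume.restrict K), |f y| ≤ C

/-- The standing assumption on the data density: `ρ` is a positive probability density with
`ln ρ ∈ L^∞_loc(ℝ^d) ∩ H¹(ℝ^d, μ)`. -/
structure IsDataDensity {d : ℕ} (ρ : Ed d → ℝ) : Prop where
  isProbDensity : IsProbDensity ρ
  pos : ∀ y, 0 < ρ y
  log_locallyEssBounded : LocallyEssBounded (fun y => Real.log (ρ y))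
  log_memH1 : MemH1 (densityMeasure ρ) (fun y => Real.log (ρ y))

/-- The weighted Laplacian `Δ_μ φ = Δφ + ∇ ln ρ · ∇φ` of a `C²` function `φ`. -/
def weightedLaplacian {d : ℕ} (ρ : Ed d → ℝ) (φ : Ed d → ℝ) (y : Ed d) : ℝ :=
  Laplacian.laplacian φ y + inner ℝ (weakGradient (fun z => Real.log (ρ z)) y) (gradient φ y)

/-- `g = -(1/2) Δ_μ ln(1+v)` in the weak sense with respect to `μ`. -/
def IsWeakA {d : ℕ} (ρ : Ed d → ℝ) (v g : L1 ρ) : Prop :=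
  ∀ φ : Ed d → ℝ, ContDiff ℝ 2 φ → HasCompactSupport φ →
    ∫ y, g y * φ y ∂(densityMeasure ρ) =
      -(1 / 2) * ∫ y, Real.log (1 + v y) * weightedLaplacian ρ φ y ∂(densityMeasure ρ)

/-- `Av` is uniquely determined. -/
theorem IsWeakA.unique {d : ℕ} {ρ : Ed d → ℝ} {v g₁ g₂ : L1 ρ} (hρ : IsDataDensity ρ)
    (h₁ : IsWeakA ρ v g₁) (h₂ : IsWeakA ρ v g₂) : g₁ = g₂ := by
  have : IsFiniteMeasure (densityMeasure ρ) :=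
    ⟨by simp [densityMeasure, hρ.isProbDensity.lintegral_eq_one]⟩
  apply Lp.ext
  refine ae_eq_of_integral_contDiff_smul_eq (L1.integrable_coeFn g₁).locallyIntegrable
    (L1.integrable_coeFn g₂).locallyIntegrable ?_
  intro φ hφ hc
  have := (h₁ φ (contDiff_infty.1 hφ 2) hc).trans (h₂ φ (contDiff_infty.1 hφ 2) hc).symm
  simpa [mul_comm] using this

/-- The domain `D(A) = {v ∈ L¹(μ) ∩ H¹₀(μ) : 0 ≤ v ≤ β, Av ∈ L¹(μ)}`. -/
def domA {d : ℕ} (ρ : Ed d → ℝ) (β : ℝ) : Set (L1 ρ) :=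
  {v | MemH10 (densityMeasure ρ) (fun y => v y) ∧
    (∀ᵐ y ∂(densityMeasure ρ), 0 ≤ v y ∧ v y ≤ β) ∧ ∃ g : L1 ρ, IsWeakA ρ v g}

open Classical in
/-- The operator `Av = -(1/2) Δ_μ ln(1+v)`; only its values on `D(A)` matter. -/
def opA {d : ℕ} (ρ : Ed d → ℝ) (v : L1 ρ) : L1 ρ :=
  if h : ∃ g : L1 ρ, IsWeakA ρ v g then h.choose else 0

/-- `v ∈ D(A)` is a weak solution of `(I + lam A) v = f` with respect to `μ`. -/
def IsWeakResolventSol {d : ℕ} (ρ : Ed d → ℝ) (β lam : ℝ) (f v : L1 ρ) : Prop :=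
  v ∈ domA ρ β ∧ ∀ φ : Ed d → ℝ, ContDiff ℝ 2 φ → HasCompactSupport φ →
    ∫ y, (v y * φ y - lam / 2 * (Real.log (1 + v y) * weightedLaplacian ρ φ y))
      ∂(densityMeasure ρ) = ∫ y, f y * φ y ∂(densityMeasure ρ)

/-- The range `R(I + lam A)` in `L¹(μ)`. -/
def rangeIA {d : ℕ} (ρ : Ed d → ℝ) (β lam : ℝ) : Set (L1 ρ) :=
  {f | ∃ v : L1 ρ, IsWeakResolventSol ρ β lam f v}

open Classical in
/-- The operator `(I + lam A)⁻¹` on `R(I + lam A)`, `lam > 0`, with `(I + 0 A)⁻¹ = I`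
(and the arbitrary value `0` off the range). -/
def resolventA {d : ℕ} (ρ : Ed d → ℝ) (β lam : ℝ) (f : L1 ρ) : L1 ρ :=
  if lam = 0 then f
  else if h : ∃ v : L1 ρ, IsWeakResolventSol ρ β lam f v then h.choose else 0

/-- `φ ∈ C_c^{1,2}((0,∞) × ℝ^d)`, extended by zero to `ℝ × ℝ^d`. -/
structure IsTestC12 {d : ℕ} (φ : ℝ → Ed d → ℝ) : Prop where
  hasCompactSupport : HasCompactSupport (fun p : ℝ × Ed d => φ p.1 p.2)
  tsupport_subset : tsupport (fun p : ℝ × Ed d => φ p.1 p.2) ⊆ Ioi (0 : ℝ) ×ˢ univ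
  continuous : Continuous (fun p : ℝ × Ed d => φ p.1 p.2)
  differentiable_time : ∀ y, Differentiable ℝ (fun t => φ t y)
  continuous_deriv_time : Continuous (fun p : ℝ × Ed d => deriv (fun s => φ s p.2) p.1)
  contDiff_space : ∀ t, ContDiff ℝ 2 (φ t)
  continuous_fderiv : Continuous (fun p : ℝ × Ed d => fderiv ℝ (φ p.1) p.2)
  continuous_fderiv_fderiv :
    Continuous (fun p : ℝ × Ed d => fderiv ℝ (fderiv ℝ (φ p.1)) p.2)

/-- The integrand `v φ_t + (1/2) ln(1+v) Δ_μ φ` at time `t`. -/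
def evolutionIntegrand {d : ℕ} (ρ : Ed d → ℝ) (v : ℝ → L1 ρ) (φ : ℝ → Ed d → ℝ)
    (t : ℝ) (y : Ed d) : ℝ :=
  v t y * deriv (fun s => φ s y) t + 1 / 2 * (Real.log (1 + v t y) * weightedLaplacian ρ (φ t) y)

/-- `v : [0,∞) → L¹(μ)` is a weak solution of `v_t = (1/2) Δ_μ ln(1+v)` with respect to `μ`;
the integrals are required to exist. Only `v t` for `t > 0` enters. -/
def IsWeakEvolutionSol {d : ℕ} (ρ : Ed d → ℝ) (v : ℝ → L1 ρ) : Prop :=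
  ∀ φ : ℝ → Ed d → ℝ, IsTestC12 φ →
    (∀ t, 0 < t → Integrable (evolutionIntegrand ρ v φ t) (densityMeasure ρ)) ∧
    IntegrableOn (fun t => ∫ y, evolutionIntegrand ρ v φ t y ∂(densityMeasure ρ)) (Ioi 0) ∧
    ∫ t in Ioi (0 : ℝ), ∫ y, evolutionIntegrand ρ v φ t y ∂(densityMeasure ρ) = 0

end

/-!
The operator `A v = -(1/2) Δ_μ ln (1 + v)` is m-accretive on the order interval `0 ≤ v ≤ β` of
`L¹(μ)`, and the evolution is obtained from its resolvents by the Crandall–Liggett exponential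
formula.

*Accretivity.* The weighted Laplacian is symmetric with respect to `μ`: the logarithmic gradient of
the density is exactly what the integration by parts produces
(`integral_mul_weightedLaplacian_of_contDiff`, proved by mollifying a cut-off of `ln ρ` and passing
to the limit in its exponential, `IsDataDensity.integral_fderiv_add`). Hence a weak equation
`g = -c Δ_μ u` with `u ∈ H¹₀(μ)` may be tested with smooth nondecreasing functions of `u`, so that
`g` has nonnegative integral over `{u > 0}` (`HasH10Gradient.setIntegral_nonneg`). For
`u = ln (1 + v₁) - ln (1 + v₂)` this set is `{v₁ > v₂}`, whence `‖v₁ - v₂‖` does not exceed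
`‖v₁ - v₂ + lam (A v₁ - A v₂)‖` (`norm_sub_le_of_isWeakA`). Uniqueness for the resolvent equation
follows.

*Range condition.* In the unknown `w = ln (1 + v)` the resolvent equation is
`exp w - 1 - (lam / 2) Δ_μ w = f`. The linear resolvent of the weighted Laplacian is an orthogonal
projection in `L²(μ) × L²(μ)` (`linearResolvent`), the nonlinear equation is solved by a contraction
built on it, and a maximum principle keeps `w` in `[0, ln (1 + β)]` (`exists_hasH10Gradient_exp`).
Every `f` with `0 ≤ f ≤ β` is therefore in the range, and these `f` form the closure of the domain,
because smooth compactly supported functions with values in `[0, β]` are in the domain and dense in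
the interval (`closure_domA`).

*Exponential formula.* Accretivity of the resolvents yields Kobayashi's estimate
(`IsResolventFamily.kobayashi`), so that the iterates `(I + (t/n) A)^(-n) x` converge, locally
uniformly in time, to a continuous trajectory.

*Weak solution.* For a fixed test function `φ` of space, the resolvent equation is a discrete
evolution equation for `∫ v φ dμ`, which passes to the limit because `v ↦ ∫ ln (1 + v) Δ_μ φ dμ` is
continuous on the order interval (`IsResolventFamily.hasDerivAt_flow`,
`continuousOn_integral_log_mul`). The product rule then identifies the tested equation with the
integral of the derivative of a compactly supported function of time (`isWeakEvolutionSol_flow`).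
-/

open scoped Pointwise

noncomputable section

/-! ### The exponential formula for nonexpansive resolvents -/

/-- A family of resolvents `J lam`, `lam > 0`, of an accretive operator, acting on a set `K`, and
whose range condition holds on `K`. The field `compare` is the resolvent form of accretivity, and
`step` bounds the displacement of points of `D` (the domain of the operator). -/
structure IsResolventFamily {X : Type*} [NormedAddCommGroup X] (K D : Set X)
    (J : ℝ → X → X) : Prop where
  isClosed : IsClosed K
  subset : D ⊆ K
  dense : K ⊆ closure D
  zero : ∀ x, J 0 x = x
  mapsTo : ∀ lam, 0 < lam → ∀ x ∈ K, J lam x ∈ K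
  nonexpansive : ∀ lam, 0 < lam → ∀ x ∈ K, ∀ y ∈ K, ‖J lam x - J lam y‖ ≤ ‖x - y‖
  compare : ∀ lam, 0 < lam → ∀ mu, 0 < mu → ∀ x ∈ K, ∀ y ∈ K,
    (lam + mu) * ‖J lam x - J mu y‖ ≤ lam * ‖J lam x - y‖ + mu * ‖x - J mu y‖
  step : ∀ x ∈ D, ∃ M, 0 ≤ M ∧ ∀ lam, 0 < lam → ‖J lam x - x‖ ≤ lam * M

namespace IsResolventFamily

variable {X : Type*} [NormedAddCommGroup X] {K D : Set X} {J : ℝ → X → X}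

theorem iterate_mem (h : IsResolventFamily K D J) {lam : ℝ} (hl : 0 < lam) {x : X} (hx : x ∈ K)
    (n : ℕ) : (J lam)^[n] x ∈ K := by
  induction n with
  | zero => simpa
  | succ n ih => rw [Function.iterate_succ_apply']; exact h.mapsTo _ hl _ ih

theorem iterate_nonexpansive (h : IsResolventFamily K D J) {lam : ℝ} (hl : 0 < lam) {x y : X}
    (hx : x ∈ K) (hy : y ∈ K) (n : ℕ) : ‖(J lam)^[n] x - (J lam)^[n] y‖ ≤ ‖x - y‖ := by
  induction n with
  | zero => simp
  | succ n ih =>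
    rw [Function.iterate_succ_apply', Function.iterate_succ_apply']
    exact (h.nonexpansive _ hl _ (h.iterate_mem hl hx n) _ (h.iterate_mem hl hy n)).trans ih

theorem norm_iterate_sub_le (h : IsResolventFamily K D J) {lam : ℝ} (hl : 0 < lam) {x : X}
    (hx : x ∈ K) {M : ℝ} (hM : ∀ lam, 0 < lam → ‖J lam x - x‖ ≤ lam * M) (n : ℕ) :
    ‖(J lam)^[n] x - x‖ ≤ n * lam * M := by
  induction n with
  | zero => simp
  | succ n ih =>
    rw [Function.iterate_succ_apply']
    have h1 := h.nonexpansive _ hl _ (h.iterate_mem hl hx n) _ hx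
    have h2 := hM lam hl
    have h3 := norm_sub_le_norm_sub_add_norm_sub (J lam ((J lam)^[n] x)) (J lam x) x
    push_cast
    linarith

/-- The weighted mean of the two preceding Kobayashi bounds is dominated by the next one. -/
theorem weighted_sqrt_le {lam mu : ℝ} (hl : 0 < lam) (hm : 0 < mu) {a b c : ℝ} (ha : 0 ≤ a)
    (hb : 0 ≤ b) (habc : lam * a + mu * b = (lam + mu) * c) :
    lam * √a + mu * √b ≤ (lam + mu) * √c := by
  have hc : 0 ≤ c := by
    have : 0 ≤ (lam + mu) * c := by rw [← habc]; positivity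
    exact nonneg_of_mul_nonneg_right this (by positivity)
  have h1 := Real.sq_sqrt ha
  have h2 := Real.sq_sqrt hb
  have h3 := Real.sq_sqrt hc
  refine le_of_sq_le_sq ?_ (by positivity)
  have : (lam + mu) ^ 2 * c = (lam + mu) * (lam * a + mu * b) := by rw [habc]; ring
  rw [mul_pow, h3, this]
  have h4 : 0 ≤ lam * mu * (√a - √b) ^ 2 := by positivity
  have h5 : (lam + mu) * (lam * a + mu * b) - (lam * √a + mu * √b) ^ 2 =
      lam * mu * (√a - √b) ^ 2 := by
    linear_combination (-lam ^ 2 - lam * mu) * h1 + (-mu ^ 2 - lam * mu) * h2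
  linarith

/-- Kobayashi's estimate: discretizations of one trajectory with two step sizes stay close. -/
theorem kobayashi (h : IsResolventFamily K D J) {lam mu : ℝ} (hl : 0 < lam) (hm : 0 < mu) {x : X}
    (hx : x ∈ K) {M : ℝ} (hM0 : 0 ≤ M) (hM : ∀ lam, 0 < lam → ‖J lam x - x‖ ≤ lam * M)
    (i j : ℕ) :
    ‖(J lam)^[i] x - (J mu)^[j] x‖ ≤
      M * √((i * lam - j * mu) ^ 2 + i * lam ^ 2 + j * mu ^ 2) := by
  induction i generalizing j with
  | zero =>
    rw [norm_sub_rev]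
    refine (h.norm_iterate_sub_le hm hx hM j).trans ?_
    rw [mul_comm]
    refine mul_le_mul_of_nonneg_left (Real.le_sqrt_of_sq_le ?_) hM0
    have : 0 ≤ (j : ℝ) * mu ^ 2 := by positivity
    simp; linarith
  | succ i ih =>
    induction j with
    | zero =>
      refine (h.norm_iterate_sub_le hl hx hM (i + 1)).trans ?_
      rw [mul_comm]
      refine mul_le_mul_of_nonneg_left (Real.le_sqrt_of_sq_le ?_) hM0
      have : 0 ≤ ((i : ℝ) + 1) * lam ^ 2 := by positivity
      simp; linarith
    | succ j ihj =>
      have h1 := h.compare lam hl mu hm _ (h.iterate_mem hl hx i) _ (h.iterate_mem hm hx j)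
      rw [← Function.iterate_succ_apply' (J lam), ← Function.iterate_succ_apply' (J mu)] at h1
      have h2 := ih (j + 1)
      have h3 : lam * √((((i + 1 : ℕ) : ℝ) * lam - j * mu) ^ 2 + ((i + 1 : ℕ) : ℝ) * lam ^ 2
            + j * mu ^ 2) + mu * √((i * lam - ((j + 1 : ℕ) : ℝ) * mu) ^ 2 + i * lam ^ 2
            + ((j + 1 : ℕ) : ℝ) * mu ^ 2) ≤ (lam + mu) * √((((i + 1 : ℕ) : ℝ) * lam
            - ((j + 1 : ℕ) : ℝ) * mu) ^ 2 + ((i + 1 : ℕ) : ℝ) * lam ^ 2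
            + ((j + 1 : ℕ) : ℝ) * mu ^ 2) := by
        refine weighted_sqrt_le hl hm (by positivity) (by positivity) ?_
        push_cast
        ring
      have h4 := mul_le_mul_of_nonneg_left ihj hl.le
      have h5 := mul_le_mul_of_nonneg_left h2 hm.le
      have h6 := mul_le_mul_of_nonneg_left h3 hM0
      refine le_of_mul_le_mul_left ?_ (add_pos hl hm)
      linarith

/-- The iterates depend on the elapsed time only, up to an error that vanishes with the steps. -/
theorem iterate_cauchy (h : IsResolventFamily K D J) {x : X} (hx : x ∈ K) {T eta : ℝ} (hT : 0 ≤ T)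
    (heta : 0 < eta) :
    ∃ del > 0, ∀ lam mu : ℝ, 0 < lam → lam ≤ del → 0 < mu → mu ≤ del → ∀ i j : ℕ,
      i * lam ≤ T → j * mu ≤ T → |i * lam - j * mu| ≤ del →
      ‖(J lam)^[i] x - (J mu)^[j] x‖ ≤ eta := by
  obtain ⟨y, hyD, hxy⟩ := Metric.mem_closure_iff.1 (h.dense hx) (eta / 4) (by positivity)
  have hy := h.subset hyD
  obtain ⟨M, hM0, hM⟩ := h.step y hyD
  rw [dist_eq_norm] at hxy
  -- `R` is the size of the radicand in Kobayashi's estimate that makes the bound `≤ eta / 2`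
  set R : ℝ := (eta / 2 / (M + 1)) ^ 2 with hR
  have hRpos : 0 < R := by positivity
  refine ⟨min 1 (R / (1 + 2 * T)), by positivity, ?_⟩
  intro lam mu hl hl' hm hm' i j hi hj hij
  have h1 := h.iterate_nonexpansive hl hx hy i
  have h2 := h.iterate_nonexpansive hm hx hy j
  have h3 := h.kobayashi hl hm hy hM0 hM i j
  set del := min 1 (R / (1 + 2 * T)) with hdel
  have hd0 : 0 < del := by positivity
  have hd1 : del ≤ 1 := min_le_left _ _
  have hd2 : del * (1 + 2 * T) ≤ R := by
    rw [← le_div_iff₀ (by positivity)]; exact min_le_right _ _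
  have h4 : (i * lam - j * mu) ^ 2 + i * lam ^ 2 + j * mu ^ 2 ≤ R := by
    have e1 : (i * lam - j * mu) ^ 2 ≤ del := by
      rw [← sq_abs]; nlinarith [abs_nonneg (i * lam - j * mu)]
    have e2 : (i : ℝ) * lam ^ 2 ≤ T * del := by
      have : (i : ℝ) * lam ^ 2 = (i * lam) * lam := by ring
      rw [this]; gcongr
    have e3 : (j : ℝ) * mu ^ 2 ≤ T * del := by
      have : (j : ℝ) * mu ^ 2 = (j * mu) * mu := by ring
      rw [this]; gcongr
    linarith
  have h5 : M * √((i * lam - j * mu) ^ 2 + i * lam ^ 2 + j * mu ^ 2) ≤ eta / 2 := by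
    have : √((i * lam - j * mu) ^ 2 + i * lam ^ 2 + j * mu ^ 2) ≤ eta / 2 / (M + 1) :=
      (Real.sqrt_le_sqrt h4).trans (by rw [hR, Real.sqrt_sq (by positivity)])
    calc _ ≤ M * (eta / 2 / (M + 1)) := by gcongr
      _ ≤ (M + 1) * (eta / 2 / (M + 1)) := by gcongr; linarith
      _ = eta / 2 := by field_simp
  have h6 := norm_sub_le_norm_sub_add_norm_sub ((J lam)^[i] x) ((J lam)^[i] y) ((J mu)^[j] x)
  have h7 := norm_sub_le_norm_sub_add_norm_sub ((J lam)^[i] y) ((J mu)^[j] y) ((J mu)^[j] x)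
  rw [norm_sub_rev ((J mu)^[j] y)] at h7
  linarith

theorem cauchySeq_iterate [CompleteSpace X] (h : IsResolventFamily K D J) {x : X} (hx : x ∈ K)
    {t : ℝ} (ht : 0 ≤ t) : CauchySeq (fun n : ℕ => (J (t / n))^[n] x) := by
  rcases ht.eq_or_lt with rfl | ht
  · have : (fun n : ℕ => (J ((0 : ℝ) / n))^[n] x) = fun _ => x := by
      funext n
      rw [zero_div]
      exact Function.iterate_fixed (h.zero x) n
    rw [this]
    exact cauchySeq_const x
  rw [Metric.cauchySeq_iff]
  intro eta heta
  obtain ⟨del, hdel, H⟩ := h.iterate_cauchy hx ht.le (half_pos heta)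
  obtain ⟨N, hN⟩ := exists_nat_gt (t / del)
  have hNpos : (0 : ℝ) < N := lt_trans (by positivity) hN
  have key : ∀ n ≥ N, 0 < t / n ∧ t / n ≤ del ∧ (n : ℝ) * (t / n) = t := by
    intro n hn
    have hn' : (N : ℝ) ≤ n := by exact_mod_cast hn
    have hn0 : (0 : ℝ) < n := hNpos.trans_le hn'
    refine ⟨by positivity, ?_, by field_simp⟩
    rw [div_le_iff₀ hn0]
    rw [div_lt_iff₀ hdel] at hN
    nlinarith
  refine ⟨N, fun m hm n hn => ?_⟩
  obtain ⟨a1, a2, a3⟩ := key m hm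
  obtain ⟨b1, b2, b3⟩ := key n hn
  rw [dist_eq_norm]
  refine (H _ _ a1 a2 b1 b2 m n a3.le b3.le ?_).trans_lt (half_lt_self heta)
  rw [a3, b3]; simpa using hdel.le

/-- The trajectory `lim (J (t / n))^n x` for `t ≥ 0` (an arbitrary value where the limit does
not exist). -/
def flow (J : ℝ → X → X) (x : X) (t : ℝ) : X :=
  limUnder atTop (fun n : ℕ => (J (t / n))^[n] x)

/-- Summation of the discrete evolution equation over `m` steps along which `b` stays close to
`B`. -/
theorem abs_iterate_sub_le (h : IsResolventFamily K D J) {a b : X → ℝ}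
    (hab : ∀ lam, 0 < lam → ∀ x ∈ K, a (J lam x) - a x = lam * b (J lam x)) {x : X} (hx : x ∈ K)
    {lam : ℝ} (hl : 0 < lam) {B eta : ℝ} (i m : ℕ)
    (H : ∀ k, i < k → k ≤ i + m → |b ((J lam)^[k] x) - B| ≤ eta) :
    |a ((J lam)^[i + m] x) - a ((J lam)^[i] x) - m * lam * B| ≤ m * lam * eta := by
  induction m with
  | zero => simp
  | succ m ih =>
    have h1 := ih (fun k hk hk' => H k hk (by omega))
    have h2 := hab lam hl _ (h.iterate_mem hl hx (i + m))
    rw [← Function.iterate_succ_apply' (J lam)] at h2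
    have h3 := H (i + m + 1) (by omega) (by omega)
    rw [← Nat.add_assoc]
    have h4 : a ((J lam)^[i + m + 1] x) - a ((J lam)^[i] x) - ((m + 1 : ℕ) : ℝ) * lam * B =
        (a ((J lam)^[i + m] x) - a ((J lam)^[i] x) - m * lam * B)
          + lam * (b ((J lam)^[i + m + 1] x) - B) := by
      push_cast
      linarith [h2]
    rw [h4]
    refine (abs_add_le _ _).trans ?_
    rw [abs_mul, abs_of_pos hl]
    push_cast
    nlinarith

variable [CompleteSpace X]

theorem tendsto_flow (h : IsResolventFamily K D J) {x : X} (hx : x ∈ K) {t : ℝ} (ht : 0 ≤ t) :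
    Tendsto (fun n : ℕ => (J (t / n))^[n] x) atTop (𝓝 (flow J x t)) :=
  (h.cauchySeq_iterate hx ht).tendsto_limUnder

theorem flow_zero (h : IsResolventFamily K D J) {x : X} (hx : x ∈ K) : flow J x 0 = x := by
  refine tendsto_nhds_unique (h.tendsto_flow hx le_rfl) ?_
  have : (fun n : ℕ => (J ((0 : ℝ) / n))^[n] x) = fun _ => x := by
    funext n
    rw [zero_div]
    exact Function.iterate_fixed (h.zero x) n
  rw [this]
  exact tendsto_const_nhds

theorem flow_mem (h : IsResolventFamily K D J) {x : X} (hx : x ∈ K) {t : ℝ} (ht : 0 ≤ t) :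
    flow J x t ∈ K := by
  rcases ht.eq_or_lt with rfl | ht
  · rwa [h.flow_zero hx]
  refine h.isClosed.mem_of_tendsto (h.tendsto_flow hx ht.le) ?_
  filter_upwards [eventually_gt_atTop 0] with n hn
  have : (0 : ℝ) < n := by exact_mod_cast hn
  exact h.iterate_mem (by positivity) hx n

/-- The discrete trajectories approximate the limit trajectory, uniformly on bounded times. -/
theorem iterate_sub_flow_le (h : IsResolventFamily K D J) {x : X} (hx : x ∈ K) {T eta : ℝ}
    (hT : 0 ≤ T) (heta : 0 < eta) :
    ∃ del > 0, ∀ lam : ℝ, 0 < lam → lam ≤ del → ∀ (i : ℕ) (t : ℝ), i * lam ≤ T → 0 ≤ t → t ≤ T →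
      |i * lam - t| ≤ del → ‖(J lam)^[i] x - flow J x t‖ ≤ eta := by
  obtain ⟨del, hdel, H⟩ := h.iterate_cauchy hx hT heta
  refine ⟨del, hdel, fun lam hl hl' i t hi ht htT hit => ?_⟩
  rcases ht.eq_or_lt with rfl | ht
  · rw [h.flow_zero hx]
    simpa using H lam lam hl hl' hl hl' i 0 hi (by simpa) (by simpa using hit)
  refine le_of_tendsto ((tendsto_const_nhds.sub (h.tendsto_flow hx ht.le)).norm) ?_
  obtain ⟨N, hN⟩ := exists_nat_gt (t / del)
  have hNpos : (0 : ℝ) < N := lt_trans (by positivity) hN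
  filter_upwards [eventually_ge_atTop N] with n hn
  have hn' : (N : ℝ) ≤ n := by exact_mod_cast hn
  have hn0 : (0 : ℝ) < n := hNpos.trans_le hn'
  have e : (n : ℝ) * (t / n) = t := by field_simp
  refine H lam (t / n) hl hl' (by positivity) ?_ i n hi (e.le.trans htT) (by rwa [e])
  rw [div_le_iff₀ hn0]
  rw [div_lt_iff₀ hdel] at hN
  nlinarith

theorem tendstoUniformlyOn_flow (h : IsResolventFamily K D J) {x : X} (hx : x ∈ K) {T : ℝ}
    (hT : 0 ≤ T) :
    TendstoUniformlyOn (fun (n : ℕ) (t : ℝ) => (J (t / n))^[n] x) (flow J x) atTop (Icc 0 T) := by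
  rw [Metric.tendstoUniformlyOn_iff]
  intro eta heta
  obtain ⟨del, hdel, H⟩ := h.iterate_sub_flow_le hx hT (half_pos heta)
  obtain ⟨N, hN⟩ := exists_nat_gt (T / del)
  have hNpos : (0 : ℝ) < N := lt_of_le_of_lt (by positivity) hN
  filter_upwards [eventually_ge_atTop N] with n hn t ht
  rw [dist_comm, dist_eq_norm]
  rcases ht.1.eq_or_lt with rfl | ht0
  · rw [zero_div, Function.iterate_fixed (h.zero x) n, h.flow_zero hx]
    simpa
  have hn' : (N : ℝ) ≤ n := by exact_mod_cast hn
  have hn0 : (0 : ℝ) < n := hNpos.trans_le hn'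
  have e : (n : ℝ) * (t / n) = t := by field_simp
  refine (H (t / n) (by positivity) ?_ n t (e.le.trans ht.2) ht.1 ht.2 ?_).trans_lt
    (half_lt_self heta)
  · rw [div_le_iff₀ hn0]
    rw [div_lt_iff₀ hdel] at hN
    nlinarith [ht.2]
  · rw [e]; simpa using hdel.le

theorem continuousOn_flow (h : IsResolventFamily K D J) {x : X} (hx : x ∈ K) :
    ContinuousOn (flow J x) (Ici 0) := by
  rw [Metric.continuousOn_iff]
  intro t ht eta heta
  obtain ⟨del, hdel, H⟩ := h.iterate_sub_flow_le hx (T := t + 1) (by linarith [mem_Ici.1 ht])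
    (half_pos heta)
  refine ⟨min del 1, by positivity, fun s hs hst => ?_⟩
  rw [Real.dist_eq] at hst
  have hst1 := hst.trans_le (min_le_left _ _)
  have hst2 := hst.trans_le (min_le_right _ _)
  rw [mem_Ici] at hs ht
  rw [abs_lt] at hst2
  refine lt_of_le_of_lt ?_ (half_lt_self heta)
  rw [dist_eq_norm]
  rcases hs.eq_or_lt with rfl | hs0
  · rw [h.flow_zero hx]
    simpa using H del hdel le_rfl 0 t (by simp; linarith) ht (by linarith)
      (by simpa using hst1.le)
  refine le_of_tendsto (((h.tendsto_flow hx hs).sub tendsto_const_nhds).norm) ?_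
  obtain ⟨N, hN⟩ := exists_nat_gt (s / del)
  have hNpos : (0 : ℝ) < N := lt_trans (by positivity) hN
  filter_upwards [eventually_ge_atTop N] with n hn
  have hn' : (N : ℝ) ≤ n := by exact_mod_cast hn
  have hn0 : (0 : ℝ) < n := hNpos.trans_le hn'
  have e : (n : ℝ) * (s / n) = s := by field_simp
  refine H (s / n) (by positivity) ?_ n t (by rw [e]; linarith) ht (by linarith) ?_
  · rw [div_le_iff₀ hn0]
    rw [div_lt_iff₀ hdel] at hN
    nlinarith
  · rw [e]; exact hst1.le

/-- The discrete evolution equation `(a (J x) - a x) / lam = b (J x)` passes to the limit: along the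
trajectory, `a` is differentiable with derivative `b`. -/
theorem hasDerivAt_flow (h : IsResolventFamily K D J) {a b : X → ℝ} (ha : ContinuousOn a K)
    (hb : ContinuousOn b K)
    (hab : ∀ lam, 0 < lam → ∀ x ∈ K, a (J lam x) - a x = lam * b (J lam x)) {x : X} (hx : x ∈ K)
    {t : ℝ} (ht : 0 < t) : HasDerivAt (fun s => a (flow J x s)) (b (flow J x t)) t := by
  -- near `t` the increments of `a` along the trajectory are those of a function with slope `b`
  have key : ∀ eta > 0, ∃ del > 0, del ≤ t ∧ ∀ s s', t - del ≤ s → s ≤ s' → s' ≤ t + del →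
      |a (flow J x s') - a (flow J x s) - (s' - s) * b (flow J x t)| ≤ (s' - s) * eta := by
    intro eta heta
    have hbt := Metric.continuousOn_iff.1 hb _ (h.flow_mem hx ht.le) eta heta
    obtain ⟨r, hr, Hr⟩ := hbt
    obtain ⟨del, hdel, H⟩ := h.iterate_sub_flow_le hx (T := t + 1) (by linarith) (half_pos hr)
    set d1 := min (min (del / 2) (t / 2)) 1 with hd1
    have hd1pos : 0 < d1 := by positivity
    have hd1a : d1 ≤ del / 2 := (min_le_left _ _).trans (min_le_left _ _)
    have hd1b : d1 ≤ t / 2 := (min_le_left _ _).trans (min_le_right _ _)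
    have hd1c : d1 ≤ 1 := min_le_right _ _
    refine ⟨d1, hd1pos, by linarith, fun s s' hs hss' hs' => ?_⟩
    have hs0 : 0 ≤ s := by linarith
    have hs0' : 0 ≤ s' := hs0.trans hss'
    -- the step sizes `1 / (n + 1)` and the indices of the grid points below `s` and `s'`
    let l : ℕ → ℝ := fun n => 1 / ((n : ℝ) + 1)
    have hl0 : ∀ n, 0 < l n := fun n => by positivity
    have hl : Tendsto l atTop (𝓝 0) := tendsto_one_div_add_atTop_nhds_zero_nat
    have grid : ∀ u, 0 ≤ u → ∀ n, ((⌊u / l n⌋₊ : ℕ) : ℝ) * l n ≤ u ∧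
        u - l n ≤ ((⌊u / l n⌋₊ : ℕ) : ℝ) * l n := by
      intro u hu n
      have h1 := Nat.floor_le (div_nonneg hu (hl0 n).le)
      have h2 := Nat.lt_floor_add_one (u / l n)
      rw [le_div_iff₀ (hl0 n)] at h1
      rw [div_lt_iff₀ (hl0 n)] at h2
      exact ⟨h1, by linarith⟩
    have gridlim : ∀ u, 0 ≤ u → Tendsto (fun n => ((⌊u / l n⌋₊ : ℕ) : ℝ) * l n) atTop (𝓝 u) := by
      intro u hu
      refine tendsto_of_tendsto_of_tendsto_of_le_of_le ?_ tendsto_const_nhds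
        (fun n => (grid u hu n).2) (fun n => (grid u hu n).1)
      simpa using tendsto_const_nhds.sub hl
    have lim : ∀ u, 0 ≤ u → u ≤ t + 1 →
        Tendsto (fun n => a ((J (l n))^[⌊u / l n⌋₊] x)) atTop (𝓝 (a (flow J x u))) := by
      intro u hu hut
      refine (ha _ (h.flow_mem hx hu)).tendsto.comp (tendsto_nhdsWithin_iff.2
        ⟨?_, Eventually.of_forall fun n => h.iterate_mem (hl0 n) hx _⟩)
      rw [Metric.tendsto_nhds]
      intro e he
      obtain ⟨d2, hd2, H2⟩ := h.iterate_sub_flow_le hx (T := t + 1) (by linarith) (half_pos he)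
      filter_upwards [hl.eventually (gt_mem_nhds hd2)] with n hn
      rw [dist_eq_norm]
      refine (H2 (l n) (hl0 n) hn.le _ u ((grid u hu n).1.trans hut) hu hut ?_).trans_lt
        (half_lt_self he)
      rw [abs_le]
      constructor <;> linarith [(grid u hu n).1, (grid u hu n).2]
    have hlim := (((lim s' hs0' (by linarith)).sub (lim s hs0 (by linarith))).sub
      (((gridlim s' hs0').sub (gridlim s hs0)).mul_const (b (flow J x t)))).abs
    refine le_of_tendsto_of_tendsto hlim
      (((gridlim s' hs0').sub (gridlim s hs0)).mul_const eta) ?_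
    filter_upwards [hl.eventually (gt_mem_nhds (show 0 < min del d1 by positivity))] with n hn
    have hn1 : l n < del := hn.trans_le (min_le_left _ _)
    have hn2 : l n < d1 := hn.trans_le (min_le_right _ _)
    have hle : ⌊s / l n⌋₊ ≤ ⌊s' / l n⌋₊ :=
      Nat.floor_mono (div_le_div_of_nonneg_right hss' (hl0 n).le)
    obtain ⟨m, hm⟩ := Nat.exists_eq_add_of_le hle
    have := h.abs_iterate_sub_le hab hx (hl0 n) (B := b (flow J x t)) (eta := eta)
      ⌊s / l n⌋₊ m ?_
    · rw [hm]
      push_cast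
      have e : ((⌊s / l n⌋₊ : ℝ) + m) * l n - ⌊s / l n⌋₊ * l n = m * l n := by ring
      rw [e]
      exact this
    · intro k hk1 hk2
      rw [← hm] at hk2
      have hk1' : ((⌊s / l n⌋₊ : ℕ) : ℝ) * l n ≤ k * l n := by
        have := (hl0 n).le
        gcongr
      have hk2' : k * l n ≤ ((⌊s' / l n⌋₊ : ℕ) : ℝ) * l n := by
        have := (hl0 n).le
        gcongr
      have g1 := (grid s hs0 n).2
      have g2 := (grid s' hs0' n).1
      have := H (l n) (hl0 n) hn1.le k t (by linarith) ht.le (by linarith)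
        (by rw [abs_le]; constructor <;> linarith)
      have := Hr _ (h.iterate_mem (hl0 n) hx k) (by rw [dist_eq_norm]; linarith)
      rw [Real.dist_eq] at this
      exact this.le
  rw [hasDerivAt_iff_isLittleO, Asymptotics.isLittleO_iff]
  intro eta heta
  obtain ⟨del, hdel, hdt, H⟩ := key eta heta
  have hmem : Ioo (t - del) (t + del) ∈ 𝓝 t := Ioo_mem_nhds (by linarith) (by linarith)
  filter_upwards [hmem] with s hs
  rw [Real.norm_eq_abs, Real.norm_eq_abs, smul_eq_mul]
  rcases le_total t s with hts | hts
  · have := H t s (by linarith) hts hs.2.le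
    rw [abs_of_nonneg (sub_nonneg.2 hts)]
    linarith
  · have := H s t hs.1.le hts (by linarith)
    rw [abs_of_nonpos (sub_nonpos.2 hts), abs_sub_comm]
    have e : (s - t) * b (flow J x t) - (a (flow J x s) - a (flow J x t)) =
      a (flow J x t) - a (flow J x s) - (t - s) * b (flow J x t) := by ring
    rw [e]
    linarith

end IsResolventFamily

/-! ### Mollification -/

/-- A sequence of bump functions shrinking to the origin. -/
def shrinkingBump (d n : ℕ) : ContDiffBump (0 : Ed d) where
  rIn := 1 / (n + 1) / 2
  rOut := 1 / (n + 1)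
  rIn_pos := by positivity
  rIn_lt_rOut := half_lt_self (by positivity)

/-- The standard smooth kernel of unit mass, supported in the ball of radius `1 / (n + 1)`. -/
def mollifierKernel (d n : ℕ) : Ed d → ℝ := (shrinkingBump d n).normed volume

/-- The mollification of `g` at scale `1 / (n + 1)`. -/
def mollify {d : ℕ} (n : ℕ) (g : Ed d → ℝ) (x : Ed d) : ℝ :=
  ∫ t, g t * mollifierKernel d n (x - t)

section Mollify

variable {d : ℕ}

theorem mollifierKernel_nonneg (n : ℕ) (x : Ed d) : 0 ≤ mollifierKernel d n x :=
  (shrinkingBump d n).nonneg_normed x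

theorem contDiff_mollifierKernel (n : ℕ) : ContDiff ℝ ∞ (mollifierKernel d n) :=
  (shrinkingBump d n).contDiff_normed

theorem hasCompactSupport_mollifierKernel (n : ℕ) : HasCompactSupport (mollifierKernel d n) :=
  (shrinkingBump d n).hasCompactSupport_normed

theorem integrable_mollifierKernel (n : ℕ) : Integrable (mollifierKernel d n) :=
  (contDiff_mollifierKernel n).continuous.integrable_of_hasCompactSupport
    (hasCompactSupport_mollifierKernel n)

theorem integral_mollifierKernel (n : ℕ) : ∫ x, mollifierKernel d n x = 1 :=
  (shrinkingBump d n).integral_normed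

theorem integral_mollifierKernel_sub (n : ℕ) (x : Ed d) :
    ∫ t, mollifierKernel d n (x - t) = 1 := by
  rw [integral_sub_left_eq_self (mollifierKernel d n) volume x, integral_mollifierKernel]

theorem mollify_eq_convolution (n : ℕ) (g : Ed d → ℝ) :
    mollify n g = convolution g (mollifierKernel d n) (ContinuousLinearMap.mul ℝ ℝ) volume := rfl

theorem mollify_eq_bump_convolution (n : ℕ) (g : Ed d → ℝ) (x : Ed d) :
    mollify n g x = convolution ((shrinkingBump d n).normed volume) g
      (ContinuousLinearMap.lsmul ℝ ℝ) volume x := by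
  rw [convolution_eq_swap]
  refine integral_congr_ae (Eventually.of_forall fun t => ?_)
  simp [mollifierKernel, mul_comm]

theorem tendsto_shrinkingBump : Tendsto (fun n => (shrinkingBump d n).rOut) atTop (𝓝 0) :=
  tendsto_one_div_add_atTop_nhds_zero_nat

theorem tendsto_mollify_of_continuous {g : Ed d → ℝ} (hg : Continuous g) (x : Ed d) :
    Tendsto (fun n => mollify n g x) atTop (𝓝 (g x)) := by
  simp_rw [mollify_eq_bump_convolution]
  exact ContDiffBump.convolution_tendsto_right_of_continuous tendsto_shrinkingBump hg x

theorem ae_tendsto_mollify {g : Ed d → ℝ} (hg : LocallyIntegrable g) :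
    ∀ᵐ x, Tendsto (fun n => mollify n g x) atTop (𝓝 (g x)) := by
  simp_rw [mollify_eq_bump_convolution]
  exact ContDiffBump.ae_convolution_tendsto_right_of_locallyIntegrable tendsto_shrinkingBump
    (K := 2) (Eventually.of_forall fun n => by simp only [shrinkingBump]; linarith) hg

theorem contDiff_mollify {g : Ed d → ℝ} (hg : LocallyIntegrable g) (n : ℕ) :
    ContDiff ℝ ∞ (mollify n g) :=
  (hasCompactSupport_mollifierKernel n).contDiff_convolution_right (ContinuousLinearMap.mul ℝ ℝ) hg
    (contDiff_mollifierKernel n)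

theorem hasCompactSupport_mollify {g : Ed d → ℝ} (hg : HasCompactSupport g) (n : ℕ) :
    HasCompactSupport (mollify n g) :=
  HasCompactSupport.convolution (ContinuousLinearMap.mul ℝ ℝ) hg
    (hasCompactSupport_mollifierKernel n)

theorem integrable_mul_mollifierKernel {g : Ed d → ℝ} (hg : LocallyIntegrable g) (n : ℕ)
    (x : Ed d) : Integrable (fun t => g t * mollifierKernel d n (x - t)) := by
  have hc : Continuous fun t => mollifierKernel d n (x - t) :=
    (contDiff_mollifierKernel n).continuous.comp (continuous_const.sub continuous_id)
  have hs : HasCompactSupport fun t => mollifierKernel d n (x - t) :=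
    (hasCompactSupport_mollifierKernel n).comp_homeomorph (Homeomorph.subLeft x)
  simpa [mul_comm] using hg.integrable_smul_left_of_hasCompactSupport hc hs

theorem mollify_sub {f g : Ed d → ℝ} (hf : LocallyIntegrable f) (hg : LocallyIntegrable g) (n : ℕ)
    (x : Ed d) : mollify n (fun y => f y - g y) x = mollify n f x - mollify n g x := by
  simp only [mollify, sub_mul]
  exact integral_sub (integrable_mul_mollifierKernel hf n x) (integrable_mul_mollifierKernel hg n x)

theorem abs_mollify_le {g : Ed d → ℝ} {C : ℝ} (hC : ∀ᵐ y, |g y| ≤ C) (n : ℕ) (x : Ed d) :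
    |mollify n g x| ≤ C := by
  have h1 : ‖mollify n g x‖ ≤ ∫ t, C * mollifierKernel d n (x - t) := by
    refine norm_integral_le_of_norm_le
      (((integrable_mollifierKernel n).comp_sub_left x).const_mul C) ?_
    filter_upwards [hC] with t ht
    rw [norm_mul, Real.norm_eq_abs, Real.norm_of_nonneg (mollifierKernel_nonneg _ _)]
    exact mul_le_mul_of_nonneg_right ht (mollifierKernel_nonneg _ _)
  rwa [integral_const_mul, integral_mollifierKernel_sub, mul_one] at h1

theorem integrable_mollify {g : Ed d → ℝ} (hg : Integrable g) (n : ℕ) :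
    Integrable (mollify n g) :=
  hg.integrable_convolution (ContinuousLinearMap.mul ℝ ℝ) (integrable_mollifierKernel n)

theorem integral_abs_mollify_le {g : Ed d → ℝ} (hg : Integrable g) (n : ℕ) :
    ∫ x, |mollify n g x| ≤ ∫ x, |g x| := by
  have h1 : ∫ x, |mollify n g x| ≤ ∫ x, mollify n (fun y => |g y|) x := by
    refine integral_mono (integrable_mollify hg n).abs (integrable_mollify hg.abs n) fun x => ?_
    rw [← Real.norm_eq_abs]
    refine (norm_integral_le_integral_norm _).trans_eq ?_
    refine integral_congr_ae (Eventually.of_forall fun t => ?_)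
    simp [abs_of_nonneg (mollifierKernel_nonneg n (x - t))]
  refine h1.trans_eq ?_
  rw [mollify_eq_convolution, integral_convolution _ hg.abs (integrable_mollifierKernel n),
    integral_mollifierKernel]
  simp

theorem mollify_eq_zero_of_notMem {g : Ed d → ℝ} (n : ℕ) {x : Ed d}
    (hx : x ∉ Metric.closedBall (0 : Ed d) 1 + tsupport g) : mollify n g x = 0 := by
  by_contra h
  apply hx
  have h1 := support_convolution_subset (ContinuousLinearMap.mul ℝ ℝ) (μ := volume)
    (f := g) (g := mollifierKernel d n) h
  obtain ⟨a, ha, b, hb, rfl⟩ := h1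
  refine ⟨b, ?_, a, subset_tsupport _ ha, add_comm b a⟩
  have h2 : b ∈ Metric.ball (0 : Ed d) (1 / (n + 1)) := by
    rw [mollifierKernel, ContDiffBump.support_normed_eq] at hb
    exact hb
  rw [mem_ball_zero_iff] at h2
  rw [mem_closedBall_zero_iff]
  refine h2.le.trans ?_
  rw [div_le_one (by positivity)]
  simp

theorem tendsto_integral_abs_mollify_sub_of_continuous {g : Ed d → ℝ} (hg : Continuous g)
    (hs : HasCompactSupport g) : Tendsto (fun n => ∫ x, |mollify n g x - g x|) atTop (𝓝 0) := by
  obtain ⟨C, hC⟩ := hg.bounded_above_of_compact_support hs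
  have hK : IsCompact (Metric.closedBall (0 : Ed d) 1 + tsupport g) :=
    (isCompact_closedBall 0 1).add hs
  have := tendsto_integral_of_dominated_convergence
    (F := fun n x => |mollify n g x - g x|) (f := fun _ => 0)
    (indicator (Metric.closedBall (0 : Ed d) 1 + tsupport g) fun _ => 2 * C) (μ := volume)
    ?_ ?_ ?_ ?_
  · simpa using this
  · intro n
    exact ((contDiff_mollify hg.locallyIntegrable n).continuous.sub hg).abs.aestronglyMeasurable
  · rw [integrable_indicator_iff hK.measurableSet]
    exact integrableOn_const hK.measure_lt_top.ne
  · intro n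
    refine Eventually.of_forall fun x => ?_
    rw [Real.norm_eq_abs, abs_abs]
    by_cases hx : x ∈ Metric.closedBall (0 : Ed d) 1 + tsupport g
    · rw [indicator_of_mem hx]
      have h1 := abs_mollify_le (Eventually.of_forall hC) n x
      have h2 := hC x
      rw [Real.norm_eq_abs] at h2
      linarith [abs_sub (mollify n g x) (g x)]
    · rw [indicator_of_notMem hx, mollify_eq_zero_of_notMem n hx]
      have : g x = 0 := by
        by_contra h
        refine hx ⟨0, by simp, x, subset_tsupport _ h, by simp⟩
      simp [this]
  · refine Eventually.of_forall fun x => ?_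
    simpa using ((tendsto_mollify_of_continuous hg x).sub_const (g x)).abs

/-- Mollifications converge in `L¹`. -/
theorem tendsto_integral_abs_mollify_sub {g : Ed d → ℝ} (hg : Integrable g) :
    Tendsto (fun n => ∫ x, |mollify n g x - g x|) atTop (𝓝 0) := by
  rw [Metric.tendsto_nhds]
  intro e he
  obtain ⟨h, hs, hgh, hc, hi⟩ := hg.exists_hasCompactSupport_integral_sub_le
    (show 0 < e / 4 by positivity)
  have h1 := (tendsto_integral_abs_mollify_sub_of_continuous hc hs).eventually
    (gt_mem_nhds (show 0 < e / 4 by positivity))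
  filter_upwards [h1] with n hn
  have hgh' : Integrable (fun y => g y - h y) := hg.sub hi
  have h2 := (integral_abs_mollify_le hgh' n).trans hgh
  have h3 : ∫ x, |mollify n g x - g x| ≤ ∫ x, (|mollify n (fun y => g y - h y) x|
      + |mollify n h x - h x| + |g x - h x|) := by
    refine integral_mono ((integrable_mollify hg n).sub hg).abs
      (((integrable_mollify hgh' n).abs.add ((integrable_mollify hi n).sub hi).abs).add
        hgh'.abs) fun x => ?_
    dsimp only
    rw [mollify_sub hg.locallyIntegrable hi.locallyIntegrable]
    have e1 : mollify n g x - g x = (mollify n g x - mollify n h x) + (mollify n h x - h x)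
      - (g x - h x) := by ring
    rw [e1]
    exact (abs_sub _ _).trans (by gcongr; exact abs_add_le _ _)
  have i1 : Integrable fun x => |mollify n (fun y => g y - h y) x| :=
    (integrable_mollify hgh' n).abs
  have i2 : Integrable fun x => |mollify n h x - h x| := ((integrable_mollify hi n).sub hi).abs
  have i3 : Integrable fun x => |mollify n (fun y => g y - h y) x| + |mollify n h x - h x| :=
    i1.add i2
  rw [integral_add i3 hgh'.abs, integral_add i1 i2] at h3
  simp only [Real.norm_eq_abs] at hgh
  rw [Real.dist_eq, sub_zero, abs_of_nonneg (integral_nonneg fun x => abs_nonneg _)]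
  linarith

theorem fderiv_mollify_apply {g : Ed d → ℝ} (hg : LocallyIntegrable g) (n : ℕ) (x e : Ed d) :
    fderiv ℝ (mollify n g) x e = ∫ t, g t * fderiv ℝ (mollifierKernel d n) (x - t) e := by
  have hk : ContDiff ℝ 1 (mollifierKernel d n) := (contDiff_mollifierKernel n).of_le (by simp)
  have h1 := (hasCompactSupport_mollifierKernel n).hasFDerivAt_convolution_right
    (ContinuousLinearMap.mul ℝ ℝ) hg hk x
  rw [mollify_eq_convolution, h1.fderiv, convolution_precompR_apply _ hg
    ((hasCompactSupport_mollifierKernel n).fderiv ℝ) (hk.continuous_fderiv (by simp))]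
  rfl

/-- If `g` is the weak derivative of `f` in the direction `e`, then mollification commutes with
it. -/
theorem fderiv_mollify_eq {f g : Ed d → ℝ} {e : Ed d} (hf : LocallyIntegrable f)
    (h : ∀ ψ : Ed d → ℝ, ContDiff ℝ ∞ ψ → HasCompactSupport ψ →
      ∫ y, f y * fderiv ℝ ψ y e = - ∫ y, ψ y * g y) (n : ℕ) (x : Ed d) :
    fderiv ℝ (mollify n f) x e = mollify n g x := by
  rw [fderiv_mollify_apply hf]
  have hc : ContDiff ℝ ∞ fun t => mollifierKernel d n (x - t) :=
    (contDiff_mollifierKernel n).comp (contDiff_const.sub contDiff_id)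
  have hs : HasCompactSupport fun t => mollifierKernel d n (x - t) :=
    (hasCompactSupport_mollifierKernel n).comp_homeomorph (Homeomorph.subLeft x)
  have h1 := h _ hc hs
  have h2 : ∀ y, fderiv ℝ (fun t => mollifierKernel d n (x - t)) y e
      = - fderiv ℝ (mollifierKernel d n) (x - y) e := by
    intro y
    have h3 : HasFDerivAt (mollifierKernel d n) (fderiv ℝ (mollifierKernel d n) (x - y)) (x - y) :=
      ((contDiff_mollifierKernel n).differentiable (by simp) _).hasFDerivAt
    have h4 : HasFDerivAt (fun t : Ed d => x - t) (-ContinuousLinearMap.id ℝ (Ed d)) y :=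
      (hasFDerivAt_id y).const_sub x
    have h5 : HasFDerivAt (fun t => mollifierKernel d n (x - t)) _ y := h3.comp y h4
    rw [h5.fderiv]
    simp
  simp_rw [h2, mul_neg, integral_neg, neg_inj] at h1
  rw [h1, mollify]
  simp_rw [mul_comm]

theorem fderiv_mollify_of_contDiff {f : Ed d → ℝ} (hf : ContDiff ℝ 1 f) (n : ℕ) (x e : Ed d) :
    fderiv ℝ (mollify n f) x e = mollify n (fun y => fderiv ℝ f y e) x := by
  refine fderiv_mollify_eq hf.continuous.locallyIntegrable (fun ψ hψ hs => ?_) n x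
  have hfd : Continuous fun y => fderiv ℝ f y e := (hf.continuous_fderiv (by simp)).clm_apply
    continuous_const
  have hψd : Continuous fun y => fderiv ℝ ψ y e :=
    (hψ.continuous_fderiv (by simp)).clm_apply continuous_const
  have hψds : HasCompactSupport fun y => fderiv ℝ ψ y e := hs.fderiv_apply (𝕜 := ℝ) e
  rw [integral_mul_fderiv_eq_neg_fderiv_mul_of_integrable
    ((hfd.mul hψ.continuous).integrable_of_hasCompactSupport hs.mul_left)
    ((hf.continuous.mul hψd).integrable_of_hasCompactSupport hψds.mul_left)
    ((hf.continuous.mul hψ.continuous).integrable_of_hasCompactSupport hs.mul_left)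
    (fun x _ => hf.differentiable (by simp) x) (fun x _ => hψ.differentiable (by simp) x)]
  simp_rw [mul_comm]

end Mollify

/-! ### The weak gradient of a density with locally bounded logarithm -/

/-- The divergence theorem for compactly supported functions. -/
theorem integral_fderiv_eq_zero {d : ℕ} {f : Ed d → ℝ} (hf : ContDiff ℝ 1 f)
    (hs : HasCompactSupport f) (e : Ed d) : ∫ y, fderiv ℝ f y e = 0 := by
  have hfd : Continuous fun y => fderiv ℝ f y e := (hf.continuous_fderiv (by simp)).clm_apply
    continuous_const
  have h := integral_mul_fderiv_eq_neg_fderiv_mul_of_integrable (f := fun _ => (1 : ℝ)) (g := f)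
    (v := e) (μ := volume) (by simp)
    (by simpa using hfd.integrable_of_hasCompactSupport (hs.fderiv_apply (𝕜 := ℝ) e))
    (by simpa using hf.continuous.integrable_of_hasCompactSupport hs)
    (fun x _ => by fun_prop) (fun x _ => hf.differentiable (by simp) x)
  simpa using h

/-- The chain rule for the exponential of a bounded function with an integrable weak derivative. -/
theorem integral_fderiv_add_mul_exp_eq_zero {d : ℕ} {f g : Ed d → ℝ} {e : Ed d} {C : ℝ}
    (hf : Integrable f) (hC : ∀ᵐ y, |f y| ≤ C) (hg : Integrable g)
    (h : ∀ ψ : Ed d → ℝ, ContDiff ℝ ∞ ψ → HasCompactSupport ψ →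
      ∫ y, f y * fderiv ℝ ψ y e = - ∫ y, ψ y * g y)
    {θ : Ed d → ℝ} (hθ : ContDiff ℝ 1 θ) (hs : HasCompactSupport θ) :
    ∫ y, (fderiv ℝ θ y e + θ y * g y) * Real.exp (f y) = 0 := by
  have hθd : Continuous fun y => fderiv ℝ θ y e := (hθ.continuous_fderiv (by simp)).clm_apply
    continuous_const
  have hθds : HasCompactSupport fun y => fderiv ℝ θ y e := hs.fderiv_apply (𝕜 := ℝ) e
  obtain ⟨B, hB⟩ := hθ.continuous.bounded_above_of_compact_support hs
  have hsm : ∀ n, ContDiff ℝ ∞ (mollify n f) := contDiff_mollify hf.locallyIntegrable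
  have hbd : ∀ n x, |mollify n f x| ≤ C := abs_mollify_le hC
  have hexp : ∀ n x, Real.exp (mollify n f x) ≤ Real.exp C := fun n x =>
    Real.exp_le_exp.2 ((le_abs_self _).trans (hbd n x))
  have hexpm : ∀ n, Continuous fun x => Real.exp (mollify n f x) := fun n =>
    Real.continuous_exp.comp (hsm n).continuous
  have hB0 : 0 ≤ B := (norm_nonneg _).trans (hB 0)
  -- the integral against the mollified exponential vanishes by the divergence theorem
  have hzero : ∀ n, ∫ y, (fderiv ℝ θ y e + θ y * mollify n g y) * Real.exp (mollify n f y) = 0 := by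
    intro n
    have h1 : ContDiff ℝ 1 fun y => θ y * Real.exp (mollify n f y) :=
      hθ.mul (((hsm n).of_le (by simp)).exp)
    rw [← integral_fderiv_eq_zero h1 hs.mul_right e]
    refine integral_congr_ae (Eventually.of_forall fun y => ?_)
    dsimp only
    have h2 : HasFDerivAt (mollify n f) (fderiv ℝ (mollify n f) y) y :=
      ((hsm n).differentiable (by simp) y).hasFDerivAt
    have h3 : HasFDerivAt (fun y => θ y * Real.exp (mollify n f y)) _ y :=
      (hθ.differentiable (by simp) y).hasFDerivAt.mul h2.exp
    rw [h3.fderiv, ← fderiv_mollify_eq hf.locallyIntegrable h]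
    simp
    ring
  have lim1 : Tendsto (fun n => ∫ y, (fderiv ℝ θ y e + θ y * g y) * Real.exp (mollify n f y)) atTop
      (𝓝 (∫ y, (fderiv ℝ θ y e + θ y * g y) * Real.exp (f y))) := by
    have hi : Integrable fun y => fderiv ℝ θ y e + θ y * g y :=
      (hθd.integrable_of_hasCompactSupport hθds).add
        (hg.bdd_mul hθ.continuous.aestronglyMeasurable (Eventually.of_forall hB))
    refine tendsto_integral_of_dominated_convergence
      (fun y => |fderiv ℝ θ y e + θ y * g y| * Real.exp C) ?_ (hi.abs.mul_const _) ?_ ?_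
    · exact fun n => hi.aestronglyMeasurable.mul (hexpm n).aestronglyMeasurable
    · refine fun n => Eventually.of_forall fun y => ?_
      rw [norm_mul, Real.norm_eq_abs, Real.norm_eq_abs, Real.abs_exp]
      exact mul_le_mul_of_nonneg_left (hexp n y) (abs_nonneg _)
    · filter_upwards [ae_tendsto_mollify hf.locallyIntegrable] with y hy
      exact ((Real.continuous_exp.tendsto _).comp hy).const_mul _
  have lim2 : Tendsto (fun n => ∫ y, θ y * (mollify n g y - g y) * Real.exp (mollify n f y)) atTop
      (𝓝 0) := by
    have hdom := (tendsto_integral_abs_mollify_sub hg).const_mul (B * Real.exp C)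
    rw [mul_zero] at hdom
    refine squeeze_zero_norm (fun n => ?_) hdom
    rw [← integral_const_mul]
    refine norm_integral_le_of_norm_le
      ((((integrable_mollify hg n).sub hg).abs).const_mul _) (Eventually.of_forall fun y => ?_)
    rw [norm_mul, norm_mul, Real.norm_eq_abs (Real.exp _), Real.abs_exp]
    have h1 := hB y
    have h2 := hexp n y
    calc ‖θ y‖ * ‖mollify n g y - g y‖ * Real.exp (mollify n f y)
        ≤ B * ‖mollify n g y - g y‖ * Real.exp C := by gcongr
      _ = B * Real.exp C * |mollify n g y - g y| := by rw [Real.norm_eq_abs]; ring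
  have hsum : ∀ n, ∫ y, (fderiv ℝ θ y e + θ y * g y) * Real.exp (mollify n f y)
      = - ∫ y, θ y * (mollify n g y - g y) * Real.exp (mollify n f y) := by
    intro n
    have hθb : ∀ y, ‖Real.exp (mollify n f y)‖ ≤ Real.exp C := fun y => by
      rw [Real.norm_eq_abs, Real.abs_exp]; exact hexp n y
    have i1 : Integrable fun y => (fderiv ℝ θ y e + θ y * g y) * Real.exp (mollify n f y) :=
      ((hθd.integrable_of_hasCompactSupport hθds).add
        (hg.bdd_mul hθ.continuous.aestronglyMeasurable (Eventually.of_forall hB))).mul_bdd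
        (hexpm n).aestronglyMeasurable (Eventually.of_forall hθb)
    have i2 : Integrable fun y => θ y * (mollify n g y - g y) * Real.exp (mollify n f y) :=
      (((integrable_mollify hg n).sub hg).bdd_mul hθ.continuous.aestronglyMeasurable
        (Eventually.of_forall hB)).mul_bdd (hexpm n).aestronglyMeasurable (Eventually.of_forall hθb)
    rw [eq_neg_iff_add_eq_zero, ← integral_add i1 i2, ← hzero n]
    congr 1
    funext y
    ring
  simp_rw [hsum] at lim1
  have := tendsto_nhds_unique lim1 lim2.neg
  rw [this, neg_zero]

theorem HasWeakGradient.integral_mul_fderiv {d : ℕ} {f : Ed d → ℝ} {G : Ed d → Ed d}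
    (h : HasWeakGradient f G) {ψ : Ed d → ℝ} (hψ : ContDiff ℝ ∞ ψ) (hs : HasCompactSupport ψ)
    (e : Ed d) : ∫ y, f y * fderiv ℝ ψ y e = - ∫ y, ψ y * inner ℝ e (G y) := by
  have hc : Continuous (gradient ψ) :=
    (LinearIsometryEquiv.continuous _).comp (hψ.continuous_fderiv (by simp))
  have hcs : HasCompactSupport (gradient ψ) :=
    (hs.fderiv (𝕜 := ℝ)).comp_left (map_zero (InnerProductSpace.toDual ℝ (Ed d)).symm)
  have h1 := congrArg (fun z => inner ℝ e z) (h.integral_eq ψ hψ hs)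
  rw [inner_neg_right, ← integral_inner, ← integral_inner] at h1
  · simpa [inner_smul_right, inner_gradient_right] using h1
  · exact h.locallyIntegrable_grad.integrable_smul_left_of_hasCompactSupport hψ.continuous hs
  · exact h.locallyIntegrable.integrable_smul_right_of_hasCompactSupport hc hcs

theorem continuous_gradient {d : ℕ} {φ : Ed d → ℝ} (hφ : ContDiff ℝ 1 φ) :
    Continuous (gradient φ) :=
  (LinearIsometryEquiv.continuous _).comp (hφ.continuous_fderiv (by simp))

theorem norm_gradient {d : ℕ} (φ : Ed d → ℝ) (x : Ed d) : ‖gradient φ x‖ = ‖fderiv ℝ φ x‖ :=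
  LinearIsometryEquiv.norm_map _ _

theorem hasCompactSupport_gradient {d : ℕ} {φ : Ed d → ℝ} (hs : HasCompactSupport φ) :
    HasCompactSupport (gradient φ) :=
  (hs.fderiv (𝕜 := ℝ)).comp_left (map_zero (InnerProductSpace.toDual ℝ (Ed d)).symm)

theorem laplacian_eq_sum {d : ℕ} (φ : Ed d → ℝ) (y : Ed d) :
    Laplacian.laplacian φ y = ∑ i, fderiv ℝ (fderiv ℝ φ) y
      (stdOrthonormalBasis ℝ (Ed d) i) (stdOrthonormalBasis ℝ (Ed d) i) := by
  rw [InnerProductSpace.laplacian_eq_iteratedFDeriv_orthonormalBasis φ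
    (stdOrthonormalBasis ℝ (Ed d))]
  simp [iteratedFDeriv_two_apply]

namespace IsDataDensity

variable {d : ℕ} {ρ : Ed d → ℝ}

theorem isProbabilityMeasure (hρ : IsDataDensity ρ) : IsProbabilityMeasure (densityMeasure ρ) :=
  ⟨by simp [densityMeasure, hρ.isProbDensity.lintegral_eq_one]⟩

theorem measurable_ofReal (hρ : IsDataDensity ρ) : Measurable fun y => ENNReal.ofReal (ρ y) :=
  hρ.isProbDensity.measurable.ennreal_ofReal

theorem absolutelyContinuous (hρ : IsDataDensity ρ) : volume ≪ densityMeasure ρ :=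
  withDensity_absolutelyContinuous' hρ.measurable_ofReal.aemeasurable
    (Eventually.of_forall fun y => by simpa using hρ.pos y)

theorem ae_iff (hρ : IsDataDensity ρ) {p : Ed d → Prop} :
    (∀ᵐ y ∂(densityMeasure ρ), p y) ↔ ∀ᵐ y, p y :=
  ⟨fun h => hρ.absolutelyContinuous.ae_le h,
    fun h => (withDensity_absolutelyContinuous _ _).ae_le h⟩

theorem aestronglyMeasurable_iff (hρ : IsDataDensity ρ) {E : Type*} [NormedAddCommGroup E]
    {f : Ed d → E} : AEStronglyMeasurable f (densityMeasure ρ) ↔ AEStronglyMeasurable f :=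
  ⟨fun h => h.mono_ac hρ.absolutelyContinuous,
    fun h => h.mono_ac (withDensity_absolutelyContinuous _ _)⟩

theorem integral_eq (hρ : IsDataDensity ρ) {E : Type*} [NormedAddCommGroup E] [NormedSpace ℝ E]
    (f : Ed d → E) : ∫ y, f y ∂(densityMeasure ρ) = ∫ y, ρ y • f y := by
  rw [densityMeasure, integral_withDensity_eq_integral_toReal_smul hρ.measurable_ofReal
    (Eventually.of_forall fun y => ENNReal.ofReal_lt_top)]
  simp [ENNReal.toReal_ofReal (hρ.pos _).le]

theorem hasWeakGradient_log (hρ : IsDataDensity ρ) :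
    HasWeakGradient (fun y => Real.log (ρ y)) (weakGradient fun y => Real.log (ρ y)) := by
  obtain ⟨G, hG, -⟩ := hρ.log_memH1
  have h' : ∃ G, HasWeakGradient (fun y => Real.log (ρ y)) G := ⟨G, hG⟩
  rw [weakGradient, dif_pos h']
  exact h'.choose_spec

theorem memLp_weakGradient_log (hρ : IsDataDensity ρ) :
    MemLp (weakGradient fun y => Real.log (ρ y)) 2 (densityMeasure ρ) := by
  obtain ⟨G, hG, hG2⟩ := hρ.log_memH1
  refine hG2.ae_eq ?_
  exact hρ.ae_iff.2 hG.ae_eq_weakGradient.symm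

/-- On a compact set the density is bounded away from zero. -/
theorem exists_le_of_isCompact (hρ : IsDataDensity ρ) {K : Set (Ed d)} (hK : IsCompact K) :
    ∃ c > 0, ∀ᵐ y ∂(volume.restrict K), c ≤ ρ y := by
  obtain ⟨C, hC⟩ := hρ.log_locallyEssBounded.2 K hK
  refine ⟨Real.exp (-C), Real.exp_pos _, ?_⟩
  filter_upwards [hC] with y hy
  rw [← Real.exp_log (hρ.pos y)]
  exact Real.exp_le_exp.2 (abs_le.1 hy).1

theorem integrableOn_of_isCompact (hρ : IsDataDensity ρ) {E : Type*} [NormedAddCommGroup E]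
    {f : Ed d → E} (hf : Integrable f (densityMeasure ρ)) {K : Set (Ed d)} (hK : IsCompact K) :
    IntegrableOn f K := by
  obtain ⟨c, hc, hcK⟩ := hρ.exists_le_of_isCompact hK
  have h1 : ENNReal.ofReal c • volume.restrict K ≤ (densityMeasure ρ).restrict K := by
    rw [densityMeasure, restrict_withDensity hK.measurableSet, ← withDensity_const]
    refine withDensity_mono ?_
    filter_upwards [hcK] with y hy
    exact ENNReal.ofReal_le_ofReal hy
  have h2 := (hf.integrableOn (s := K)).integrable.mono_measure h1
  exact (integrable_smul_measure (by simpa using hc) ENNReal.ofReal_ne_top).1 h2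

theorem locallyIntegrable (hρ : IsDataDensity ρ) {E : Type*} [NormedAddCommGroup E]
    {f : Ed d → E} (hf : Integrable f (densityMeasure ρ)) : LocallyIntegrable f :=
  locallyIntegrable_iff.2 fun _ hK => hρ.integrableOn_of_isCompact hf hK

/-- The weak form of `∇ρ = ρ ∇ ln ρ`, tested with compactly supported `C¹` functions. -/
theorem integral_fderiv_add (hρ : IsDataDensity ρ) {θ : Ed d → ℝ} (hθ : ContDiff ℝ 1 θ)
    (hs : HasCompactSupport θ) (e : Ed d) :
    ∫ y, (fderiv ℝ θ y e + θ y * inner ℝ e (weakGradient (fun z => Real.log (ρ z)) y))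
      ∂(densityMeasure ρ) = 0 := by
  set G := weakGradient fun z => Real.log (ρ z) with hG
  set l : Ed d → ℝ := fun z => Real.log (ρ z) with hl
  have hw : HasWeakGradient l G := hρ.hasWeakGradient_log
  -- a cutoff which is `1` near the support of `θ`
  obtain ⟨R, hR0, hR⟩ : ∃ R, 0 < R ∧ tsupport θ ⊆ Metric.ball 0 R := by
    obtain ⟨R, hR⟩ := hs.isCompact.isBounded.subset_ball_lt 0 (0 : Ed d)
    exact ⟨R, hR⟩
  let χ : ContDiffBump (0 : Ed d) := ⟨R, R + 1, hR0, by linarith⟩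
  have hχ : ContDiff ℝ ∞ χ := χ.contDiff
  have hχs : HasCompactSupport χ := χ.hasCompactSupport
  have hχd : Continuous fun y => fderiv ℝ χ y e :=
    (hχ.continuous_fderiv (by simp)).clm_apply continuous_const
  have hχds : HasCompactSupport fun y => fderiv ℝ χ y e := hχs.fderiv_apply (𝕜 := ℝ) e
  have hGe : LocallyIntegrable fun y => inner ℝ e (G y) := by
    intro x
    obtain ⟨s, hs, hi⟩ := hw.locallyIntegrable_grad x
    exact ⟨s, hs, hi.const_inner e⟩
  have i1 : Integrable fun y => χ y * l y := by
    simpa using hw.locallyIntegrable.integrable_smul_left_of_hasCompactSupport χ.continuous hχs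
  have i2 : Integrable fun y => χ y * inner ℝ e (G y) := by
    simpa using hGe.integrable_smul_left_of_hasCompactSupport χ.continuous hχs
  have i3 : Integrable fun y => fderiv ℝ χ y e * l y := by
    simpa using hw.locallyIntegrable.integrable_smul_left_of_hasCompactSupport hχd hχds
  obtain ⟨C, hC⟩ := hρ.log_locallyEssBounded.2 (Metric.closedBall 0 (R + 1))
    (isCompact_closedBall _ _)
  have hbound : ∀ᵐ y, |χ y * l y| ≤ max C 0 := by
    rw [ae_restrict_iff' measurableSet_closedBall] at hC
    filter_upwards [hC] with y hy
    by_cases hyb : y ∈ Metric.closedBall (0 : Ed d) (R + 1)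
    · rw [abs_mul, abs_of_nonneg χ.nonneg]
      calc χ y * |l y| ≤ 1 * |l y| := by gcongr; exact χ.le_one
        _ ≤ max C 0 := by rw [one_mul]; exact (hy hyb).trans (le_max_left _ _)
    · have : χ y = 0 := by
        refine χ.zero_of_le_dist ?_
        rw [Metric.mem_closedBall, not_le] at hyb
        exact hyb.le
      simp [this]
  have key := integral_fderiv_add_mul_exp_eq_zero i1 hbound (i2.add i3) (e := e) ?_ hθ hs
  · rw [hρ.integral_eq, ← key]
    refine integral_congr_ae (Eventually.of_forall fun y => ?_)
    simp only [smul_eq_mul, Pi.add_apply]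
    by_cases hy : y ∈ tsupport θ
    · have hyb := hR hy
      have h1 : (χ : Ed d → ℝ) =ᶠ[𝓝 y] 1 := χ.eventuallyEq_one_of_mem_ball hyb
      have h2 : χ y = 1 := h1.eq_of_nhds
      have h3 : fderiv ℝ χ y = 0 := by rw [h1.fderiv_eq]; exact fderiv_const_apply (1 : ℝ)
      rw [h2, h3, one_mul, one_mul, hl, Real.exp_log (hρ.pos y)]
      simp [mul_comm]
    · have h1 : θ y = 0 := image_eq_zero_of_notMem_tsupport hy
      have h2 : fderiv ℝ θ y = 0 := by
        by_contra h
        exact hy (support_fderiv_subset ℝ h)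
      simp [h1, h2]
  · intro ψ hψ hψs
    have hχψ : ContDiff ℝ ∞ fun y => χ y * ψ y := hχ.mul hψ
    have h1 := hw.integral_mul_fderiv hχψ hψs.mul_left e
    have h2 : ∀ y, fderiv ℝ (fun y => χ y * ψ y) y e =
        χ y * fderiv ℝ ψ y e + ψ y * fderiv ℝ χ y e := by
      intro y
      have h3 : HasFDerivAt (fun y => χ y * ψ y) _ y :=
        (hχ.differentiable (by simp) y).hasFDerivAt.mul
          (hψ.differentiable (by simp) y).hasFDerivAt
      rw [h3.fderiv]
      simp
    simp_rw [h2] at h1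
    have hψd : Continuous fun y => fderiv ℝ ψ y e :=
      (hψ.continuous_fderiv (by simp)).clm_apply continuous_const
    obtain ⟨B, hB⟩ := hψ.continuous.bounded_above_of_compact_support hψs
    obtain ⟨B', hB'⟩ := hψd.bounded_above_of_compact_support (hψs.fderiv_apply (𝕜 := ℝ) e)
    have j1 : Integrable fun y => χ y * l y * fderiv ℝ ψ y e :=
      i1.mul_bdd hψd.aestronglyMeasurable (Eventually.of_forall hB')
    have j2 : Integrable fun y => fderiv ℝ χ y e * l y * ψ y :=
      i3.mul_bdd hψ.continuous.aestronglyMeasurable (Eventually.of_forall hB)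
    have j3 : Integrable fun y => χ y * inner ℝ e (G y) * ψ y :=
      i2.mul_bdd hψ.continuous.aestronglyMeasurable (Eventually.of_forall hB)
    have e1 : ∫ y, l y * (χ y * fderiv ℝ ψ y e + ψ y * fderiv ℝ χ y e) =
        (∫ y, χ y * l y * fderiv ℝ ψ y e) + ∫ y, fderiv ℝ χ y e * l y * ψ y := by
      rw [← integral_add j1 j2]
      refine integral_congr_ae (Eventually.of_forall fun y => ?_)
      ring
    have e2 : ∫ y, χ y * ψ y * inner ℝ e (G y) = ∫ y, χ y * inner ℝ e (G y) * ψ y := by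
      refine integral_congr_ae (Eventually.of_forall fun y => ?_)
      ring
    have e3 : ∫ y, ψ y * ((fun y => χ y * inner ℝ e (G y)) + fun y => fderiv ℝ χ y e * l y) y =
        (∫ y, χ y * inner ℝ e (G y) * ψ y) + ∫ y, fderiv ℝ χ y e * l y * ψ y := by
      rw [← integral_add j3 j2]
      refine integral_congr_ae (Eventually.of_forall fun y => ?_)
      simp only [Pi.add_apply]
      ring
    rw [e1, e2] at h1
    rw [e3]
    linarith

theorem memLp_of_continuous (hρ : IsDataDensity ρ) {E : Type*} [NormedAddCommGroup E]
    {f : Ed d → E} (hf : Continuous f) (hs : HasCompactSupport f) (p : ENNReal) :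
    MemLp f p (densityMeasure ρ) := by
  have := hρ.isProbabilityMeasure
  obtain ⟨C, hC⟩ := hf.bounded_above_of_compact_support hs
  exact MemLp.of_bound (hρ.aestronglyMeasurable_iff.2 hf.aestronglyMeasurable) C
    (Eventually.of_forall hC)

theorem memLp_inner_weakGradient_log (hρ : IsDataDensity ρ) {V : Ed d → Ed d} (hV : Continuous V)
    (hs : HasCompactSupport V) :
    MemLp (fun y => inner ℝ (weakGradient (fun z => Real.log (ρ z)) y) (V y)) 2
      (densityMeasure ρ) := by
  obtain ⟨C, hC⟩ := hV.bounded_above_of_compact_support hs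
  refine hρ.memLp_weakGradient_log.norm.of_le_mul (c := C)
    (hρ.memLp_weakGradient_log.aestronglyMeasurable.inner
      (hρ.aestronglyMeasurable_iff.2 hV.aestronglyMeasurable)) (Eventually.of_forall fun y => ?_)
  rw [norm_norm, mul_comm]
  exact (norm_inner_le_norm _ _).trans (by gcongr; exact hC y)

end IsDataDensity

section

variable {d : ℕ} {ρ : Ed d → ℝ}

theorem continuous_laplacian {φ : Ed d → ℝ} (hφ : ContDiff ℝ 2 φ) :
    Continuous (Laplacian.laplacian φ) := by
  have h1 : ContDiff ℝ 1 (fderiv ℝ φ) := hφ.fderiv_right (by norm_num)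
  have h2 := h1.continuous_fderiv (by simp)
  have h3 : Laplacian.laplacian φ = fun y => ∑ i, fderiv ℝ (fderiv ℝ φ) y
      (stdOrthonormalBasis ℝ (Ed d) i) (stdOrthonormalBasis ℝ (Ed d) i) :=
    funext (laplacian_eq_sum φ)
  rw [h3]
  exact continuous_finsetSum _ fun i _ =>
    (h2.clm_apply continuous_const).clm_apply continuous_const

theorem hasCompactSupport_laplacian {φ : Ed d → ℝ} (hs : HasCompactSupport φ) :
    HasCompactSupport (Laplacian.laplacian φ) := by
  have h1 := (hs.fderiv (𝕜 := ℝ)).fderiv (𝕜 := ℝ)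
  refine h1.mono fun y hy => ?_
  rw [Function.mem_support] at hy ⊢
  contrapose! hy
  rw [laplacian_eq_sum, hy]
  simp

theorem memLp_weightedLaplacian (hρ : IsDataDensity ρ) {φ : Ed d → ℝ} (hφ : ContDiff ℝ 2 φ)
    (hs : HasCompactSupport φ) : MemLp (weightedLaplacian ρ φ) 2 (densityMeasure ρ) :=
  (hρ.memLp_of_continuous (continuous_laplacian hφ) (hasCompactSupport_laplacian hs) 2).add
    (hρ.memLp_inner_weakGradient_log (continuous_gradient (hφ.of_le (by simp)))
      (hasCompactSupport_gradient hs))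

/-- Integration by parts for the weighted Laplacian against a `C¹` function. -/
theorem integral_mul_weightedLaplacian_of_contDiff (hρ : IsDataDensity ρ) {ψ φ : Ed d → ℝ}
    (hψ : ContDiff ℝ 1 ψ) (hψs : HasCompactSupport ψ) (hφ : ContDiff ℝ 2 φ)
    (hφs : HasCompactSupport φ) :
    ∫ y, ψ y * weightedLaplacian ρ φ y ∂(densityMeasure ρ) =
      - ∫ y, inner ℝ (gradient ψ y) (gradient φ y) ∂(densityMeasure ρ) := by
  have := hρ.isProbabilityMeasure
  set b := stdOrthonormalBasis ℝ (Ed d) with hb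
  have hφ1 : ContDiff ℝ 1 φ := hφ.of_le (by simp)
  have hfd : ContDiff ℝ 1 (fderiv ℝ φ) := hφ.fderiv_right (by norm_num)
  have hθ : ∀ i, ContDiff ℝ 1 fun y => ψ y * fderiv ℝ φ y (b i) := fun i =>
    hψ.mul (hfd.clm_apply contDiff_const)
  have hθs : ∀ i, HasCompactSupport fun y => ψ y * fderiv ℝ φ y (b i) := fun i =>
    hψs.mono fun y hy => left_ne_zero_of_mul hy
  have h0 : ∀ i, ∫ y, (fderiv ℝ (fun y => ψ y * fderiv ℝ φ y (b i)) y (b i)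
      + (ψ y * fderiv ℝ φ y (b i)) * inner ℝ (b i) (weakGradient (fun z => Real.log (ρ z)) y))
        ∂(densityMeasure ρ) = 0 := fun i => hρ.integral_fderiv_add (hθ i) (hθs i) (b i)
  have hi : ∀ i, Integrable (fun y => fderiv ℝ (fun y => ψ y * fderiv ℝ φ y (b i)) y (b i)
      + (ψ y * fderiv ℝ φ y (b i)) * inner ℝ (b i) (weakGradient (fun z => Real.log (ρ z)) y))
        (densityMeasure ρ) := by
    intro i
    have m1 : MemLp (fun y => fderiv ℝ (fun y => ψ y * fderiv ℝ φ y (b i)) y (b i)) 1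
        (densityMeasure ρ) := hρ.memLp_of_continuous (((hθ i).continuous_fderiv (by simp)).clm_apply
          continuous_const) ((hθs i).fderiv_apply (𝕜 := ℝ) (b i)) 1
    have m2 : MemLp (fun y => inner ℝ (weakGradient (fun z => Real.log (ρ z)) y)
        ((ψ y * fderiv ℝ φ y (b i)) • b i)) 2 (densityMeasure ρ) :=
      hρ.memLp_inner_weakGradient_log ((hθ i).continuous.smul continuous_const)
        ((hθs i).mono fun y hy => left_ne_zero_of_smul hy)
    refine (memLp_one_iff_integrable.1 m1).add ((m2.integrable (by norm_num)).congr
      (Eventually.of_forall fun y => ?_))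
    simp only [inner_smul_right]
    rw [real_inner_comm]
  have hsum : ∫ y, ∑ i, (fderiv ℝ (fun y => ψ y * fderiv ℝ φ y (b i)) y (b i)
      + (ψ y * fderiv ℝ φ y (b i)) * inner ℝ (b i) (weakGradient (fun z => Real.log (ρ z)) y))
        ∂(densityMeasure ρ) = 0 := by
    rw [integral_finsetSum _ fun i _ => hi i]
    exact Finset.sum_eq_zero fun i _ => h0 i
  have hpt : ∀ y, ∑ i, (fderiv ℝ (fun y => ψ y * fderiv ℝ φ y (b i)) y (b i)
      + (ψ y * fderiv ℝ φ y (b i)) * inner ℝ (b i) (weakGradient (fun z => Real.log (ρ z)) y))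
      = ψ y * weightedLaplacian ρ φ y + inner ℝ (gradient ψ y) (gradient φ y) := by
    intro y
    have h1 : ∀ i, fderiv ℝ (fun y => ψ y * fderiv ℝ φ y (b i)) y (b i) =
        ψ y * fderiv ℝ (fderiv ℝ φ) y (b i) (b i) +
          inner ℝ (gradient ψ y) (b i) * inner ℝ (b i) (gradient φ y) := by
      intro i
      have h2 : HasFDerivAt (fun y => ψ y * fderiv ℝ φ y (b i)) _ y :=
        (hψ.differentiable (by simp) y).hasFDerivAt.mul
          ((hfd.differentiable (by simp) y).hasFDerivAt.clm_apply (hasFDerivAt_const (b i) y))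
      rw [h2.fderiv, inner_gradient_left, inner_gradient_right]
      simp [mul_comm]
    have h3 : ∀ i, ψ y * fderiv ℝ φ y (b i) *
        inner ℝ (b i) (weakGradient (fun z => Real.log (ρ z)) y) =
        ψ y * (inner ℝ (weakGradient (fun z => Real.log (ρ z)) y) (b i) *
          inner ℝ (b i) (gradient φ y)) := by
      intro i
      rw [inner_gradient_right, real_inner_comm]
      simp
      ring
    simp_rw [h1, h3]
    rw [Finset.sum_add_distrib, Finset.sum_add_distrib, ← Finset.mul_sum, ← Finset.mul_sum,
      b.sum_inner_mul_inner, b.sum_inner_mul_inner, weightedLaplacian, laplacian_eq_sum]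
    ring
  simp_rw [hpt] at hsum
  have i1 : Integrable (fun y => ψ y * weightedLaplacian ρ φ y) (densityMeasure ρ) :=
    (hρ.memLp_of_continuous hψ.continuous hψs 2).integrable_mul (memLp_weightedLaplacian hρ hφ hφs)
  have i2 : Integrable (fun y => inner ℝ (gradient ψ y) (gradient φ y)) (densityMeasure ρ) := by
    refine memLp_one_iff_integrable.1 (hρ.memLp_of_continuous
      ((continuous_gradient hψ).inner (continuous_gradient hφ1))
      ((hasCompactSupport_gradient hφs).mono fun y hy => ?_) 1)
    rw [Function.mem_support] at hy ⊢
    contrapose! hy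
    simp [hy]
  rw [integral_add i1 i2] at hsum
  linarith

end

/-! ### The weighted Sobolev space and its chain rule -/

/-- Dominated convergence to zero in `L²`. -/
theorem tendsto_eLpNorm_two_of_dominated {α E : Type*} [MeasurableSpace α] {μ : Measure α}
    [NormedAddCommGroup E] {F : ℕ → α → E} {b : α → ℝ} (hF : ∀ n, AEStronglyMeasurable (F n) μ)
    (hb : MemLp b 2 μ) (hFb : ∀ n, ∀ᵐ x ∂μ, ‖F n x‖ ≤ b x)
    (hlim : ∀ᵐ x ∂μ, Tendsto (fun n => F n x) atTop (𝓝 0)) :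
    Tendsto (fun n => eLpNorm (F n) 2 μ) atTop (𝓝 0) := by
  have key : Tendsto (fun n => ∫⁻ x, ‖F n x‖ₑ ^ (2 : ℝ) ∂μ) atTop (𝓝 (∫⁻ _, 0 ∂μ)) := by
    refine tendsto_lintegral_of_dominated_convergence' (fun x => ‖b x‖ₑ ^ (2 : ℝ))
      (fun n => (hF n).enorm.pow_const _) (fun n => ?_) ?_ ?_
    · filter_upwards [hFb n] with x hx
      refine ENNReal.rpow_le_rpow ?_ (by norm_num)
      rw [enorm_le_iff_norm_le]
      exact hx.trans (le_abs_self _)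
    · have := lintegral_rpow_enorm_lt_top_of_eLpNorm_lt_top (by norm_num) (by norm_num) hb.2
      simpa using this.ne
    · filter_upwards [hlim] with x hx
      have h1 : Tendsto (fun n => ‖F n x‖ₑ) atTop (𝓝 0) := by simpa using hx.enorm
      have h2 := (ENNReal.continuous_rpow_const (y := (2 : ℝ))).tendsto 0 |>.comp h1
      simpa [Function.comp_def] using h2
  simp_rw [eLpNorm_eq_lintegral_rpow_enorm_toReal (p := 2) (by norm_num) (by norm_num)]
  have h3 := (ENNReal.continuous_rpow_const (y := (1 / 2 : ℝ))).tendsto 0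
  rw [lintegral_zero] at key
  have h4 := h3.comp key
  simpa [Function.comp_def] using h4

/-- `L²` convergence implies convergence of integrals of inner products. -/
theorem tendsto_integral_inner_of_tendsto_eLpNorm {α E : Type*} [MeasurableSpace α]
    {μ : Measure α} [NormedAddCommGroup E] [InnerProductSpace ℝ E] {V : ℕ → α → E} {W U : α → E}
    (hV : ∀ n, MemLp (V n) 2 μ) (hW : MemLp W 2 μ) (hU : MemLp U 2 μ)
    (h : Tendsto (fun n => eLpNorm (fun x => W x - V n x) 2 μ) atTop (𝓝 0)) :
    Tendsto (fun n => ∫ x, inner ℝ (U x) (V n x) ∂μ) atTop (𝓝 (∫ x, inner ℝ (U x) (W x) ∂μ)) := by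
  have h1 : Tendsto (fun n => (hV n).toLp (V n)) atTop (𝓝 (hW.toLp W)) := by
    rw [Lp.tendsto_Lp_iff_tendsto_eLpNorm'' V hV W hW]
    refine h.congr fun n => ?_
    rw [← eLpNorm_neg]
    congr 1
    funext x
    simp
  have h2 : ∀ {F : α → E} (hF : MemLp F 2 μ), inner ℝ (hU.toLp U) (hF.toLp F) =
      ∫ x, inner ℝ (U x) (F x) ∂μ := by
    intro F hF
    rw [L2.inner_def]
    refine integral_congr_ae ?_
    filter_upwards [hU.coeFn_toLp, hF.coeFn_toLp] with x hx1 hx2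
    rw [hx1, hx2]
  have h3 := (tendsto_const_nhds (x := hU.toLp U)).inner h1 (𝕜 := ℝ)
  simpa only [h2] using h3

/-- `u` belongs to `H¹₀(ν)` and `G` is its gradient there: `(u, G)` is a limit in
`L²(ν) × L²(ν)` of pairs `(φ, ∇φ)` with `φ ∈ C_c^∞`. -/
structure HasH10Gradient {d : ℕ} (ν : Measure (Ed d)) (u : Ed d → ℝ) (G : Ed d → Ed d) : Prop where
  memLp : MemLp u 2 ν
  memLp_grad : MemLp G 2 ν
  approx : ∀ ε : ENNReal, 0 < ε → ∃ φ : Ed d → ℝ, ContDiff ℝ ∞ φ ∧ HasCompactSupport φ ∧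
    eLpNorm (fun y => u y - φ y) 2 ν < ε ∧ eLpNorm (fun y => G y - gradient φ y) 2 ν < ε

namespace HasH10Gradient

variable {d : ℕ}

theorem of_tendsto {ν : Measure (Ed d)} {u : Ed d → ℝ} {G : Ed d → Ed d} (hu : MemLp u 2 ν)
    (hG : MemLp G 2 ν) {φ : ℕ → Ed d → ℝ} (hφ : ∀ n, ContDiff ℝ ∞ (φ n))
    (hs : ∀ n, HasCompactSupport (φ n))
    (h1 : Tendsto (fun n => eLpNorm (fun y => u y - φ n y) 2 ν) atTop (𝓝 0))
    (h2 : Tendsto (fun n => eLpNorm (fun y => G y - gradient (φ n) y) 2 ν) atTop (𝓝 0)) :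
    HasH10Gradient ν u G := by
  refine ⟨hu, hG, fun ε hε => ?_⟩
  obtain ⟨n, hn1, hn2⟩ := ((h1.eventually (gt_mem_nhds hε)).and
    (h2.eventually (gt_mem_nhds hε))).exists
  exact ⟨φ n, hφ n, hs n, hn1, hn2⟩

theorem congr_ae {ν : Measure (Ed d)} {u u' : Ed d → ℝ} {G G' : Ed d → Ed d}
    (h : HasH10Gradient ν u G) (hu : u =ᵐ[ν] u') (hG : G =ᵐ[ν] G') : HasH10Gradient ν u' G' := by
  refine ⟨h.memLp.ae_eq hu, h.memLp_grad.ae_eq hG, fun ε hε => ?_⟩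
  obtain ⟨φ, a, b, c, e⟩ := h.approx ε hε
  refine ⟨φ, a, b, ?_, ?_⟩
  · rwa [eLpNorm_congr_ae (hu.symm.fun_sub (ae_eq_refl φ))]
  · rwa [eLpNorm_congr_ae (hG.symm.fun_sub (ae_eq_refl (gradient φ)))]

/-- The approximating sequence may be chosen to converge almost everywhere as well. -/
theorem exists_seq {ν : Measure (Ed d)} {u : Ed d → ℝ} {G : Ed d → Ed d}
    (h : HasH10Gradient ν u G) : ∃ φ : ℕ → Ed d → ℝ, (∀ n, ContDiff ℝ ∞ (φ n)) ∧
      (∀ n, HasCompactSupport (φ n)) ∧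
      Tendsto (fun n => eLpNorm (fun y => u y - φ n y) 2 ν) atTop (𝓝 0) ∧
      Tendsto (fun n => eLpNorm (fun y => G y - gradient (φ n) y) 2 ν) atTop (𝓝 0) ∧
      ∀ᵐ y ∂ν, Tendsto (fun n => φ n y) atTop (𝓝 (u y)) := by
  have hpos : ∀ n : ℕ, (0 : ENNReal) < ENNReal.ofReal (1 / ((n : ℝ) + 1)) := fun n => by
    rw [ENNReal.ofReal_pos]; positivity
  choose φ hφ hs h1 h2 using fun n : ℕ => h.approx _ (hpos n)
  have hz : Tendsto (fun n : ℕ => ENNReal.ofReal (1 / ((n : ℝ) + 1))) atTop (𝓝 0) := by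
    have := (ENNReal.continuous_ofReal.tendsto 0).comp
      (tendsto_one_div_add_atTop_nhds_zero_nat (𝕜 := ℝ))
    simpa [Function.comp_def] using this
  have l1 := tendsto_of_tendsto_of_tendsto_of_le_of_le tendsto_const_nhds hz
    (fun n => zero_le) (fun n => (h1 n).le)
  have l2 := tendsto_of_tendsto_of_tendsto_of_le_of_le tendsto_const_nhds hz
    (fun n => zero_le) (fun n => (h2 n).le)
  have l3 : TendstoInMeasure ν φ atTop u := by
    refine tendstoInMeasure_of_tendsto_eLpNorm (p := 2) (by norm_num)
      (fun n => (hφ n).continuous.aestronglyMeasurable) h.memLp.aestronglyMeasurable ?_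
    refine l1.congr fun n => ?_
    rw [← eLpNorm_neg]
    congr 1
    funext x
    simp
  obtain ⟨ns, hns, hae⟩ := l3.exists_seq_tendsto_ae
  exact ⟨fun n => φ (ns n), fun n => hφ _, fun n => hs _, l1.comp hns.tendsto_atTop,
    l2.comp hns.tendsto_atTop, hae⟩

theorem gradient_comp {T : ℝ → ℝ} (hT : ContDiff ℝ ∞ T) {φ : Ed d → ℝ} (hφ : ContDiff ℝ ∞ φ)
    (y : Ed d) : gradient (fun z => T (φ z)) y = deriv T (φ y) • gradient φ y := by
  have h1 : HasDerivAt T (deriv T (φ y)) (φ y) :=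
    (hT.differentiable (by simp) _).hasDerivAt
  have h2 : HasFDerivAt φ (fderiv ℝ φ y) y := (hφ.differentiable (by simp) y).hasFDerivAt
  have h3 : HasFDerivAt (fun z => T (φ z)) _ y := h1.comp_hasFDerivAt y h2
  rw [gradient, h3.fderiv, map_smul]
  rfl

/-- Smooth maps act on the approximating sequences, which gives the chain rule together with
approximants that obey the same pointwise bounds as the composition. -/
theorem exists_seq_comp {ν : Measure (Ed d)} {u : Ed d → ℝ} {G : Ed d → Ed d}
    (h : HasH10Gradient ν u G) {T : ℝ → ℝ} (hT : ContDiff ℝ ∞ T) (hT0 : T 0 = 0) {L : ℝ}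
    (hL : ∀ s, |deriv T s| ≤ L) : ∃ φ : ℕ → Ed d → ℝ,
      (∀ n, ContDiff ℝ ∞ (fun y => T (φ n y))) ∧
      (∀ n, HasCompactSupport (fun y => T (φ n y))) ∧
      Tendsto (fun n => eLpNorm (fun y => T (u y) - T (φ n y)) 2 ν) atTop (𝓝 0) ∧
      Tendsto (fun n => eLpNorm (fun y => deriv T (u y) • G y
        - gradient (fun z => T (φ n z)) y) 2 ν) atTop (𝓝 0) ∧
      ∀ᵐ y ∂ν, Tendsto (fun n => T (φ n y)) atTop (𝓝 (T (u y))) := by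
  obtain ⟨φ, hφ, hs, l1, l2, hae⟩ := h.exists_seq
  have hL0 : 0 ≤ L := (abs_nonneg _).trans (hL 0)
  have hTd : Continuous (deriv T) := hT.continuous_deriv (by simp)
  have hlip : ∀ a b, |T a - T b| ≤ L * |a - b| := by
    intro a b
    have := Convex.norm_image_sub_le_of_norm_deriv_le (f := T) (s := univ) (x := b) (y := a)
      (fun x _ => hT.differentiable (by simp) x) (fun x _ => hL x) convex_univ trivial trivial
    simpa using this
  refine ⟨φ, fun n => hT.comp (hφ n), fun n => (hs n).comp_left hT0, ?_, ?_, ?_⟩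
  · have h1 : Tendsto (fun n => ENNReal.ofReal L * eLpNorm (fun y => u y - φ n y) 2 ν) atTop
        (𝓝 0) := by
      simpa using ENNReal.Tendsto.const_mul l1 (Or.inr ENNReal.ofReal_ne_top)
    refine tendsto_of_tendsto_of_tendsto_of_le_of_le tendsto_const_nhds h1 (fun n => zero_le)
      fun n => eLpNorm_le_mul_eLpNorm_of_ae_le_mul (Eventually.of_forall fun y => ?_) 2
    exact hlip _ _
  · have e : ∀ n y, deriv T (u y) • G y - gradient (fun z => T (φ n z)) y =
        (deriv T (u y) - deriv T (φ n y)) • G y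
          + deriv T (φ n y) • (G y - gradient (φ n) y) := by
      intro n y
      rw [gradient_comp hT (hφ n), sub_smul, smul_sub]
      abel
    have mu : AEStronglyMeasurable (fun y => deriv T (u y)) ν :=
      hTd.comp_aestronglyMeasurable h.memLp.aestronglyMeasurable
    have mφ : ∀ n, AEStronglyMeasurable (fun y => deriv T (φ n y)) ν := fun n =>
      (hTd.comp (hφ n).continuous).aestronglyMeasurable
    have m1 : ∀ n, AEStronglyMeasurable (fun y => (deriv T (u y) - deriv T (φ n y)) • G y) ν :=
      fun n => (mu.sub (mφ n)).smul h.memLp_grad.aestronglyMeasurable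
    have m2 : ∀ n, AEStronglyMeasurable
        (fun y => deriv T (φ n y) • (G y - gradient (φ n) y)) ν := fun n =>
      (mφ n).smul (h.memLp_grad.aestronglyMeasurable.sub
        (continuous_gradient ((hφ n).of_le (by simp))).aestronglyMeasurable)
    have t1 : Tendsto (fun n => eLpNorm (fun y => (deriv T (u y) - deriv T (φ n y)) • G y) 2 ν)
        atTop (𝓝 0) := by
      refine tendsto_eLpNorm_two_of_dominated m1 (h.memLp_grad.norm.const_mul (2 * L))
        (fun n => Eventually.of_forall fun y => ?_) ?_
      · rw [norm_smul, Real.norm_eq_abs]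
        gcongr
        have := abs_sub (deriv T (u y)) (deriv T (φ n y))
        linarith [hL (u y), hL (φ n y)]
      · filter_upwards [hae] with y hy
        have h1 : Tendsto (fun n => deriv T (u y) - deriv T (φ n y)) atTop (𝓝 0) := by
          simpa using ((hTd.tendsto _).comp hy).const_sub (deriv T (u y))
        simpa using h1.smul_const (G y)
    have t2 : Tendsto (fun n => eLpNorm (fun y => deriv T (φ n y) • (G y - gradient (φ n) y)) 2 ν)
        atTop (𝓝 0) := by
      have h1 : Tendsto (fun n => ENNReal.ofReal L * eLpNorm (fun y => G y - gradient (φ n) y) 2 ν)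
          atTop (𝓝 0) := by
        simpa using ENNReal.Tendsto.const_mul l2 (Or.inr ENNReal.ofReal_ne_top)
      refine tendsto_of_tendsto_of_tendsto_of_le_of_le tendsto_const_nhds h1 (fun n => zero_le)
        fun n => eLpNorm_le_mul_eLpNorm_of_ae_le_mul (Eventually.of_forall fun y => ?_) 2
      rw [norm_smul]
      exact mul_le_mul_of_nonneg_right (hL _) (norm_nonneg _)
    have t3 := t1.add t2
    rw [add_zero] at t3
    refine tendsto_of_tendsto_of_tendsto_of_le_of_le tendsto_const_nhds t3 (fun n => zero_le)
      fun n => ?_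
    simp_rw [e]
    exact eLpNorm_add_le (m1 n) (m2 n) (by norm_num)
  · filter_upwards [hae] with y hy
    exact (hT.continuous.tendsto _).comp hy

/-- The chain rule in `H¹₀`. -/
theorem comp {ν : Measure (Ed d)} {u : Ed d → ℝ} {G : Ed d → Ed d}
    (h : HasH10Gradient ν u G) {T : ℝ → ℝ} (hT : ContDiff ℝ ∞ T) (hT0 : T 0 = 0) {L : ℝ}
    (hL : ∀ s, |deriv T s| ≤ L) :
    HasH10Gradient ν (fun y => T (u y)) (fun y => deriv T (u y) • G y) := by
  obtain ⟨φ, hφ, hs, l1, l2, -⟩ := h.exists_seq_comp hT hT0 hL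
  have hTd : Continuous (deriv T) := hT.continuous_deriv (by simp)
  refine of_tendsto ?_ ?_ hφ hs l1 l2
  · refine h.memLp.of_le_mul (c := L)
      (hT.continuous.comp_aestronglyMeasurable h.memLp.aestronglyMeasurable)
      (Eventually.of_forall fun y => ?_)
    have := Convex.norm_image_sub_le_of_norm_deriv_le (f := T) (s := univ) (x := 0) (y := u y)
      (fun x _ => hT.differentiable (by simp) x) (fun x _ => hL x) convex_univ trivial trivial
    simpa [hT0] using this
  · refine h.memLp_grad.of_le_mul (c := L) ((hTd.comp_aestronglyMeasurable
      h.memLp.aestronglyMeasurable).smul h.memLp_grad.aestronglyMeasurable)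
      (Eventually.of_forall fun y => ?_)
    rw [norm_smul]
    exact mul_le_mul_of_nonneg_right (hL _) (norm_nonneg _)

theorem neg {ν : Measure (Ed d)} {u : Ed d → ℝ} {G : Ed d → Ed d} (h : HasH10Gradient ν u G) :
    HasH10Gradient ν (fun y => -u y) (fun y => -G y) := by
  have h1 := h.comp (T := fun s => -s) (L := 1) contDiff_neg (by simp) (fun s => by simp)
  simpa using h1

theorem sub {ν : Measure (Ed d)} {u v : Ed d → ℝ} {G H : Ed d → Ed d} (h : HasH10Gradient ν u G)
    (h' : HasH10Gradient ν v H) :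
    HasH10Gradient ν (fun y => u y - v y) (fun y => G y - H y) := by
  obtain ⟨φ, hφ, hs, l1, l2, -⟩ := h.exists_seq
  obtain ⟨ψ, hψ, hs', l1', l2', -⟩ := h'.exists_seq
  refine of_tendsto (h.memLp.sub h'.memLp) (h.memLp_grad.sub h'.memLp_grad)
    (φ := fun n y => φ n y - ψ n y) (fun n => (hφ n).sub (hψ n)) (fun n => (hs n).sub (hs' n)) ?_ ?_
  · have t := l1.add l1'
    rw [add_zero] at t
    refine tendsto_of_tendsto_of_tendsto_of_le_of_le tendsto_const_nhds t (fun n => zero_le)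
      fun n => ?_
    have e : (fun y => u y - v y - (φ n y - ψ n y)) =
        (fun y => u y - φ n y) - fun y => v y - ψ n y := by
      funext y; simp only [Pi.sub_apply]; ring
    rw [e]
    exact eLpNorm_sub_le (h.memLp.aestronglyMeasurable.sub (hφ n).continuous.aestronglyMeasurable)
      (h'.memLp.aestronglyMeasurable.sub (hψ n).continuous.aestronglyMeasurable) (by norm_num)
  · have t := l2.add l2'
    rw [add_zero] at t
    refine tendsto_of_tendsto_of_tendsto_of_le_of_le tendsto_const_nhds t (fun n => zero_le)
      fun n => ?_
    have e : (fun y => G y - H y - gradient (fun y => φ n y - ψ n y) y) =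
        (fun y => G y - gradient (φ n) y) - fun y => H y - gradient (ψ n) y := by
      funext y
      have : gradient (fun y => φ n y - ψ n y) y = gradient (φ n) y - gradient (ψ n) y := by
        rw [gradient, gradient, gradient, fderiv_fun_sub ((hφ n).differentiable (by simp) y)
          ((hψ n).differentiable (by simp) y), map_sub]
      rw [this]
      simp only [Pi.sub_apply]
      abel
    rw [e]
    exact eLpNorm_sub_le (h.memLp_grad.aestronglyMeasurable.sub
      (continuous_gradient ((hφ n).of_le (by simp))).aestronglyMeasurable)
      (h'.memLp_grad.aestronglyMeasurable.sub
      (continuous_gradient ((hψ n).of_le (by simp))).aestronglyMeasurable) (by norm_num)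

variable {ρ : Ed d → ℝ}

theorem memLp_gradient (hρ : IsDataDensity ρ) {φ : Ed d → ℝ} (hφ : ContDiff ℝ 1 φ)
    (hs : HasCompactSupport φ) : MemLp (gradient φ) 2 (densityMeasure ρ) :=
  hρ.memLp_of_continuous (continuous_gradient hφ) (hasCompactSupport_gradient hs) 2

/-- Integration by parts for the weighted Laplacian on `H¹₀`. -/
theorem integral_mul_weightedLaplacian (hρ : IsDataDensity ρ) {u : Ed d → ℝ} {G : Ed d → Ed d}
    (h : HasH10Gradient (densityMeasure ρ) u G) {φ : Ed d → ℝ} (hφ : ContDiff ℝ 2 φ)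
    (hφs : HasCompactSupport φ) :
    ∫ y, u y * weightedLaplacian ρ φ y ∂(densityMeasure ρ) =
      - ∫ y, inner ℝ (G y) (gradient φ y) ∂(densityMeasure ρ) := by
  obtain ⟨ψ, hψ, hs, l1, l2, -⟩ := h.exists_seq
  have hg := memLp_gradient hρ (hφ.of_le (by simp)) hφs
  have t1 := tendsto_integral_inner_of_tendsto_eLpNorm
    (fun n => hρ.memLp_of_continuous (hψ n).continuous (hs n) 2) h.memLp
    (memLp_weightedLaplacian hρ hφ hφs) l1
  have t2 := tendsto_integral_inner_of_tendsto_eLpNorm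
    (fun n => memLp_gradient hρ ((hψ n).of_le (by simp)) (hs n)) h.memLp_grad hg l2
  have e : ∀ V : Ed d → Ed d, ∫ y, inner ℝ (V y) (gradient φ y) ∂(densityMeasure ρ) =
      ∫ y, inner ℝ (gradient φ y) (V y) ∂(densityMeasure ρ) := fun V =>
    integral_congr_ae (Eventually.of_forall fun y => real_inner_comm _ _)
  rw [e]
  refine tendsto_nhds_unique t1 (t2.neg.congr fun n => ?_)
  rw [← e, ← integral_mul_weightedLaplacian_of_contDiff hρ ((hψ n).of_le (by simp)) (hs n) hφ hφs]
  rfl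

/-- Limits of smooth functions in the weighted norm have a weak gradient in the usual sense, since
the weight is locally bounded below. -/
theorem hasWeakGradient (hρ : IsDataDensity ρ) {u : Ed d → ℝ} {G : Ed d → Ed d}
    (h : HasH10Gradient (densityMeasure ρ) u G) : HasWeakGradient u G := by
  have := hρ.isProbabilityMeasure
  obtain ⟨φ, hφ, hs, l1, l2, -⟩ := h.exists_seq
  have hu := hρ.locallyIntegrable (h.memLp.integrable (by norm_num))
  have hG := hρ.locallyIntegrable (h.memLp_grad.integrable (by norm_num))
  refine ⟨hu, hG, fun ψ hψ hψs => ?_⟩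
  -- division by the density turns compactly supported test fields into elements of `L²(μ)`
  have hdiv : ∀ {E : Type} [NormedAddCommGroup E] [NormedSpace ℝ E] {V : Ed d → E},
      Continuous V → HasCompactSupport V →
      MemLp (fun y => (ρ y)⁻¹ • V y) 2 (densityMeasure ρ) := by
    intro E _ _ V hV hVs
    obtain ⟨c, hc, hcK⟩ := hρ.exists_le_of_isCompact hVs.isCompact
    refine (hρ.memLp_of_continuous hV hVs 2).of_le_mul (c := c⁻¹) ?_ ?_
    · exact hρ.isProbDensity.measurable.inv.aestronglyMeasurable.smul
        (hρ.aestronglyMeasurable_iff.2 hV.aestronglyMeasurable)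
    · rw [hρ.ae_iff]
      rw [ae_restrict_iff' (isClosed_tsupport V).measurableSet] at hcK
      filter_upwards [hcK] with y hy
      by_cases hyt : y ∈ tsupport V
      · rw [norm_smul, norm_inv, Real.norm_of_nonneg (hρ.pos y).le]
        gcongr
        exact hy hyt
      · simp [image_eq_zero_of_notMem_tsupport hyt]
  have hψ1 : ContDiff ℝ 1 ψ := hψ.of_le (by simp)
  have hψg := continuous_gradient hψ1
  have hψgs := hasCompactSupport_gradient hψs
  have hi1 : Integrable fun y => u y • gradient ψ y :=
    hu.integrable_smul_right_of_hasCompactSupport hψg hψgs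
  have hi2 : Integrable fun y => ψ y • G y :=
    hG.integrable_smul_left_of_hasCompactSupport hψ.continuous hψs
  refine ext_inner_left ℝ fun e => ?_
  rw [inner_neg_right, ← integral_inner hi1, ← integral_inner hi2]
  have he1 : Continuous fun y => fderiv ℝ ψ y e :=
    (hψ.continuous_fderiv (by simp)).clm_apply continuous_const
  have hes1 : HasCompactSupport fun y => fderiv ℝ ψ y e := hψs.fderiv_apply (𝕜 := ℝ) e
  have c1 : ∀ w : Ed d → ℝ, ∫ y, inner ℝ ((ρ y)⁻¹ • fderiv ℝ ψ y e) (w y) ∂(densityMeasure ρ) =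
      ∫ y, w y * fderiv ℝ ψ y e := by
    intro w
    rw [hρ.integral_eq]
    refine integral_congr_ae (Eventually.of_forall fun y => ?_)
    have := (hρ.pos y).ne'
    simp only [smul_eq_mul, RCLike.inner_apply, conj_trivial]
    field_simp
  have c2 : ∀ W : Ed d → Ed d, ∫ y, inner ℝ ((ρ y)⁻¹ • ψ y • e) (W y) ∂(densityMeasure ρ) =
      ∫ y, ψ y * inner ℝ e (W y) := by
    intro W
    rw [hρ.integral_eq]
    refine integral_congr_ae (Eventually.of_forall fun y => ?_)
    have := (hρ.pos y).ne'
    simp only [smul_eq_mul, real_inner_smul_left]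
    field_simp
  have t1 : Tendsto (fun n => ∫ y, φ n y * fderiv ℝ ψ y e) atTop
      (𝓝 (∫ y, u y * fderiv ℝ ψ y e)) := by
    rw [← c1 u]
    exact (tendsto_integral_inner_of_tendsto_eLpNorm
      (fun n => hρ.memLp_of_continuous (hφ n).continuous (hs n) 2) h.memLp
      (hdiv he1 hes1) l1).congr fun n => c1 (φ n)
  have t2 : Tendsto (fun n => ∫ y, ψ y * inner ℝ e (gradient (φ n) y)) atTop
      (𝓝 (∫ y, ψ y * inner ℝ e (G y))) := by
    rw [← c2 G]
    exact (tendsto_integral_inner_of_tendsto_eLpNorm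
      (fun n => memLp_gradient hρ ((hφ n).of_le (by simp)) (hs n)) h.memLp_grad
      (hdiv (hψ.continuous.smul continuous_const)
        (hψs.mono fun y hy => left_ne_zero_of_smul (b := e) hy)) l2).congr fun n =>
      c2 (gradient (φ n))
  have e1 : ∫ y, inner ℝ e (u y • gradient ψ y) = ∫ y, u y * fderiv ℝ ψ y e := by
    simp [inner_smul_right, inner_gradient_right]
  have e2 : ∫ y, inner ℝ e (ψ y • G y) = ∫ y, ψ y * inner ℝ e (G y) := by
    simp [inner_smul_right]
  rw [e1, e2]
  refine tendsto_nhds_unique t1 (t2.neg.congr fun n => ?_)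
  have hd : Continuous fun y => fderiv ℝ (φ n) y e :=
    ((hφ n).continuous_fderiv (by simp)).clm_apply continuous_const
  have := integral_mul_fderiv_eq_neg_fderiv_mul_of_integrable (f := φ n) (g := ψ) (v := e)
    (μ := volume)
    ((hd.mul hψ.continuous).integrable_of_hasCompactSupport hψs.mul_left)
    (((hφ n).continuous.mul he1).integrable_of_hasCompactSupport hes1.mul_left)
    (((hφ n).continuous.mul hψ.continuous).integrable_of_hasCompactSupport hψs.mul_left)
    (fun x _ => (hφ n).differentiable (by simp) x) (fun x _ => hψ.differentiable (by simp) x)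
  rw [this]
  simp [inner_gradient_right, mul_comm]

theorem memH10 (hρ : IsDataDensity ρ) {u : Ed d → ℝ} {G : Ed d → Ed d}
    (h : HasH10Gradient (densityMeasure ρ) u G) : MemH10 (densityMeasure ρ) u :=
  ⟨G, h.memLp, h.hasWeakGradient hρ, h.memLp_grad, h.approx⟩

/-- Mollification shows that compactly supported `C¹` functions belong to `H¹₀`. -/
theorem of_contDiff (hρ : IsDataDensity ρ) {φ : Ed d → ℝ} (hφ : ContDiff ℝ 1 φ)
    (hs : HasCompactSupport φ) : HasH10Gradient (densityMeasure ρ) φ (gradient φ) := by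
  have := hρ.isProbabilityMeasure
  have hli := hφ.continuous.locallyIntegrable (μ := volume)
  obtain ⟨C, hC⟩ := hφ.continuous.bounded_above_of_compact_support hs
  obtain ⟨C', hC'⟩ := (hφ.continuous_fderiv (by simp)).bounded_above_of_compact_support
    (hs.fderiv (𝕜 := ℝ))
  set b := stdOrthonormalBasis ℝ (Ed d) with hb
  have hm : ∀ n, ContDiff ℝ ∞ (mollify n φ) := contDiff_mollify hli
  have hms : ∀ n, HasCompactSupport (mollify n φ) := hasCompactSupport_mollify hs
  have hdir : ∀ i, Continuous fun y => fderiv ℝ φ y (b i) := fun i =>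
    (hφ.continuous_fderiv (by simp)).clm_apply continuous_const
  have hrep : ∀ (ψ : Ed d → ℝ) y, gradient ψ y = ∑ i, fderiv ℝ ψ y (b i) • b i := by
    intro ψ y
    conv_lhs => rw [← b.sum_repr' (gradient ψ y)]
    simp [inner_gradient_right]
  refine of_tendsto (hρ.memLp_of_continuous hφ.continuous hs 2) (memLp_gradient hρ hφ hs)
    hm hms ?_ ?_
  · refine tendsto_eLpNorm_two_of_dominated
      (fun n => (hφ.continuous.sub (hm n).continuous).aestronglyMeasurable)
      (memLp_const (2 * C)) (fun n => Eventually.of_forall fun y => ?_)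
      (Eventually.of_forall fun y => ?_)
    · have h1 := abs_mollify_le (Eventually.of_forall hC) n y
      have h2 := hC y
      rw [Real.norm_eq_abs] at h2 ⊢
      linarith [abs_sub (φ y) (mollify n φ y)]
    · simpa using (tendsto_mollify_of_continuous hφ.continuous y).const_sub (φ y)
  · refine tendsto_eLpNorm_two_of_dominated
      (fun n => ((continuous_gradient hφ).sub
        (continuous_gradient ((hm n).of_le (by simp)))).aestronglyMeasurable)
      (memLp_const (C' + ∑ i, C' * ‖b i‖)) (fun n => Eventually.of_forall fun y => ?_)
      (Eventually.of_forall fun y => ?_)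
    · refine (norm_sub_le _ _).trans (add_le_add ?_ ?_)
      · rw [norm_gradient]; exact hC' y
      · rw [hrep]
        refine (norm_sum_le _ _).trans (Finset.sum_le_sum fun i _ => ?_)
        rw [norm_smul, fderiv_mollify_of_contDiff hφ]
        gcongr
        refine abs_mollify_le (Eventually.of_forall fun z => ?_) n y
        have := (fderiv ℝ φ z).le_opNorm (b i)
        rw [b.orthonormal.1 i, mul_one] at this
        exact this.trans (hC' z)
    · have h1 : Tendsto (fun n => gradient (mollify n φ) y) atTop (𝓝 (gradient φ y)) := by
        simp_rw [hrep]
        refine tendsto_finsetSum _ fun i _ => Tendsto.smul_const ?_ _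
        simp_rw [fderiv_mollify_of_contDiff hφ]
        exact tendsto_mollify_of_continuous (hdir i) y
      simpa using h1.const_sub (gradient φ y)

/-- The weak equation `g = -c Δ_μ u` may be tested with bounded smooth functions of `u`, although
`g` is only integrable. -/
theorem integral_mul_comp (hρ : IsDataDensity ρ) {u g : Ed d → ℝ} {G : Ed d → Ed d}
    (h : HasH10Gradient (densityMeasure ρ) u G) (hg : Integrable g (densityMeasure ρ)) {c : ℝ}
    (heq : ∀ φ : Ed d → ℝ, ContDiff ℝ ∞ φ → HasCompactSupport φ →
      ∫ y, g y * φ y ∂(densityMeasure ρ) =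
        c * ∫ y, inner ℝ (G y) (gradient φ y) ∂(densityMeasure ρ))
    {T : ℝ → ℝ} (hT : ContDiff ℝ ∞ T) (hT0 : T 0 = 0) {L B : ℝ}
    (hL : ∀ s, |deriv T s| ≤ L) (hB : ∀ s, |T s| ≤ B) :
    ∫ y, g y * T (u y) ∂(densityMeasure ρ) =
      c * ∫ y, deriv T (u y) * ‖G y‖ ^ 2 ∂(densityMeasure ρ) := by
  obtain ⟨φ, hφ, hs, -, l2, hae⟩ := h.exists_seq_comp hT hT0 hL
  have t1 : Tendsto (fun n => ∫ y, g y * T (φ n y) ∂(densityMeasure ρ)) atTop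
      (𝓝 (∫ y, g y * T (u y) ∂(densityMeasure ρ))) := by
    refine tendsto_integral_of_dominated_convergence (fun y => |g y| * B) (fun n => ?_)
      (hg.abs.mul_const B) (fun n => Eventually.of_forall fun y => ?_) ?_
    · exact hg.aestronglyMeasurable.mul
        (hρ.aestronglyMeasurable_iff.2 (hφ n).continuous.aestronglyMeasurable)
    · rw [norm_mul]
      exact mul_le_mul_of_nonneg_left (hB _) (norm_nonneg _)
    · filter_upwards [hae] with y hy
      exact hy.const_mul _
  have t2 := (tendsto_integral_inner_of_tendsto_eLpNorm
    (fun n => memLp_gradient hρ ((hφ n).of_le (by simp)) (hs n))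
    (h.comp hT hT0 hL).memLp_grad h.memLp_grad l2).const_mul c
  have e : ∫ y, inner ℝ (G y) (deriv T (u y) • G y) ∂(densityMeasure ρ) =
      ∫ y, deriv T (u y) * ‖G y‖ ^ 2 ∂(densityMeasure ρ) := by
    simp [inner_smul_right]
  rw [e] at t2
  exact tendsto_nhds_unique (t1.congr fun n => heq _ (hφ n) (hs n)) t2

/-- The sign property of `-Δ_μ`: if `g = -c Δ_μ u` then `g` has nonnegative integral over the
superlevel sets of `u` at nonnegative levels. The indicator of the superlevel set is approximated by
smooth nondecreasing functions of `u`. -/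
theorem setIntegral_nonneg (hρ : IsDataDensity ρ) {u g : Ed d → ℝ} {G : Ed d → Ed d}
    (h : HasH10Gradient (densityMeasure ρ) u G) (hg : Integrable g (densityMeasure ρ)) {c : ℝ}
    (hc : 0 ≤ c)
    (heq : ∀ φ : Ed d → ℝ, ContDiff ℝ ∞ φ → HasCompactSupport φ →
      ∫ y, g y * φ y ∂(densityMeasure ρ) =
        c * ∫ y, inner ℝ (G y) (gradient φ y) ∂(densityMeasure ρ))
    {b : ℝ} (hb : 0 ≤ b) :
    0 ≤ ∫ y, g y * (if b < u y then 1 else 0) ∂(densityMeasure ρ) := by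
  have hsm : ContDiff ℝ ∞ Real.smoothTransition := Real.smoothTransition.contDiff
  obtain ⟨L, hL⟩ : ∃ L, ∀ s, |deriv Real.smoothTransition s| ≤ L := by
    have hcs : HasCompactSupport (deriv Real.smoothTransition) := by
      refine HasCompactSupport.intro (isCompact_Icc (a := (0 : ℝ)) (b := 1)) fun x hx => ?_
      rw [mem_Icc, not_and_or, not_le, not_le] at hx
      rcases hx with hx | hx
      · have : Real.smoothTransition =ᶠ[𝓝 x] fun _ => 0 := by
          filter_upwards [gt_mem_nhds hx] with y hy
          exact Real.smoothTransition.zero_of_nonpos hy.le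
        rw [this.deriv_eq, deriv_const]
      · have : Real.smoothTransition =ᶠ[𝓝 x] fun _ => 1 := by
          filter_upwards [lt_mem_nhds hx] with y hy
          exact Real.smoothTransition.one_of_one_le hy.le
        rw [this.deriv_eq, deriv_const]
    exact (hsm.continuous_deriv (by simp)).bounded_above_of_compact_support hcs
  have hpos : ∀ k : ℕ, 0 ≤ ∫ y, g y * Real.smoothTransition (k * (u y - b))
      ∂(densityMeasure ρ) := by
    intro k
    let T : ℝ → ℝ := fun s => Real.smoothTransition (k * (s - b))
    have hT : ContDiff ℝ ∞ T := hsm.comp (contDiff_const.mul (contDiff_id.sub contDiff_const))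
    have hmono : Monotone T := fun x y hxy => Real.smoothTransition.monotone (by gcongr)
    have hd : ∀ s, deriv T s = deriv Real.smoothTransition (k * (s - b)) * k := by
      intro s
      have h1 := (hsm.differentiable (by simp) (k * (s - b))).hasDerivAt
      have h2 : HasDerivAt (fun s : ℝ => (k : ℝ) * (s - b)) k s := by
        simpa using ((hasDerivAt_id s).sub_const b).const_mul (k : ℝ)
      exact (h1.comp s h2).deriv
    rw [h.integral_mul_comp hρ hg heq hT ?_ (L := L * k) (B := 1) ?_ ?_]
    · refine mul_nonneg hc (integral_nonneg fun y => ?_)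
      exact mul_nonneg (hmono.deriv_nonneg) (by positivity)
    · refine Real.smoothTransition.zero_of_nonpos ?_
      have : (0 : ℝ) ≤ k * b := by positivity
      linarith
    · intro s
      rw [hd, abs_mul, Nat.abs_cast]
      gcongr
      exact hL _
    · intro s
      rw [abs_of_nonneg (Real.smoothTransition.nonneg _)]
      exact Real.smoothTransition.le_one _
  refine ge_of_tendsto' (x := atTop)
    (f := fun k : ℕ => ∫ y, g y * Real.smoothTransition (k * (u y - b)) ∂(densityMeasure ρ)) ?_ hpos
  refine tendsto_integral_of_dominated_convergence (fun y => |g y|) (fun k => ?_) hg.abs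
    (fun k => Eventually.of_forall fun y => ?_) (Eventually.of_forall fun y => ?_)
  · exact hg.aestronglyMeasurable.mul (Real.smoothTransition.continuous.comp_aestronglyMeasurable
      ((h.memLp.aestronglyMeasurable.sub aestronglyMeasurable_const).const_mul _))
  · rw [norm_mul, Real.norm_of_nonneg (Real.smoothTransition.nonneg _)]
    exact mul_le_of_le_one_right (norm_nonneg _) (Real.smoothTransition.le_one _)
  · refine Tendsto.const_mul _ ?_
    split_ifs with hy
    · refine tendsto_const_nhds.congr' ?_
      have h1 : Tendsto (fun k : ℕ => (k : ℝ) * (u y - b)) atTop atTop :=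
        tendsto_natCast_atTop_atTop.atTop_mul_const (sub_pos.2 hy)
      filter_upwards [h1.eventually_ge_atTop 1] with k hk
      exact (Real.smoothTransition.one_of_one_le hk).symm
    · refine tendsto_const_nhds.congr fun k => ?_
      refine (Real.smoothTransition.zero_of_nonpos ?_).symm
      exact mul_nonpos_of_nonneg_of_nonpos (by positivity) (by linarith)

end HasH10Gradient

/-! ### The linear resolvent -/

section LinearResolvent

variable {d : ℕ}

/-- The subspace of pairs `(φ, s ∇φ)`, `φ ∈ C_c^∞`, in the Hilbert space `L²(ν) × L²(ν)`. -/
def scaledGraph (ν : Measure (Ed d)) (s : ℝ) :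
    Submodule ℝ (WithLp 2 (Lp ℝ 2 ν × Lp (Ed d) 2 ν)) where
  carrier := {p | ∃ φ : Ed d → ℝ, ContDiff ℝ ∞ φ ∧ HasCompactSupport φ ∧
    (p.fst : Ed d → ℝ) =ᵐ[ν] φ ∧ (p.snd : Ed d → Ed d) =ᵐ[ν] fun y => s • gradient φ y}
  zero_mem' := by
    refine ⟨fun _ => 0, contDiff_const, HasCompactSupport.zero, Lp.coeFn_zero _ _ _, ?_⟩
    refine (Lp.coeFn_zero _ _ _).trans (Eventually.of_forall fun y => ?_)
    simp [gradient]
  add_mem' := by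
    rintro p q ⟨φ, hφ, hs, h1, h2⟩ ⟨ψ, hψ, hs', h1', h2'⟩
    refine ⟨fun y => φ y + ψ y, hφ.add hψ, hs.add hs', ?_, ?_⟩
    · filter_upwards [Lp.coeFn_add p.fst q.fst, h1, h1'] with y e e1 e2
      rw [WithLp.add_fst, e, Pi.add_apply, e1, e2]
    · filter_upwards [Lp.coeFn_add p.snd q.snd, h2, h2'] with y e e1 e2
      rw [WithLp.add_snd, e, Pi.add_apply, e1, e2, gradient, gradient, gradient,
        fderiv_fun_add (hφ.differentiable (by simp) y) (hψ.differentiable (by simp) y), map_add,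
        smul_add]
  smul_mem' := by
    rintro c p ⟨φ, hφ, hs, h1, h2⟩
    refine ⟨fun y => c * φ y, contDiff_const.mul hφ, hs.mul_left, ?_, ?_⟩
    · filter_upwards [Lp.coeFn_smul c p.fst, h1] with y e e1
      rw [WithLp.smul_fst, e, Pi.smul_apply, e1, smul_eq_mul]
    · filter_upwards [Lp.coeFn_smul c p.snd, h2] with y e e1
      rw [WithLp.smul_snd, e, Pi.smul_apply, e1, gradient, gradient,
        fderiv_const_mul (hφ.differentiable (by simp) y), map_smul, smul_comm]

theorem hasH10Gradient_of_mem_closure {ν : Measure (Ed d)} {s : ℝ} (hs : 0 < s)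
    {p : WithLp 2 (Lp ℝ 2 ν × Lp (Ed d) 2 ν)} (hp : p ∈ (scaledGraph ν s).topologicalClosure) :
    HasH10Gradient ν p.fst (fun y => s⁻¹ • p.snd y) := by
  refine ⟨Lp.memLp _, (Lp.memLp p.snd).const_smul s⁻¹, fun ε hε => ?_⟩
  obtain ⟨r, hr0, hr⟩ : ∃ r : ℝ, 0 < r ∧ ENNReal.ofReal r ≤ ε := by
    rcases eq_or_ne ε ⊤ with rfl | h
    · exact ⟨1, one_pos, le_top⟩
    · exact ⟨ε.toReal, ENNReal.toReal_pos hε.ne' h, (ENNReal.ofReal_toReal h).le⟩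
  obtain ⟨q, ⟨φ, hφ, hφs, h1, h2⟩, hq⟩ := Metric.mem_closure_iff.1 hp (min r (r * s))
    (by positivity)
  rw [dist_eq_norm] at hq
  have n1 : ‖p.fst - q.fst‖ < r :=
    ((WithLp.norm_fst_le _ (p - q)).trans_lt hq).trans_le (min_le_left _ _)
  have n2 : ‖p.snd - q.snd‖ < r * s :=
    ((WithLp.norm_snd_le _ (p - q)).trans_lt hq).trans_le (min_le_right _ _)
  refine ⟨φ, hφ, hφs, lt_of_lt_of_le ?_ hr, lt_of_lt_of_le ?_ hr⟩
  · have e : eLpNorm (fun y => p.fst y - φ y) 2 ν = ENNReal.ofReal ‖p.fst - q.fst‖ := by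
      rw [Lp.norm_def, ENNReal.ofReal_toReal (Lp.eLpNorm_ne_top _)]
      refine eLpNorm_congr_ae ?_
      filter_upwards [Lp.coeFn_sub p.fst q.fst, h1] with y e1 e2
      rw [e1, Pi.sub_apply, e2]
    rw [e]
    exact (ENNReal.ofReal_lt_ofReal_iff hr0).2 n1
  · have e : eLpNorm (fun y => s⁻¹ • p.snd y - gradient φ y) 2 ν =
        ENNReal.ofReal ‖s⁻¹ • (p.snd - q.snd)‖ := by
      rw [Lp.norm_def, ENNReal.ofReal_toReal (Lp.eLpNorm_ne_top _)]
      refine eLpNorm_congr_ae ?_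
      filter_upwards [Lp.coeFn_sub p.snd q.snd, h2, Lp.coeFn_smul s⁻¹ (p.snd - q.snd)]
        with y e1 e2 e3
      rw [e3, Pi.smul_apply, e1, Pi.sub_apply, e2, smul_sub, inv_smul_smul₀ hs.ne']
    rw [e, norm_smul, norm_inv, Real.norm_of_nonneg hs.le]
    refine (ENNReal.ofReal_lt_ofReal_iff hr0).2 ?_
    rw [inv_mul_lt_iff₀ hs]
    linarith

/-- The resolvent of the weighted Laplacian on `L²`: the first component of the orthogonal
projection of `(h, 0)` onto the closure of the graph `{(φ, s ∇φ)}`. -/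
def linearResolvent (ν : Measure (Ed d)) (s : ℝ) (h : Lp ℝ 2 ν) : Lp ℝ 2 ν :=
  ((scaledGraph ν s).topologicalClosure.starProjection (WithLp.toLp 2 (h, 0))).fst

theorem norm_linearResolvent_sub_le (ν : Measure (Ed d)) (s : ℝ) (h h' : Lp ℝ 2 ν) :
    ‖linearResolvent ν s h - linearResolvent ν s h'‖ ≤ ‖h - h'‖ := by
  have e : linearResolvent ν s h - linearResolvent ν s h' =
      ((scaledGraph ν s).topologicalClosure.starProjection (WithLp.toLp 2 (h - h', 0))).fst := by
    have : (WithLp.toLp 2 (h - h', (0 : Lp (Ed d) 2 ν))) =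
        WithLp.toLp 2 (h, 0) - WithLp.toLp 2 (h', 0) := by
      rw [← WithLp.toLp_sub, Prod.mk_sub_mk, sub_zero]
    rw [this, map_sub, WithLp.sub_fst]
    rfl
  rw [e]
  refine (WithLp.norm_fst_le _ _).trans ((Submodule.norm_starProjection_apply_le _ _).trans_eq ?_)
  have h1 : ‖(WithLp.toLp 2 (h - h', (0 : Lp (Ed d) 2 ν)))‖ ^ 2 = ‖h - h'‖ ^ 2 := by
    rw [WithLp.prod_norm_sq_eq_of_L2]
    simp
  exact (sq_eq_sq₀ (norm_nonneg _) (norm_nonneg _)).1 h1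

/-- The linear resolvent solves `u - s² Δ_μ u = h` weakly: this is the orthogonality of the residual
`(h, 0) - (u, s ∇u)` to the graph. -/
theorem exists_hasH10Gradient_linearResolvent {ρ : Ed d → ℝ} (hρ : IsDataDensity ρ) {s : ℝ}
    (hs : 0 < s) (h : Lp ℝ 2 (densityMeasure ρ)) : ∃ G : Ed d → Ed d,
      HasH10Gradient (densityMeasure ρ) (linearResolvent (densityMeasure ρ) s h) G ∧
      ∀ φ : Ed d → ℝ, ContDiff ℝ ∞ φ → HasCompactSupport φ →
        ∫ y, (h y - linearResolvent (densityMeasure ρ) s h y) * φ y ∂(densityMeasure ρ) =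
          s ^ 2 * ∫ y, inner ℝ (G y) (gradient φ y) ∂(densityMeasure ρ) := by
  set V := (scaledGraph (densityMeasure ρ) s).topologicalClosure with hV
  set p := V.starProjection (WithLp.toLp 2 (h, 0)) with hp
  refine ⟨_, hasH10Gradient_of_mem_closure hs (V.starProjection_apply_mem _), fun φ hφ hφs => ?_⟩
  have m1 : MemLp φ 2 (densityMeasure ρ) := hρ.memLp_of_continuous hφ.continuous hφs 2
  have m2 : MemLp (gradient φ) 2 (densityMeasure ρ) :=
    HasH10Gradient.memLp_gradient hρ (hφ.of_le (by simp)) hφs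
  have hmem : WithLp.toLp 2 (m1.toLp φ, s • m2.toLp (gradient φ)) ∈ V := by
    refine (scaledGraph (densityMeasure ρ) s).le_topologicalClosure ⟨φ, hφ, hφs, m1.coeFn_toLp, ?_⟩
    filter_upwards [Lp.coeFn_smul s (m2.toLp (gradient φ)), m2.coeFn_toLp] with y e1 e2
    rw [WithLp.toLp_snd, e1, Pi.smul_apply, e2]
  have key := V.starProjection_inner_eq_zero (WithLp.toLp 2 (h, 0)) _ hmem
  rw [WithLp.prod_inner_apply] at key
  have e1 : (inner ℝ (h - p.fst) (m1.toLp φ) : ℝ) =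
      ∫ y, (h y - linearResolvent (densityMeasure ρ) s h y) * φ y ∂(densityMeasure ρ) := by
    rw [L2.inner_def]
    refine integral_congr_ae ?_
    filter_upwards [Lp.coeFn_sub h p.fst, m1.coeFn_toLp] with y a b
    rw [a, b, Pi.sub_apply]
    simp only [RCLike.inner_apply, conj_trivial]
    rw [mul_comm]
    rfl
  have e2 : (inner ℝ (0 - p.snd) (s • m2.toLp (gradient φ)) : ℝ) =
      - (s ^ 2 * ∫ y, inner ℝ (s⁻¹ • p.snd y) (gradient φ y) ∂(densityMeasure ρ)) := by
    rw [zero_sub, inner_neg_left, inner_smul_right, L2.inner_def, neg_inj]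
    have : ∫ y, inner ℝ (s⁻¹ • p.snd y) (gradient φ y) ∂(densityMeasure ρ) =
        s⁻¹ * ∫ y, inner ℝ (p.snd y) (gradient φ y) ∂(densityMeasure ρ) := by
      rw [← integral_const_mul]
      simp_rw [real_inner_smul_left]
    rw [this, ← mul_assoc, pow_two, mul_assoc s s, mul_inv_cancel₀ hs.ne', mul_one]
    congr 1
    refine integral_congr_ae ?_
    filter_upwards [m2.coeFn_toLp] with y b
    rw [b]
  have key' : (inner ℝ (h - p.fst) (m1.toLp φ) : ℝ) +
    (inner ℝ (0 - p.snd) (s • m2.toLp (gradient φ)) : ℝ) = 0 := key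
  rw [e1, e2] at key'
  linarith

theorem integrable_mul_ite {ν : Measure (Ed d)} {g u : Ed d → ℝ} (hg : Integrable g ν)
    (hu : AEStronglyMeasurable u ν) (b : ℝ) :
    Integrable (fun y => g y * (if b < u y then 1 else 0)) ν := by
  refine hg.mul_bdd (c := 1) ?_ (Eventually.of_forall fun y => ?_)
  · have hm : NullMeasurableSet {y | b < u y} ν :=
      nullMeasurableSet_lt aemeasurable_const hu.aemeasurable
    have : (fun y => if b < u y then (1 : ℝ) else 0) = indicator {y | b < u y} fun _ => 1 := by
      funext y
      simp [indicator_apply]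
    rw [this]
    exact (aestronglyMeasurable_const (b := (1 : ℝ))).indicator₀ hm
  · split_ifs <;> simp

/-- The maximum principle: a solution of `u - c Δ_μ u = h` with `h ≤ b` satisfies `u ≤ b`. -/
theorem HasH10Gradient.ae_le_of_ae_le {ρ : Ed d → ℝ} (hρ : IsDataDensity ρ) {u h : Ed d → ℝ}
    {G : Ed d → Ed d} (hu : HasH10Gradient (densityMeasure ρ) u G)
    (hh : Integrable h (densityMeasure ρ)) {c : ℝ} (hc : 0 ≤ c)
    (heq : ∀ φ : Ed d → ℝ, ContDiff ℝ ∞ φ → HasCompactSupport φ →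
      ∫ y, (h y - u y) * φ y ∂(densityMeasure ρ) =
        c * ∫ y, inner ℝ (G y) (gradient φ y) ∂(densityMeasure ρ))
    {b : ℝ} (hb : 0 ≤ b) (hhb : ∀ᵐ y ∂(densityMeasure ρ), h y ≤ b) :
    ∀ᵐ y ∂(densityMeasure ρ), u y ≤ b := by
  have := hρ.isProbabilityMeasure
  have hi : Integrable (fun y => h y - u y) (densityMeasure ρ) :=
    hh.sub (hu.memLp.integrable (by norm_num))
  have h1 := hu.setIntegral_nonneg hρ hi hc heq hb
  have hneg : ∀ᵐ y ∂(densityMeasure ρ), 0 ≤ -((h y - u y) * (if b < u y then 1 else 0)) := by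
    filter_upwards [hhb] with y hy
    split_ifs with hy'
    · linarith
    · simp
  have hii : Integrable (fun y => -((h y - u y) * (if b < u y then 1 else 0)))
      (densityMeasure ρ) := (integrable_mul_ite hi hu.memLp.aestronglyMeasurable b).neg
  have h2 : ∫ y, -((h y - u y) * (if b < u y then 1 else 0)) ∂(densityMeasure ρ) = 0 := by
    refine le_antisymm ?_ (integral_nonneg_of_ae hneg)
    rw [integral_neg]
    linarith
  rw [integral_eq_zero_iff_of_nonneg_ae hneg hii] at h2
  filter_upwards [h2, hhb] with y hy hyb
  by_contra! hlt
  simp only [if_pos hlt, mul_one, Pi.zero_apply] at hy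
  linarith

end LinearResolvent

/-! ### The nonlinear resolvent -/

/-- A smooth function on `(-1, ∞)` vanishing at `0` can be modified outside `[0, c]` so as to become
smooth on the line with bounded derivative. -/
theorem exists_smooth_extension {F : ℝ → ℝ} (hF : ContDiffOn ℝ ∞ F (Ioi (-1))) (hF0 : F 0 = 0)
    {c : ℝ} (hc : 0 < c) : ∃ T : ℝ → ℝ, ContDiff ℝ ∞ T ∧ T 0 = 0 ∧ (∃ L, ∀ s, |deriv T s| ≤ L) ∧
      ∀ s ∈ Icc 0 c, T s = F s := by
  let χ : ContDiffBump (c / 2) := ⟨c / 2, c / 2 + 1 / 2, by positivity, by linarith⟩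
  have hsm : ContDiff ℝ ∞ fun s => χ s * F s := by
    rw [contDiff_iff_contDiffAt]
    intro x
    rcases lt_or_ge (-1) x with hx | hx
    · exact χ.contDiff.contDiffAt.mul (hF.contDiffAt (Ioi_mem_nhds hx))
    · have : (fun s => χ s * F s) =ᶠ[𝓝 x] fun _ => 0 := by
        filter_upwards [gt_mem_nhds (show x < -1 / 2 by linarith)] with y hy
        have : χ y = 0 := by
          refine χ.zero_of_le_dist ?_
          rw [Real.dist_eq, abs_of_nonpos (by linarith)]
          change c / 2 + 1 / 2 ≤ _
          linarith
        rw [this, zero_mul]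
      exact contDiffAt_const.congr_of_eventuallyEq this
  have hcs : HasCompactSupport fun s => χ s * F s := χ.hasCompactSupport.mul_right
  refine ⟨fun s => χ s * F s, hsm, by simp [hF0], ?_, fun s hs => ?_⟩
  · exact (hsm.continuous_deriv (by simp)).bounded_above_of_compact_support hcs.deriv
  · have : χ s = 1 := by
      refine χ.one_of_mem_closedBall ?_
      rw [Metric.mem_closedBall, Real.dist_eq, abs_le]
      change -(c / 2) ≤ _ ∧ _ ≤ c / 2
      constructor <;> linarith [hs.1, hs.2]
    simp [this]

/-- The function `r ↦ (1 + β) r - (exp r - 1)` on `[0, ln (1 + β)]`, extended to the line by its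
boundary values. -/
def truncatedRemainder (β r : ℝ) : ℝ :=
  (1 + β) * max 0 (min r (Real.log (1 + β))) - (Real.exp (max 0 (min r (Real.log (1 + β)))) - 1)

section

variable {β : ℝ}

theorem truncatedRemainder_of_mem {r : ℝ} (hr : r ∈ Icc 0 (Real.log (1 + β))) :
    truncatedRemainder β r = (1 + β) * r - (Real.exp r - 1) := by
  rw [truncatedRemainder, min_eq_left hr.2, max_eq_right hr.1]

theorem truncatedRemainder_zero (hβ : 0 < β) : truncatedRemainder β 0 = 0 := by
  rw [truncatedRemainder_of_mem ⟨le_rfl, Real.log_nonneg (by linarith)⟩]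
  simp

/-- On `[0, ln (1 + β)]` the remainder is nondecreasing with slope at most `β`. -/
theorem remainder_sub_mem (hβ : 0 < β) {a b : ℝ} (ha : 0 ≤ a) (hab : a ≤ b)
    (hb : b ≤ Real.log (1 + β)) :
    0 ≤ ((1 + β) * b - (Real.exp b - 1)) - ((1 + β) * a - (Real.exp a - 1)) ∧
    ((1 + β) * b - (Real.exp b - 1)) - ((1 + β) * a - (Real.exp a - 1)) ≤ β * (b - a) := by
  have hM : Real.exp b ≤ 1 + β := by
    rw [← Real.exp_log (show 0 < 1 + β by linarith)]
    exact Real.exp_le_exp.2 hb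
  have h1 : b - a + 1 ≤ Real.exp (b - a) := Real.add_one_le_exp _
  have h2 : a - b + 1 ≤ Real.exp (a - b) := Real.add_one_le_exp _
  have h3 : Real.exp b = Real.exp a * Real.exp (b - a) := by rw [← Real.exp_add]; ring_nf
  have h4 : Real.exp a = Real.exp b * Real.exp (a - b) := by rw [← Real.exp_add]; ring_nf
  have h5 : 1 ≤ Real.exp a := Real.one_le_exp ha
  have h6 : 0 ≤ b - a := by linarith
  have h7 := Real.exp_pos b
  constructor
  · have : Real.exp b - Real.exp a ≤ (1 + β) * (b - a) := by
      calc Real.exp b - Real.exp a = Real.exp b * (1 - Real.exp (a - b)) := by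
            rw [mul_sub, ← h4, mul_one]
        _ ≤ Real.exp b * (b - a) := mul_le_mul_of_nonneg_left (by linarith) h7.le
        _ ≤ (1 + β) * (b - a) := by gcongr
    linarith
  · have : b - a ≤ Real.exp b - Real.exp a := by
      calc b - a ≤ Real.exp a * (b - a) := le_mul_of_one_le_left h6 h5
        _ ≤ Real.exp a * (Real.exp (b - a) - 1) :=
            mul_le_mul_of_nonneg_left (by linarith) (Real.exp_pos a).le
        _ = Real.exp b - Real.exp a := by rw [mul_sub, ← h3, mul_one]
    linarith

theorem lipschitzWith_truncatedRemainder (hβ : 0 < β) :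
    LipschitzWith β.toNNReal (truncatedRemainder β) := by
  have hl : 0 ≤ Real.log (1 + β) := Real.log_nonneg (by linarith)
  have key : ∀ r s, r ≤ s → |truncatedRemainder β s - truncatedRemainder β r| ≤ β * |s - r| := by
    intro r s hrs
    have hab : max 0 (min r (Real.log (1 + β))) ≤ max 0 (min s (Real.log (1 + β))) := by gcongr
    have hb : max 0 (min s (Real.log (1 + β))) ≤ Real.log (1 + β) := max_le hl (min_le_right _ _)
    obtain ⟨h1, h2⟩ := remainder_sub_mem hβ (le_max_left _ _) hab hb
    have h3 : max 0 (min s (Real.log (1 + β))) - max 0 (min r (Real.log (1 + β))) ≤ s - r := by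
      have e1 := abs_max_sub_max_le_max 0 (min s (Real.log (1 + β))) 0 (min r (Real.log (1 + β)))
      have e2 := abs_min_sub_min_le_max s (Real.log (1 + β)) r (Real.log (1 + β))
      rw [sub_self, abs_zero] at e1 e2
      rw [max_eq_right (a := (0 : ℝ)) (b := |_ - _|) (abs_nonneg _)] at e1
      rw [max_eq_left (abs_nonneg _), abs_of_nonneg (sub_nonneg.2 hrs)] at e2
      exact (le_abs_self _).trans (e1.trans e2)
    rw [truncatedRemainder, truncatedRemainder, abs_of_nonneg h1, abs_of_nonneg (by linarith)]
    exact h2.trans (by gcongr)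
  refine LipschitzWith.of_dist_le_mul fun r s => ?_
  rw [Real.dist_eq, Real.dist_eq, Real.coe_toNNReal _ hβ.le]
  rcases le_total r s with h | h
  · rw [abs_sub_comm, abs_sub_comm r]
    exact key r s h
  · exact key s r h

theorem truncatedRemainder_nonneg (hβ : 0 < β) (r : ℝ) : 0 ≤ truncatedRemainder β r := by
  have hl : 0 ≤ Real.log (1 + β) := Real.log_nonneg (by linarith)
  have h := (remainder_sub_mem hβ le_rfl (le_max_left 0 (min r (Real.log (1 + β))))
    (max_le hl (min_le_right _ _))).1
  rw [truncatedRemainder]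
  simpa using h

theorem truncatedRemainder_le (hβ : 0 < β) (r : ℝ) :
    truncatedRemainder β r ≤ (1 + β) * Real.log (1 + β) - β := by
  have hl : 0 ≤ Real.log (1 + β) := Real.log_nonneg (by linarith)
  have h := (remainder_sub_mem hβ (le_max_left 0 (min r (Real.log (1 + β))))
    (max_le hl (min_le_right _ _)) le_rfl).1
  rw [Real.exp_log (by linarith)] at h
  rw [truncatedRemainder]
  linarith

end

/-- Solvability of `exp w - 1 - c Δ_μ w = f` for data between `0` and `β`. With `N` the truncated
remainder, the equation reads `(1 + β) w - c Δ_μ w = f + N w` as long as `0 ≤ w ≤ ln (1 + β)`. Since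
`N` has Lipschitz constant `β`, the linear resolvent turns this into a fixed point equation for a
contraction with ratio `β / (1 + β)`, and the maximum principle gives the bounds on the solution. -/
theorem exists_hasH10Gradient_exp {d : ℕ} {ρ : Ed d → ℝ} (hρ : IsDataDensity ρ) {β c : ℝ}
    (hβ : 0 < β) (hc : 0 < c) {f : Ed d → ℝ} (hfm : AEStronglyMeasurable f (densityMeasure ρ))
    (hf : ∀ᵐ y ∂(densityMeasure ρ), 0 ≤ f y ∧ f y ≤ β) :
    ∃ (w : Ed d → ℝ) (G : Ed d → Ed d), HasH10Gradient (densityMeasure ρ) w G ∧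
      (∀ᵐ y ∂(densityMeasure ρ), w y ∈ Icc 0 (Real.log (1 + β))) ∧
      ∀ φ : Ed d → ℝ, ContDiff ℝ ∞ φ → HasCompactSupport φ →
        ∫ y, (f y - (Real.exp (w y) - 1)) * φ y ∂(densityMeasure ρ) =
          c * ∫ y, inner ℝ (G y) (gradient φ y) ∂(densityMeasure ρ) := by
  have := hρ.isProbabilityMeasure
  set ν := densityMeasure ρ with hν
  have hM : 0 < 1 + β := by linarith
  have hl : 0 ≤ Real.log (1 + β) := Real.log_nonneg (by linarith)
  set s : ℝ := √(c / (1 + β)) with hs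
  have hs0 : 0 < s := Real.sqrt_pos.2 (by positivity)
  have hs2 : s ^ 2 = c / (1 + β) := Real.sq_sqrt (by positivity)
  have hf2 : MemLp f 2 ν := by
    refine MemLp.of_bound hfm β ?_
    filter_upwards [hf] with y hy
    rw [Real.norm_of_nonneg hy.1]
    exact hy.2
  let N : Lp ℝ 2 ν → Lp ℝ 2 ν :=
    (lipschitzWith_truncatedRemainder hβ).compLp (truncatedRemainder_zero hβ)
  let F : Lp ℝ 2 ν → Lp ℝ 2 ν := fun w =>
    linearResolvent ν s ((1 + β)⁻¹ • (hf2.toLp f + N w))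
  have hcontr : ContractingWith (β / (1 + β)).toNNReal F := by
    refine ⟨?_, LipschitzWith.of_dist_le_mul fun w w' => ?_⟩
    · rw [Real.toNNReal_lt_one, div_lt_one hM]
      linarith
    · rw [Real.coe_toNNReal _ (by positivity)]
      have h1 := ((lipschitzWith_truncatedRemainder hβ).lipschitzWith_compLp
        (truncatedRemainder_zero hβ) (μ := ν) (p := 2)).dist_le_mul w w'
      rw [Real.coe_toNNReal _ hβ.le] at h1
      rw [dist_eq_norm]
      refine (norm_linearResolvent_sub_le _ _ _ _).trans ?_
      rw [← smul_sub, add_sub_add_left_eq_sub, norm_smul, norm_inv, Real.norm_of_nonneg hM.le,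
        ← dist_eq_norm]
      calc (1 + β)⁻¹ * dist (N w) (N w') ≤ (1 + β)⁻¹ * (β * dist w w') := by gcongr
        _ = β / (1 + β) * dist w w' := by ring
  obtain ⟨w, hw, -⟩ := hcontr.exists_fixedPoint 0 (edist_ne_top _ _)
  set h : Lp ℝ 2 ν := (1 + β)⁻¹ • (hf2.toLp f + N w) with hh
  obtain ⟨G, hG, heq⟩ := exists_hasH10Gradient_linearResolvent hρ hs0 h
  rw [show linearResolvent (densityMeasure ρ) s h = w from hw] at hG heq
  have hhy : ∀ᵐ y ∂ν, h y = (1 + β)⁻¹ * (f y + truncatedRemainder β (w y)) := by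
    filter_upwards [Lp.coeFn_smul (1 + β)⁻¹ (hf2.toLp f + N w), Lp.coeFn_add (hf2.toLp f) (N w),
      hf2.coeFn_toLp, (lipschitzWith_truncatedRemainder hβ).coeFn_compLp
      (truncatedRemainder_zero hβ) w] with y e1 e2 e3 e4
    have e4' : N w y = truncatedRemainder β (w y) := e4
    rw [hh, e1, Pi.smul_apply, e2, Pi.add_apply, e3, e4', smul_eq_mul]
  have hhi : Integrable (fun y => h y) ν := (Lp.memLp h).integrable (by norm_num)
  have hup : ∀ᵐ y ∂ν, w y ≤ Real.log (1 + β) := by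
    refine hG.ae_le_of_ae_le hρ hhi (sq_nonneg s) heq hl ?_
    filter_upwards [hhy, hf] with y hy hfy
    rw [hy, inv_mul_le_iff₀ hM]
    linarith [truncatedRemainder_le hβ (w y), hfy.2]
  have hlow : ∀ᵐ y ∂ν, -w y ≤ 0 := by
    refine hG.neg.ae_le_of_ae_le hρ (h := fun y => -h y) hhi.neg (sq_nonneg s) ?_ le_rfl ?_
    · intro φ hφ hφs
      have e1 : ∀ y, (-h y - -w y) * φ y = -((h y - w y) * φ y) := fun y => by ring
      simp_rw [e1, inner_neg_left, integral_neg]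
      rw [mul_neg, neg_inj]
      exact heq φ hφ hφs
    · filter_upwards [hhy, hf] with y hy hfy
      rw [hy, neg_nonpos]
      have := truncatedRemainder_nonneg hβ (w y)
      have := hfy.1
      positivity
  have hmem : ∀ᵐ y ∂ν, w y ∈ Icc 0 (Real.log (1 + β)) := by
    filter_upwards [hup, hlow] with y h1 h2
    exact ⟨by linarith, h1⟩
  refine ⟨w, G, hG, hmem, fun φ hφ hφs => ?_⟩
  have h1 := heq φ hφ hφs
  rw [hs2] at h1
  have h2 : ∫ y, (f y - (Real.exp (w y) - 1)) * φ y ∂ν =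
      (1 + β) * ∫ y, (h y - w y) * φ y ∂ν := by
    rw [← integral_const_mul]
    refine integral_congr_ae ?_
    filter_upwards [hmem, hhy] with y e1 e2
    rw [e2, truncatedRemainder_of_mem e1]
    field_simp
    ring
  have h3 : ∫ y, (h y - w y) * φ y ∂ν =
      c / (1 + β) * ∫ y, inner ℝ (G y) (gradient φ y) ∂ν := h1
  rw [h2, h3]
  field_simp

/-! ### The operator and its resolvents -/

section Operator

variable {d : ℕ} {ρ : Ed d → ℝ} {β : ℝ}

/-- The order interval `0 ≤ u ≤ β` in `L¹(μ)`; it is the closure of the domain of the operator. -/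
def orderInterval (ρ : Ed d → ℝ) (β : ℝ) : Set (L1 ρ) :=
  {u | ∀ᵐ y ∂(densityMeasure ρ), 0 ≤ u y ∧ u y ≤ β}

theorem domA_subset_orderInterval : domA ρ β ⊆ orderInterval ρ β := fun _ hv => hv.2.1

/-- The chain rule applied to `ln (1 + ·)`, which is smooth on the range of `v`. -/
theorem hasH10Gradient_log_one_add (hβ : 0 < β) {v : L1 ρ} (hv : v ∈ domA ρ β) :
    ∃ G, HasH10Gradient (densityMeasure ρ) (fun y => Real.log (1 + v y)) G := by
  obtain ⟨⟨G, h1, -, h2, h3⟩, hb, -⟩ := hv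
  have hG : HasH10Gradient (densityMeasure ρ) v G := ⟨h1, h2, h3⟩
  have hF : ContDiffOn ℝ ∞ (fun s : ℝ => Real.log (1 + s)) (Ioi (-1)) := by
    refine ContDiffOn.log (by fun_prop) fun x hx => ?_
    rw [mem_Ioi] at hx
    linarith
  obtain ⟨T, hT, hT0, ⟨L, hL⟩, hTF⟩ := exists_smooth_extension hF (by simp) hβ
  refine ⟨_, (hG.comp hT hT0 hL).congr_ae ?_ (ae_eq_refl _)⟩
  filter_upwards [hb] with y hy
  exact hTF _ hy

/-- The weak equation tested with smooth functions extends to `C²` test functions when the right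
side is square integrable. -/
theorem integral_mul_eq_of_contDiff (hρ : IsDataDensity ρ) {g : Ed d → ℝ} {G : Ed d → Ed d}
    (hg : MemLp g 2 (densityMeasure ρ)) (hG : MemLp G 2 (densityMeasure ρ)) {c : ℝ}
    (heq : ∀ φ : Ed d → ℝ, ContDiff ℝ ∞ φ → HasCompactSupport φ →
      ∫ y, g y * φ y ∂(densityMeasure ρ) =
        c * ∫ y, inner ℝ (G y) (gradient φ y) ∂(densityMeasure ρ))
    {φ : Ed d → ℝ} (hφ : ContDiff ℝ 2 φ) (hs : HasCompactSupport φ) :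
    ∫ y, g y * φ y ∂(densityMeasure ρ) =
      c * ∫ y, inner ℝ (G y) (gradient φ y) ∂(densityMeasure ρ) := by
  have h := HasH10Gradient.of_contDiff hρ (hφ.of_le (by simp)) hs
  obtain ⟨ψ, hψ, hψs, l1, l2, -⟩ := h.exists_seq
  have t1 := tendsto_integral_inner_of_tendsto_eLpNorm
    (fun n => hρ.memLp_of_continuous (hψ n).continuous (hψs n) 2) h.memLp hg l1
  have t2 := (tendsto_integral_inner_of_tendsto_eLpNorm
    (fun n => HasH10Gradient.memLp_gradient hρ ((hψ n).of_le (by simp)) (hψs n))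
    h.memLp_grad hG l2).const_mul c
  have e : ∀ w : Ed d → ℝ, ∫ y, g y * w y ∂(densityMeasure ρ) =
      ∫ y, inner ℝ (g y) (w y) ∂(densityMeasure ρ) := fun w =>
    integral_congr_ae (Eventually.of_forall fun y => by simp [mul_comm])
  rw [e]
  refine tendsto_nhds_unique t1 (t2.congr fun n => ?_)
  rw [← e, heq _ (hψ n) (hψs n)]

theorem integrable_mul_of_continuous (hρ : IsDataDensity ρ) {g : Ed d → ℝ}
    (hg : Integrable g (densityMeasure ρ)) {φ : Ed d → ℝ} (hφ : Continuous φ)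
    (hs : HasCompactSupport φ) : Integrable (fun y => g y * φ y) (densityMeasure ρ) := by
  obtain ⟨C, hC⟩ := hφ.bounded_above_of_compact_support hs
  exact hg.mul_bdd (hρ.aestronglyMeasurable_iff.2 hφ.aestronglyMeasurable)
    (Eventually.of_forall hC)

theorem integrable_inner {ν : Measure (Ed d)} {U V : Ed d → Ed d} (hU : MemLp U 2 ν)
    (hV : MemLp V 2 ν) : Integrable (fun y => inner ℝ (U y) (V y)) ν := by
  refine (hU.norm.integrable_mul hV.norm).mono' (hU.aestronglyMeasurable.inner
    hV.aestronglyMeasurable) (Eventually.of_forall fun y => norm_inner_le_norm _ _)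

/-- The accretivity inequality. Since `ln (1 + ·)` is increasing, `v₁ - v₂` and
`ln (1 + v₁) - ln (1 + v₂)` have the same sign, so that the sign property of the weighted Laplacian
applies. -/
theorem norm_sub_le_of_isWeakA (hρ : IsDataDensity ρ) (hβ : 0 < β) {v₁ v₂ g₁ g₂ : L1 ρ}
    (hv₁ : v₁ ∈ domA ρ β) (hv₂ : v₂ ∈ domA ρ β) (hg₁ : IsWeakA ρ v₁ g₁) (hg₂ : IsWeakA ρ v₂ g₂)
    {lam : ℝ} (hl : 0 ≤ lam) : ‖v₁ - v₂‖ ≤ ‖v₁ - v₂ + lam • (g₁ - g₂)‖ := by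
  obtain ⟨G₁, hG₁⟩ := hasH10Gradient_log_one_add hβ hv₁
  obtain ⟨G₂, hG₂⟩ := hasH10Gradient_log_one_add hβ hv₂
  have hi₁ := L1.integrable_coeFn g₁
  have hi₂ := L1.integrable_coeFn g₂
  have hG := hG₁.sub hG₂
  have hgi : Integrable (fun y => g₁ y - g₂ y) (densityMeasure ρ) := hi₁.sub hi₂
  have heq : ∀ φ : Ed d → ℝ, ContDiff ℝ ∞ φ → HasCompactSupport φ →
      ∫ y, (g₁ y - g₂ y) * φ y ∂(densityMeasure ρ) =
        (1 / 2) * ∫ y, inner ℝ (G₁ y - G₂ y) (gradient φ y) ∂(densityMeasure ρ) := by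
    intro φ hφ hs
    have hφ2 : ContDiff ℝ 2 φ := contDiff_infty.1 hφ 2
    have hgr := HasH10Gradient.memLp_gradient hρ (hφ.of_le (by simp)) hs
    simp_rw [sub_mul, inner_sub_left]
    rw [integral_sub (integrable_mul_of_continuous hρ hi₁ hφ.continuous hs)
      (integrable_mul_of_continuous hρ hi₂ hφ.continuous hs),
      integral_sub (integrable_inner hG₁.memLp_grad hgr) (integrable_inner hG₂.memLp_grad hgr),
      hg₁ φ hφ2 hs, hg₂ φ hφ2 hs, hG₁.integral_mul_weightedLaplacian hρ hφ2 hs,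
      hG₂.integral_mul_weightedLaplacian hρ hφ2 hs]
    ring
  have p1 := hG.setIntegral_nonneg hρ hgi (by norm_num) heq le_rfl
  have p2 := hG.neg.setIntegral_nonneg hρ (c := 1 / 2) (g := fun y => -(g₁ y - g₂ y)) hgi.neg
    (by norm_num)
    (fun φ hφ hs => by
      have := heq φ hφ hs
      simp_rw [neg_mul, inner_neg_left, integral_neg]
      rw [this]
      ring) le_rfl
  have i1 := integrable_mul_ite hgi hG.memLp.aestronglyMeasurable 0
  have i2 := integrable_mul_ite (g := fun y => -(g₁ y - g₂ y)) hgi.neg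
    hG.neg.memLp.aestronglyMeasurable 0
  have i3 : Integrable (fun y => ‖(v₁ - v₂ + lam • (g₁ - g₂) : L1 ρ) y‖) (densityMeasure ρ) :=
    (L1.integrable_coeFn _).norm
  rw [L1.norm_eq_integral_norm, L1.norm_eq_integral_norm]
  have key : ∫ y, ‖(v₁ - v₂ : L1 ρ) y‖ ∂(densityMeasure ρ) ≤
      ∫ y, (‖(v₁ - v₂ + lam • (g₁ - g₂) : L1 ρ) y‖
        - lam * ((g₁ y - g₂ y) * (if 0 < Real.log (1 + v₁ y) - Real.log (1 + v₂ y) then 1 else 0))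
        - lam * (-(g₁ y - g₂ y) *
          (if 0 < -(Real.log (1 + v₁ y) - Real.log (1 + v₂ y)) then 1 else 0)))
        ∂(densityMeasure ρ) := by
    refine integral_mono_ae (L1.integrable_coeFn _).norm
      ((i3.sub (i1.const_mul lam)).sub (i2.const_mul lam)) ?_
    filter_upwards [Lp.coeFn_add (v₁ - v₂) (lam • (g₁ - g₂)), Lp.coeFn_sub v₁ v₂,
      Lp.coeFn_smul lam (g₁ - g₂), Lp.coeFn_sub g₁ g₂, hv₁.2.1, hv₂.2.1] with y e1 e2 e3 e4 b1 b2
    rw [e1, Pi.add_apply, e2, e3, Pi.smul_apply, e4, Pi.sub_apply, Pi.sub_apply, smul_eq_mul]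
    simp only [Real.norm_eq_abs]
    have a1 : 0 < 1 + v₁ y := by linarith [b1.1]
    have a2 : 0 < 1 + v₂ y := by linarith [b2.1]
    rcases lt_trichotomy (Real.log (1 + v₁ y)) (Real.log (1 + v₂ y)) with h | h | h
    · rw [if_neg (by linarith), if_pos (by linarith)]
      have := (Real.log_lt_log_iff a1 a2).1 h
      rw [abs_of_neg (by linarith)]
      have := neg_abs_le (v₁ y - v₂ y + lam * (g₁ y - g₂ y))
      linarith
    · have := Real.log_injOn_pos a1 a2 h
      rw [if_neg (by linarith), if_neg (by linarith), show v₁ y - v₂ y = 0 by linarith, abs_zero]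
      simp only [mul_zero, sub_zero]
      exact abs_nonneg _
    · rw [if_pos (by linarith), if_neg (by linarith)]
      have := (Real.log_lt_log_iff a2 a1).1 h
      rw [abs_of_pos (by linarith)]
      have := le_abs_self (v₁ y - v₂ y + lam * (g₁ y - g₂ y))
      linarith
  have i4 : Integrable (fun y => ‖(v₁ - v₂ + lam • (g₁ - g₂) : L1 ρ) y‖ - lam *
      ((g₁ y - g₂ y) * (if 0 < Real.log (1 + v₁ y) - Real.log (1 + v₂ y) then 1 else 0)))
      (densityMeasure ρ) := i3.sub (i1.const_mul lam)
  rw [integral_sub i4 (i2.const_mul lam), integral_sub i3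
    (i1.const_mul lam), integral_const_mul, integral_const_mul] at key
  have := mul_nonneg hl p1
  have := mul_nonneg hl p2
  linarith

theorem isWeakA_opA {v : L1 ρ} (hv : v ∈ domA ρ β) : IsWeakA ρ v (opA ρ v) := by
  rw [opA, dif_pos hv.2.2]
  exact hv.2.2.choose_spec

theorem memLp_log_one_add {u : L1 ρ} (hu : u ∈ orderInterval ρ β) (hρ : IsDataDensity ρ) :
    MemLp (fun y => Real.log (1 + u y)) 2 (densityMeasure ρ) := by
  have := hρ.isProbabilityMeasure
  refine MemLp.of_bound (Real.measurable_log.comp_aemeasurable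
    ((Lp.aestronglyMeasurable u).aemeasurable.const_add 1)).aestronglyMeasurable
    (Real.log (1 + β)) ?_
  filter_upwards [hu] with y hy
  rw [Real.norm_of_nonneg (Real.log_nonneg (by linarith [hy.1]))]
  exact Real.log_le_log (by linarith [hy.1]) (by linarith [hy.2])

theorem integrable_log_mul {u : L1 ρ} (hu : u ∈ orderInterval ρ β) (hρ : IsDataDensity ρ)
    {φ : Ed d → ℝ} (hφ : ContDiff ℝ 2 φ) (hs : HasCompactSupport φ) :
    Integrable (fun y => Real.log (1 + u y) * weightedLaplacian ρ φ y) (densityMeasure ρ) :=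
  (memLp_log_one_add hu hρ).integrable_mul (memLp_weightedLaplacian hρ hφ hs)

/-- The resolvent equation says that `A v = (f - v) / lam`. -/
theorem isWeakResolventSol_iff (hρ : IsDataDensity ρ) {lam : ℝ} (hl : 0 < lam) {f v : L1 ρ} :
    IsWeakResolventSol ρ β lam f v ↔ v ∈ domA ρ β ∧ IsWeakA ρ v (lam⁻¹ • (f - v)) := by
  refine and_congr_right fun hv => forall_congr' fun φ => forall_congr' fun hφ =>
    forall_congr' fun hs => ?_
  have hK := domA_subset_orderInterval hv
  have i1 := integrable_mul_of_continuous hρ (L1.integrable_coeFn v) hφ.continuous hs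
  have i2 := integrable_mul_of_continuous hρ (L1.integrable_coeFn f) hφ.continuous hs
  rw [integral_sub i1 ((integrable_log_mul hK hρ hφ hs).const_mul _), integral_const_mul]
  have e : ∫ y, (lam⁻¹ • (f - v) : L1 ρ) y * φ y ∂(densityMeasure ρ) =
      lam⁻¹ * ((∫ y, f y * φ y ∂(densityMeasure ρ)) - ∫ y, v y * φ y ∂(densityMeasure ρ)) := by
    rw [← integral_sub i2 i1, ← integral_const_mul]
    refine integral_congr_ae ?_
    filter_upwards [Lp.coeFn_smul lam⁻¹ (f - v), Lp.coeFn_sub f v] with y e1 e2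
    rw [e1, Pi.smul_apply, e2, Pi.sub_apply, smul_eq_mul]
    ring
  rw [e, inv_mul_eq_iff_eq_mul₀ hl.ne']
  constructor <;> intro h <;> linarith

/-- The range condition: `v = exp w - 1`, where `exp w - 1 - (lam / 2) Δ_μ w = f`. -/
theorem exists_isWeakResolventSol (hρ : IsDataDensity ρ) (hβ : 0 < β) {lam : ℝ} (hl : 0 < lam)
    {f : L1 ρ} (hf : f ∈ orderInterval ρ β) : ∃ v, IsWeakResolventSol ρ β lam f v := by
  have := hρ.isProbabilityMeasure
  obtain ⟨w, G, hG, hw, heq⟩ := exists_hasH10Gradient_exp hρ hβ (half_pos hl)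
    (Lp.aestronglyMeasurable f) hf
  have hl1 : 0 < Real.log (1 + β) := Real.log_pos (by linarith)
  have hexp : ∀ᵐ y ∂(densityMeasure ρ), 0 ≤ Real.exp (w y) - 1 ∧ Real.exp (w y) - 1 ≤ β := by
    filter_upwards [hw] with y hy
    have h1 := Real.one_le_exp hy.1
    have h2 := Real.exp_le_exp.2 hy.2
    rw [Real.exp_log (by linarith)] at h2
    constructor <;> linarith
  have hm : AEStronglyMeasurable (fun y => Real.exp (w y) - 1) (densityMeasure ρ) :=
    (Real.continuous_exp.comp_aestronglyMeasurable hG.memLp.aestronglyMeasurable).sub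
      aestronglyMeasurable_const
  have hm' : ∀ p, MemLp (fun y => Real.exp (w y) - 1) p (densityMeasure ρ) := fun p =>
    MemLp.of_bound hm β (by
      filter_upwards [hexp] with y hy
      rw [Real.norm_of_nonneg hy.1]
      exact hy.2)
  have hfm : MemLp f 2 (densityMeasure ρ) := MemLp.of_bound (Lp.aestronglyMeasurable f) β (by
      filter_upwards [hf] with y hy
      rw [Real.norm_of_nonneg hy.1]
      exact hy.2)
  set v : L1 ρ := (hm' 1).toLp _ with hv
  have hvy : ∀ᵐ y ∂(densityMeasure ρ), v y = Real.exp (w y) - 1 := (hm' 1).coeFn_toLp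
  have hF : ContDiffOn ℝ ∞ (fun s : ℝ => Real.exp s - 1) (Ioi (-1)) :=
    (Real.contDiff_exp.sub contDiff_const).contDiffOn
  obtain ⟨T, hT, hT0, ⟨L, hL⟩, hTF⟩ := exists_smooth_extension hF (by simp) hl1
  have hvG : HasH10Gradient (densityMeasure ρ) v _ :=
    (hG.comp hT hT0 hL).congr_ae (by
      filter_upwards [hw, hvy] with y hy h1
      rw [h1]
      exact hTF _ hy) (ae_eq_refl _)
  have hvK : v ∈ orderInterval ρ β := by
    filter_upwards [hexp, hvy] with y h1 h2
    rwa [h2]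
  have hA : IsWeakA ρ v (lam⁻¹ • (f - v)) := by
    intro φ hφ hs
    have e1 : ∫ y, Real.log (1 + v y) * weightedLaplacian ρ φ y ∂(densityMeasure ρ) =
        ∫ y, w y * weightedLaplacian ρ φ y ∂(densityMeasure ρ) := by
      refine integral_congr_ae ?_
      filter_upwards [hvy] with y h1
      rw [h1, add_sub_cancel, Real.log_exp]
    have e2 : ∫ y, (lam⁻¹ • (f - v) : L1 ρ) y * φ y ∂(densityMeasure ρ) =
        lam⁻¹ * ∫ y, (f y - (Real.exp (w y) - 1)) * φ y ∂(densityMeasure ρ) := by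
      rw [← integral_const_mul]
      refine integral_congr_ae ?_
      filter_upwards [Lp.coeFn_smul lam⁻¹ (f - v), Lp.coeFn_sub f v, hvy] with y e1 e2 e3
      rw [e1, Pi.smul_apply, e2, Pi.sub_apply, e3, smul_eq_mul]
      ring
    rw [e1, e2, integral_mul_eq_of_contDiff hρ (g := fun y => f y - (Real.exp (w y) - 1))
      (hfm.sub (hm' 2)) hG.memLp_grad heq hφ hs,
      hG.integral_mul_weightedLaplacian hρ hφ hs]
    field_simp
  exact ⟨v, (isWeakResolventSol_iff hρ hl).2 ⟨⟨hvG.memH10 hρ, hvK, _, hA⟩, hA⟩⟩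

theorem isWeakResolventSol_resolventA (hρ : IsDataDensity ρ) (hβ : 0 < β) {lam : ℝ} (hl : 0 < lam)
    {f : L1 ρ} (hf : f ∈ orderInterval ρ β) :
    IsWeakResolventSol ρ β lam f (resolventA ρ β lam f) := by
  have h := exists_isWeakResolventSol hρ hβ hl hf
  rw [resolventA, if_neg hl.ne', dif_pos h]
  exact h.choose_spec

theorem isClosed_orderInterval (hρ : IsDataDensity ρ) : IsClosed (orderInterval ρ β) := by
  have := hρ.isProbabilityMeasure
  have hc : MemLp (fun _ : Ed d => β) 1 (densityMeasure ρ) := memLp_const β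
  have e : orderInterval ρ β = Icc 0 (hc.toLp _) := by
    ext u
    rw [mem_Icc, ← Lp.coeFn_le, ← Lp.coeFn_le]
    have h0 := Lp.coeFn_zero ℝ 1 (densityMeasure ρ)
    constructor
    · intro h
      constructor
      · filter_upwards [h, h0] with y hy e
        rw [e]
        exact hy.1
      · filter_upwards [h, hc.coeFn_toLp] with y hy e
        rw [e]
        exact hy.2
    · rintro ⟨h1, h2⟩
      filter_upwards [h1, h2, h0, hc.coeFn_toLp] with y a1 a2 e1 e2
      rw [e1] at a1
      rw [e2] at a2
      exact ⟨a1, a2⟩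
  rw [e]
  exact isClosed_Icc

/-- Smooth compactly supported functions with values in `[0, β]` belong to the domain. -/
theorem toLp_mem_domA (hρ : IsDataDensity ρ) {φ : Ed d → ℝ} (hφ : ContDiff ℝ ∞ φ)
    (hs : HasCompactSupport φ) (hb : ∀ y, 0 ≤ φ y ∧ φ y ≤ β) :
    (hρ.memLp_of_continuous hφ.continuous hs 1).toLp φ ∈ domA ρ β := by
  have := hρ.isProbabilityMeasure
  have hm := hρ.memLp_of_continuous hφ.continuous hs 1
  have hae : ∀ᵐ y ∂(densityMeasure ρ), hm.toLp φ y = φ y := hm.coeFn_toLp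
  have h1 : HasH10Gradient (densityMeasure ρ) (hm.toLp φ) (gradient φ) :=
    (HasH10Gradient.of_contDiff hρ (hφ.of_le (by simp)) hs).congr_ae hm.coeFn_toLp.symm
      (ae_eq_refl _)
  refine ⟨h1.memH10 hρ, ?_, ?_⟩
  · filter_upwards [hae] with y e
    rw [e]
    exact hb y
  · set w : Ed d → ℝ := fun y => Real.log (1 + φ y) with hw
    have hw2 : ContDiff ℝ 2 w := by
      refine ContDiff.log (contDiff_const.add (contDiff_infty.1 hφ 2)) fun y => ?_
      linarith [(hb y).1]
    have hws : HasCompactSupport w := by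
      refine hs.mono fun y hy => ?_
      rw [Function.mem_support] at hy ⊢
      contrapose! hy
      simp [hw, hy]
    have hL : MemLp (fun y => -(1 / 2) * weightedLaplacian ρ w y) 1 (densityMeasure ρ) :=
      ((memLp_weightedLaplacian hρ hw2 hws).const_mul _).mono_exponent (by norm_num)
    refine ⟨hL.toLp _, fun ψ hψ hψs => ?_⟩
    have e1 : ∫ y, hL.toLp _ y * ψ y ∂(densityMeasure ρ) =
        -(1 / 2) * ∫ y, ψ y * weightedLaplacian ρ w y ∂(densityMeasure ρ) := by
      rw [← integral_const_mul]
      refine integral_congr_ae ?_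
      filter_upwards [hL.coeFn_toLp] with y e
      rw [e]
      ring
    have e2 : ∫ y, Real.log (1 + hm.toLp φ y) * weightedLaplacian ρ ψ y ∂(densityMeasure ρ) =
        ∫ y, w y * weightedLaplacian ρ ψ y ∂(densityMeasure ρ) := by
      refine integral_congr_ae ?_
      filter_upwards [hae] with y e
      rw [e]
    rw [e1, e2, integral_mul_weightedLaplacian_of_contDiff hρ (hψ.of_le (by simp)) hψs hw2 hws,
      integral_mul_weightedLaplacian_of_contDiff hρ (hw2.of_le (by simp)) hws hψ hψs]
    simp_rw [real_inner_comm]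

/-- A continuous compactly supported function with values in `[0, β]` is a uniform limit of smooth
ones. Approximating a multiple of the square root and squaring keeps the values in `[0, β]`. -/
theorem exists_contDiff_abs_sub_le (hβ : 0 < β) {k : Ed d → ℝ} (hk : Continuous k)
    (hs : HasCompactSupport k) (hb : ∀ y, 0 ≤ k y ∧ k y ≤ β) {ε : ℝ} (hε : 0 < ε) :
    ∃ φ : Ed d → ℝ, ContDiff ℝ ∞ φ ∧ HasCompactSupport φ ∧ (∀ y, 0 ≤ φ y ∧ φ y ≤ β) ∧
      ∀ y, |k y - φ y| ≤ ε := by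
  -- shrinking the square root by `1 - δ` leaves room for an approximation error of `δ √β`
  set δ : ℝ := min (1 / 2) (ε / (4 * β)) with hδ
  have hδ0 : 0 < δ := by positivity
  have hδ1 : δ ≤ 1 / 2 := min_le_left _ _
  have hδ2 : 4 * β * δ ≤ ε := by
    have : δ ≤ ε / (4 * β) := min_le_right _ _
    rw [le_div_iff₀ (by positivity)] at this
    linarith
  have hsβ : 0 < √β := Real.sqrt_pos.2 hβ
  have hsβ2 : √β * √β = β := Real.mul_self_sqrt hβ.le
  set q : Ed d → ℝ := fun y => (1 - δ) * √(k y) with hq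
  have hqc : Continuous q := continuous_const.mul hk.sqrt
  obtain ⟨p, hp, hpq, hps⟩ := hqc.exists_contDiff_approx ⊤ (ε := fun _ => δ * √β) (by fun_prop)
    (by intro; positivity)
  have hqs : HasCompactSupport q := by
    refine hs.mono fun y hy => ?_
    rw [Function.mem_support] at hy ⊢
    contrapose! hy
    simp [hq, hy]
  have hps' : HasCompactSupport p := hqs.mono hps
  have hr : ∀ y, 0 ≤ √(k y) ∧ √(k y) ≤ √β := fun y =>
    ⟨Real.sqrt_nonneg _, Real.sqrt_le_sqrt (hb y).2⟩
  have hpa : ∀ y, -(δ * √β) ≤ p y - q y ∧ p y - q y ≤ δ * √β := fun y => by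
    have := (hpq y).le
    rwa [Real.dist_eq, abs_le] at this
  have hp1 : ∀ y, |p y| ≤ √β := by
    intro y
    obtain ⟨h1, h2⟩ := hpa y
    obtain ⟨h3, h4⟩ := hr y
    simp only [hq] at h1 h2
    have h5 : 0 ≤ (1 - δ) * √(k y) := mul_nonneg (by linarith) h3
    have h6 : (1 - δ) * √(k y) ≤ (1 - δ) * √β := mul_le_mul_of_nonneg_left h4 (by linarith)
    have h7 : δ * √β ≤ 1 / 2 * √β := mul_le_mul_of_nonneg_right hδ1 hsβ.le
    rw [abs_le]
    constructor <;> linarith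
  refine ⟨fun y => p y * p y, hp.mul hp, hps'.mul_left, fun y => ⟨mul_self_nonneg _, ?_⟩,
    fun y => ?_⟩
  · change p y * p y ≤ β
    rw [← abs_mul_abs_self, ← hsβ2]
    exact mul_self_le_mul_self (abs_nonneg _) (hp1 y)
  · have e : k y - p y * p y = (√(k y) - p y) * (√(k y) + p y) := by
      linear_combination -(Real.mul_self_sqrt (hb y).1)
    have h1 : |√(k y) - p y| ≤ 2 * δ * √β := by
      obtain ⟨h1, h2⟩ := hpa y
      obtain ⟨h3, h4⟩ := hr y
      simp only [hq] at h1 h2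
      have h5 : δ * √(k y) ≤ δ * √β := mul_le_mul_of_nonneg_left h4 hδ0.le
      have h6 : 0 ≤ δ * √(k y) := mul_nonneg hδ0.le h3
      rw [abs_le]
      constructor <;> linarith
    have h2 : |√(k y) + p y| ≤ 2 * √β := by
      refine (abs_add_le _ _).trans ?_
      rw [abs_of_nonneg (hr y).1]
      linarith [(hr y).2, hp1 y]
    change |k y - p y * p y| ≤ ε
    rw [e, abs_mul]
    calc |√(k y) - p y| * |√(k y) + p y| ≤ (2 * δ * √β) * (2 * √β) := by gcongr
      _ = 4 * (√β * √β) * δ := by ring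
      _ ≤ ε := by rw [hsβ2]; exact hδ2

theorem orderInterval_subset_closure (hρ : IsDataDensity ρ) (hβ : 0 < β) :
    orderInterval ρ β ⊆ closure (domA ρ β) := by
  have := hρ.isProbabilityMeasure
  intro f hf
  rw [Metric.mem_closure_iff]
  intro ε hε
  obtain ⟨g, hgs, hfg, hgc, hgi⟩ := (L1.integrable_coeFn f).exists_hasCompactSupport_integral_sub_le
    (show 0 < ε / 3 by positivity)
  set k : Ed d → ℝ := fun y => max 0 (min (g y) β) with hk
  have hkc : Continuous k := continuous_const.max (hgc.min continuous_const)
  have hks : HasCompactSupport k := by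
    refine hgs.mono fun y hy => ?_
    rw [Function.mem_support] at hy ⊢
    contrapose! hy
    simp [hk, hy, hβ.le]
  obtain ⟨φ, hφ, hφs, hφb, hφk⟩ := exists_contDiff_abs_sub_le hβ hkc hks
    (fun y => ⟨le_max_left _ _, max_le hβ.le (min_le_right _ _)⟩) (show 0 < ε / 3 by positivity)
  refine ⟨_, toLp_mem_domA hρ hφ hφs hφb, ?_⟩
  have hm := hρ.memLp_of_continuous hφ.continuous hφs 1
  rw [dist_eq_norm, L1.norm_eq_integral_norm]
  have hle : ∫ y, ‖(f - hm.toLp φ : L1 ρ) y‖ ∂(densityMeasure ρ) ≤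
      ∫ y, (‖f y - g y‖ + ε / 3) ∂(densityMeasure ρ) := by
    refine integral_mono_ae (L1.integrable_coeFn _).norm
      (((L1.integrable_coeFn f).sub hgi).norm.add (integrable_const _)) ?_
    filter_upwards [Lp.coeFn_sub f (hm.toLp φ), hm.coeFn_toLp, hf] with y e1 e2 hy
    rw [e1, Pi.sub_apply, e2, Real.norm_eq_abs, Real.norm_eq_abs]
    have h1 : |f y - k y| ≤ |f y - g y| := by
      have e3 : f y = max 0 (min (f y) β) := by rw [min_eq_left hy.2, max_eq_right hy.1]
      have a1 := abs_max_sub_max_le_max 0 (min (f y) β) 0 (min (g y) β)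
      have a2 := abs_min_sub_min_le_max (f y) β (g y) β
      rw [sub_self, abs_zero, max_eq_right (a := (0 : ℝ)) (b := |_ - _|) (abs_nonneg _)] at a1
      rw [sub_self, abs_zero, max_eq_left (a := |_ - _|) (b := (0 : ℝ)) (abs_nonneg _)] at a2
      rw [← e3] at a1
      exact a1.trans a2
    have h2 := abs_sub_le (f y) (k y) (φ y)
    linarith [hφk y]
  have i : Integrable (fun y => ‖f y - g y‖) (densityMeasure ρ) :=
    ((L1.integrable_coeFn f).sub hgi).norm
  rw [integral_add i (integrable_const _)] at hle
  simp only [integral_const, probReal_univ, one_smul] at hle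
  linarith

theorem closure_domA (hρ : IsDataDensity ρ) (hβ : 0 < β) :
    closure (domA ρ β) = orderInterval ρ β :=
  (closure_minimal domA_subset_orderInterval (isClosed_orderInterval hρ)).antisymm
    (orderInterval_subset_closure hρ hβ)

/-- Resolvent solutions for different parameters and data satisfy the comparison inequality used in
Kobayashi's estimate. -/
theorem IsWeakResolventSol.compare (hρ : IsDataDensity ρ) (hβ : 0 < β) {lam mu : ℝ} (hl : 0 < lam)
    (hm : 0 < mu) {x y u v : L1 ρ} (hu : IsWeakResolventSol ρ β lam x u)
    (hv : IsWeakResolventSol ρ β mu y v) :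
    (lam + mu) * ‖u - v‖ ≤ ‖lam • (u - y) + mu • (x - v)‖ := by
  rw [isWeakResolventSol_iff hρ hl] at hu
  rw [isWeakResolventSol_iff hρ hm] at hv
  have hlm : 0 < lam + mu := by positivity
  -- with this parameter the contributions of `u` and `v` cancel up to the weights `lam` and `mu`
  have h := norm_sub_le_of_isWeakA hρ hβ hu.1 hv.1 hu.2 hv.2
    (lam := lam * mu / (lam + mu)) (by positivity)
  have e : (lam + mu) • (u - v + (lam * mu / (lam + mu)) • (lam⁻¹ • (x - u) - mu⁻¹ • (y - v))) =
      lam • (u - y) + mu • (x - v) := by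
    rw [smul_add, smul_smul, smul_sub (_ * _), smul_smul, smul_smul]
    have c1 : (lam + mu) * (lam * mu / (lam + mu)) * lam⁻¹ = mu := by field_simp
    have c2 : (lam + mu) * (lam * mu / (lam + mu)) * mu⁻¹ = lam := by field_simp
    rw [c1, c2]
    module
  rw [← e, norm_smul, Real.norm_of_nonneg hlm.le]
  gcongr

/-- The resolvents are nonexpansive. -/
theorem IsWeakResolventSol.norm_sub_le (hρ : IsDataDensity ρ) (hβ : 0 < β) {lam : ℝ}
    (hl : 0 < lam) {x y u v : L1 ρ} (hu : IsWeakResolventSol ρ β lam x u)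
    (hv : IsWeakResolventSol ρ β lam y v) : ‖u - v‖ ≤ ‖x - y‖ := by
  rw [isWeakResolventSol_iff hρ hl] at hu hv
  have h := norm_sub_le_of_isWeakA hρ hβ hu.1 hv.1 hu.2 hv.2 hl.le
  rw [smul_sub, smul_inv_smul₀ hl.ne', smul_inv_smul₀ hl.ne'] at h
  refine h.trans_eq (congrArg _ ?_)
  abel

/-- The abstract exponential formula applies: the range condition holds on the closure of the
domain, and one step from `x ∈ D(A)` has length at most `lam ‖A x‖`. -/
theorem isResolventFamily_resolventA (hρ : IsDataDensity ρ) (hβ : 0 < β) :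
    IsResolventFamily (orderInterval ρ β) (domA ρ β) (resolventA ρ β) where
  isClosed := isClosed_orderInterval hρ
  subset := domA_subset_orderInterval
  dense := orderInterval_subset_closure hρ hβ
  zero := fun x => by rw [resolventA, if_pos rfl]
  mapsTo := fun lam hl x hx =>
    domA_subset_orderInterval (isWeakResolventSol_resolventA hρ hβ hl hx).1
  nonexpansive := fun lam hl x hx y hy =>
    (isWeakResolventSol_resolventA hρ hβ hl hx).norm_sub_le hρ hβ hl
      (isWeakResolventSol_resolventA hρ hβ hl hy)
  compare := fun lam hl mu hm x hx y hy => by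
    refine ((isWeakResolventSol_resolventA hρ hβ hl hx).compare hρ hβ hl hm
      (isWeakResolventSol_resolventA hρ hβ hm hy)).trans ((norm_add_le _ _).trans_eq ?_)
    rw [norm_smul, norm_smul, Real.norm_of_nonneg hl.le, Real.norm_of_nonneg hm.le]
  step := fun x hx => by
    refine ⟨‖opA ρ x‖, norm_nonneg _, fun lam hl => ?_⟩
    have hu := (isWeakResolventSol_iff hρ hl).1
      (isWeakResolventSol_resolventA hρ hβ hl (domA_subset_orderInterval hx))
    have h := norm_sub_le_of_isWeakA hρ hβ hu.1 hx hu.2 (isWeakA_opA hx) hl.le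
    rw [smul_sub, smul_inv_smul₀ hl.ne'] at h
    have e : resolventA ρ β lam x - x + (x - resolventA ρ β lam x - lam • opA ρ x) =
        -(lam • opA ρ x) := by abel
    rwa [e, norm_neg, norm_smul, Real.norm_of_nonneg hl.le] at h

end Operator

/-! ### Test functions in time and space -/

namespace IsTestC12

variable {d : ℕ} {φ : ℝ → Ed d → ℝ}

theorem hasCompactSupport_slice (hφ : IsTestC12 φ) (t : ℝ) : HasCompactSupport (φ t) := by
  refine HasCompactSupport.intro (hφ.hasCompactSupport.isCompact.image continuous_snd)
    fun y hy => ?_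
  by_contra h
  exact hy ⟨(t, y), subset_tsupport _ h, rfl⟩

theorem eventuallyEq_zero {t : ℝ} {y : Ed d}
    (h : (t, y) ∉ tsupport fun p : ℝ × Ed d => φ p.1 p.2) : φ t =ᶠ[𝓝 y] 0 :=
  (Continuous.prodMk_right t).continuousAt.eventually (notMem_tsupport_iff_eventuallyEq.1 h)

theorem deriv_eq_zero {t : ℝ} {y : Ed d}
    (h : (t, y) ∉ tsupport fun p : ℝ × Ed d => φ p.1 p.2) : deriv (fun s => φ s y) t = 0 := by
  have h1 : (fun s => φ s y) =ᶠ[𝓝 t] fun _ => 0 :=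
    (Continuous.prodMk_left y).continuousAt.eventually (notMem_tsupport_iff_eventuallyEq.1 h)
  rw [h1.deriv_eq, deriv_const]

theorem fderiv_eq_zero {t : ℝ} {y : Ed d}
    (h : (t, y) ∉ tsupport fun p : ℝ × Ed d => φ p.1 p.2) : fderiv ℝ (φ t) y = 0 := by
  rw [(eventuallyEq_zero h).fderiv_eq]
  exact fderiv_const_apply 0

theorem fderiv_fderiv_eq_zero {t : ℝ} {y : Ed d}
    (h : (t, y) ∉ tsupport fun p : ℝ × Ed d => φ p.1 p.2) :
    fderiv ℝ (fderiv ℝ (φ t)) y = 0 := by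
  have h1 : fderiv ℝ (φ t) =ᶠ[𝓝 y] fun _ => 0 :=
    (eventuallyEq_zero h).fderiv.trans (Eventually.of_forall fun z => fderiv_const_apply 0)
  rw [h1.fderiv_eq]
  exact fderiv_const_apply 0

/-- The derivatives of a test function are bounded. -/
theorem exists_bound (hφ : IsTestC12 φ) : ∃ B, 0 ≤ B ∧ ∀ t y, |deriv (fun s => φ s y) t| ≤ B ∧
    ‖fderiv ℝ (φ t) y‖ ≤ B ∧ ‖fderiv ℝ (fderiv ℝ (φ t)) y‖ ≤ B := by
  have hK := hφ.hasCompactSupport.isCompact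
  obtain ⟨B₁, h₁⟩ := hK.exists_bound_of_continuousOn hφ.continuous_deriv_time.continuousOn
  obtain ⟨B₂, h₂⟩ := hK.exists_bound_of_continuousOn hφ.continuous_fderiv.continuousOn
  obtain ⟨B₃, h₃⟩ := hK.exists_bound_of_continuousOn (E := Ed d →L[ℝ] Ed d →L[ℝ] ℝ)
    (f := fun p : ℝ × Ed d => fderiv ℝ (fderiv ℝ (φ p.1)) p.2)
    hφ.continuous_fderiv_fderiv.continuousOn
  have hB : 0 ≤ max 0 (max B₁ (max B₂ B₃)) := le_max_left _ _
  refine ⟨max 0 (max B₁ (max B₂ B₃)), hB, fun t y => ?_⟩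
  by_cases hp : (t, y) ∈ tsupport fun p : ℝ × Ed d => φ p.1 p.2
  · exact ⟨(h₁ _ hp).trans (by simp), (h₂ _ hp).trans (by simp), (h₃ _ hp).trans (by simp)⟩
  · rw [deriv_eq_zero hp, fderiv_eq_zero hp, fderiv_fderiv_eq_zero hp, abs_zero, norm_zero,
      ContinuousLinearMap.opNorm_zero]
    exact ⟨hB, hB, hB⟩

/-- A test function vanishes outside a compact time interval contained in `(0, ∞)`. -/
theorem exists_notMem_tsupport (hφ : IsTestC12 φ) : ∃ a b : ℝ, 0 < a ∧ a ≤ b ∧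
    ∀ t y, (t ≤ a ∨ b ≤ t) → (t, y) ∉ tsupport fun p : ℝ × Ed d => φ p.1 p.2 := by
  have hT := hφ.hasCompactSupport.isCompact.image continuous_fst
  rcases (Prod.fst '' tsupport fun p : ℝ × Ed d => φ p.1 p.2).eq_empty_or_nonempty with h | h
  · refine ⟨1, 1, one_pos, le_rfl, fun t y _ hm => ?_⟩
    rw [image_eq_empty] at h
    rw [h] at hm
    exact hm
  · obtain ⟨m, ⟨p, hp, rfl⟩, hm⟩ := hT.exists_isLeast h
    obtain ⟨M, ⟨q, hq, rfl⟩, hM⟩ := hT.exists_isGreatest h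
    have h0 : 0 < p.1 := (hφ.tsupport_subset hp).1
    have hpq : p.1 ≤ q.1 := hm ⟨q, hq, rfl⟩
    refine ⟨p.1 / 2, q.1 + 1, by positivity, by linarith, fun t y ht hmem => ?_⟩
    have h1 : p.1 ≤ t := hm ⟨(t, y), hmem, rfl⟩
    have h2 : t ≤ q.1 := hM ⟨(t, y), hmem, rfl⟩
    rcases ht with ht | ht <;> linarith

theorem weightedLaplacian_eq_zero (ρ : Ed d → ℝ) {t : ℝ} {y : Ed d}
    (h : (t, y) ∉ tsupport fun p : ℝ × Ed d => φ p.1 p.2) : weightedLaplacian ρ (φ t) y = 0 := by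
  have hg : gradient (φ t) y = 0 := by rw [gradient, fderiv_eq_zero h, map_zero]
  rw [weightedLaplacian, laplacian_eq_sum, fderiv_fderiv_eq_zero h, hg, inner_zero_right]
  simp

end IsTestC12

theorem abs_weightedLaplacian_le {d : ℕ} (ρ : Ed d → ℝ) {φ : Ed d → ℝ} {y : Ed d} {B : ℝ}
    (h1 : ‖fderiv ℝ φ y‖ ≤ B) (h2 : ‖fderiv ℝ (fderiv ℝ φ) y‖ ≤ B) :
    |weightedLaplacian ρ φ y| ≤
      d * B + ‖weakGradient (fun z => Real.log (ρ z)) y‖ * B := by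
  refine (abs_add_le _ _).trans (add_le_add ?_ ?_)
  · rw [laplacian_eq_sum]
    refine (Finset.abs_sum_le_sum_abs _ _).trans ?_
    refine (Finset.sum_le_card_nsmul _ _ B fun i _ => ?_).trans_eq (by simp)
    have := (fderiv ℝ (fderiv ℝ φ) y).le_opNorm₂ (stdOrthonormalBasis ℝ (Ed d) i)
      (stdOrthonormalBasis ℝ (Ed d) i)
    rw [OrthonormalBasis.norm_eq_one, mul_one, mul_one] at this
    exact this.trans h2
  · refine (abs_real_inner_le_norm _ _).trans ?_
    rw [norm_gradient]
    gcongr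

/-! ### The flow solves the evolution equation -/

section Evolution

variable {d : ℕ} {ρ : Ed d → ℝ} {β : ℝ}

theorem abs_integral_mul_sub_le (u u' : L1 ρ) {ψ : Ed d → ℝ}
    (hψ : AEStronglyMeasurable ψ (densityMeasure ρ)) {B : ℝ} (hB : ∀ y, |ψ y| ≤ B) :
    |(∫ y, u y * ψ y ∂(densityMeasure ρ)) - ∫ y, u' y * ψ y ∂(densityMeasure ρ)| ≤
      B * ‖u - u'‖ := by
  have i (w : L1 ρ) : Integrable (fun y => w y * ψ y) (densityMeasure ρ) :=
    (L1.integrable_coeFn w).mul_bdd hψ (Eventually.of_forall hB)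
  rw [← integral_sub (i u) (i u'), L1.norm_eq_integral_norm (u - u'), ← integral_const_mul,
    ← Real.norm_eq_abs]
  refine norm_integral_le_of_norm_le ((L1.integrable_coeFn (u - u')).norm.const_mul B) ?_
  filter_upwards [Lp.coeFn_sub u u'] with y e
  rw [e, Pi.sub_apply, ← sub_mul, norm_mul, mul_comm]
  exact mul_le_mul_of_nonneg_right (hB y) (norm_nonneg _)

theorem continuous_integral_mul {ψ : Ed d → ℝ} (hψ : AEStronglyMeasurable ψ (densityMeasure ρ))
    {B : ℝ} (hB : ∀ y, |ψ y| ≤ B) :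
    Continuous fun u : L1 ρ => ∫ y, u y * ψ y ∂(densityMeasure ρ) := by
  refine LipschitzWith.continuous (K := B.toNNReal) (LipschitzWith.of_dist_le_mul fun u u' => ?_)
  rw [dist_eq_norm, dist_eq_norm, Real.coe_toNNReal _ ((abs_nonneg _).trans (hB 0))]
  exact abs_integral_mul_sub_le u u' hψ hB

theorem abs_log_one_add_sub_le {a b : ℝ} (ha : 0 ≤ a) (hb : 0 ≤ b) :
    |Real.log (1 + a) - Real.log (1 + b)| ≤ |a - b| := by
  wlog h : b ≤ a generalizing a b
  · rw [abs_sub_comm, abs_sub_comm a]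
    exact this hb ha (le_of_not_ge h)
  have h1 : Real.log (1 + b) ≤ Real.log (1 + a) := Real.log_le_log (by linarith) (by linarith)
  rw [abs_of_nonneg (by linarith), abs_of_nonneg (by linarith),
    ← Real.log_div (by linarith) (by linarith)]
  refine (Real.log_le_sub_one_of_pos (by positivity)).trans ?_
  have e : (1 + a) / (1 + b) - 1 = (a - b) / (1 + b) := by
    field_simp
    ring
  rw [e]
  exact div_le_self (by linarith) (by linarith)

/-- On the order interval, `L¹` convergence gives convergence of `∫ ln (1 + u) ξ` for every square
integrable `ξ`, because `|u - u'|² ≤ β |u - u'|` there. -/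
theorem continuousOn_integral_log_mul (hρ : IsDataDensity ρ) (hβ : 0 < β) {ξ : Ed d → ℝ}
    (hξ : MemLp ξ 2 (densityMeasure ρ)) :
    ContinuousOn (fun u : L1 ρ => ∫ y, Real.log (1 + u y) * ξ y ∂(densityMeasure ρ))
      (orderInterval ρ β) := by
  have key : ∀ δ : ℝ, 0 < δ → ∀ u ∈ orderInterval ρ β, ∀ u' ∈ orderInterval ρ β,
      |(∫ y, Real.log (1 + u y) * ξ y ∂(densityMeasure ρ)) -
        ∫ y, Real.log (1 + u' y) * ξ y ∂(densityMeasure ρ)| ≤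
      β / δ * ‖u - u'‖ + δ * ∫ y, ξ y ^ 2 ∂(densityMeasure ρ) := by
    intro δ hδ u hu u' hu'
    have i (w : L1 ρ) (hw : w ∈ orderInterval ρ β) :
        Integrable (fun y => Real.log (1 + w y) * ξ y) (densityMeasure ρ) :=
      (memLp_log_one_add hw hρ).integrable_mul hξ
    have i1 : Integrable (fun y => β / δ * ‖(u - u' : L1 ρ) y‖) (densityMeasure ρ) :=
      (L1.integrable_coeFn (u - u')).norm.const_mul _
    have i2 : Integrable (fun y => δ * ξ y ^ 2) (densityMeasure ρ) := hξ.integrable_sq.const_mul _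
    rw [← integral_sub (i u hu) (i u' hu'), L1.norm_eq_integral_norm (u - u'), ← integral_const_mul,
      ← integral_const_mul, ← integral_add i1 i2, ← Real.norm_eq_abs]
    refine norm_integral_le_of_norm_le (i1.add i2) ?_
    filter_upwards [Lp.coeFn_sub u u', hu, hu'] with y e h1 h2
    rw [e, Pi.sub_apply, ← sub_mul, norm_mul, Real.norm_eq_abs, Real.norm_eq_abs, Real.norm_eq_abs]
    have h3 := mul_le_mul_of_nonneg_right (abs_log_one_add_sub_le h1.1 h2.1) (abs_nonneg (ξ y))
    have h4 : |u y - u' y| ≤ β := by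
      rw [abs_le]
      constructor <;> linarith [h1.1, h1.2, h2.1, h2.2]
    -- Young's inequality with a parameter, followed by `|u - u'| ≤ β`
    refine h3.trans ?_
    set p := |u y - u' y| with hp
    have hp0 : 0 ≤ p := abs_nonneg _
    have h5 : p * |ξ y| ≤ p * p / δ + δ * ξ y ^ 2 := by
      rw [← sq_abs (ξ y), ← sub_nonneg]
      have e : p * p / δ + δ * |ξ y| ^ 2 - p * |ξ y| =
          ((p - δ * |ξ y|) ^ 2 + p * (δ * |ξ y|)) / δ := by
        field_simp
        ring
      rw [e]
      positivity
    have h6 : p * p / δ ≤ β / δ * p := by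
      rw [div_mul_eq_mul_div]
      gcongr
    linarith
  intro u hu
  set M := ∫ y, ξ y ^ 2 ∂(densityMeasure ρ) with hM
  have hM0 : 0 ≤ M := integral_nonneg fun y => sq_nonneg _
  refine Metric.continuousWithinAt_iff.2 fun ε hε => ?_
  set δ : ℝ := ε / (2 * (M + 1)) with hδ
  have hδ0 : 0 < δ := by positivity
  refine ⟨ε * δ / (2 * β), by positivity, fun u' hu' hd => ?_⟩
  rw [Real.dist_eq]
  refine (key δ hδ0 u' hu' u hu).trans_lt ?_
  rw [dist_eq_norm] at hd
  have h1 : β / δ * ‖u' - u‖ < ε / 2 := by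
    calc β / δ * ‖u' - u‖ < β / δ * (ε * δ / (2 * β)) := by gcongr
      _ = ε / 2 := by field_simp
  have h2 : δ * M ≤ ε / 2 := by
    have : δ * (M + 1) = ε / 2 := by
      rw [hδ]
      field_simp
    linarith
  linarith

/-- The flow generated by the resolvents satisfies the equation tested with functions of the space
variable. -/
theorem hasDerivAt_integral_flow_mul (hρ : IsDataDensity ρ) (hβ : 0 < β) {φ : Ed d → ℝ}
    (hφ : ContDiff ℝ 2 φ) (hs : HasCompactSupport φ) {x : L1 ρ} (hx : x ∈ orderInterval ρ β)
    {t : ℝ} (ht : 0 < t) :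
    HasDerivAt
      (fun s => ∫ y, IsResolventFamily.flow (resolventA ρ β) x s y * φ y ∂(densityMeasure ρ))
      (1 / 2 * ∫ y, Real.log (1 + IsResolventFamily.flow (resolventA ρ β) x t y) *
        weightedLaplacian ρ φ y ∂(densityMeasure ρ)) t := by
  obtain ⟨C, hC⟩ := hφ.continuous.bounded_above_of_compact_support hs
  refine (isResolventFamily_resolventA hρ hβ).hasDerivAt_flow
    (a := fun u => ∫ y, u y * φ y ∂(densityMeasure ρ))
    (b := fun u => 1 / 2 * ∫ y, Real.log (1 + u y) * weightedLaplacian ρ φ y ∂(densityMeasure ρ))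
    (continuous_integral_mul (hρ.aestronglyMeasurable_iff.2 hφ.continuous.aestronglyMeasurable)
      hC).continuousOn
    ((continuousOn_integral_log_mul hρ hβ (memLp_weightedLaplacian hρ hφ hs)).const_mul _)
    (fun lam hl f hf => ?_) hx ht
  have h := isWeakResolventSol_resolventA hρ hβ hl hf
  have h2 := h.2 φ hφ hs
  rw [integral_sub (integrable_mul_of_continuous hρ (L1.integrable_coeFn _) hφ.continuous hs)
    ((integrable_log_mul (domA_subset_orderInterval h.1) hρ hφ hs).const_mul _),
    integral_const_mul] at h2
  linarith

/-- A bounded family of multipliers converging pointwise may be paired with an `L¹` convergent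
family. -/
theorem tendsto_integral_mul {ι : Type*} {l : Filter ι} [l.IsCountablyGenerated] {u : ι → L1 ρ}
    {u₀ : L1 ρ} (hu : Tendsto u l (𝓝 u₀)) {ψ : ι → Ed d → ℝ} {ψ₀ : Ed d → ℝ}
    (hm : ∀ i, AEStronglyMeasurable (ψ i) (densityMeasure ρ)) {B : ℝ} (hB : ∀ i y, |ψ i y| ≤ B)
    (hψ : ∀ y, Tendsto (fun i => ψ i y) l (𝓝 (ψ₀ y))) :
    Tendsto (fun i => ∫ y, u i y * ψ i y ∂(densityMeasure ρ)) l
      (𝓝 (∫ y, u₀ y * ψ₀ y ∂(densityMeasure ρ))) := by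
  have h1 : Tendsto (fun i => ∫ y, u₀ y * ψ i y ∂(densityMeasure ρ)) l
      (𝓝 (∫ y, u₀ y * ψ₀ y ∂(densityMeasure ρ))) := by
    refine tendsto_integral_filter_of_dominated_convergence (fun y => ‖u₀ y‖ * B)
      (Eventually.of_forall fun i => (Lp.aestronglyMeasurable u₀).mul (hm i))
      (Eventually.of_forall fun i => Eventually.of_forall fun y => ?_)
      ((L1.integrable_coeFn u₀).norm.mul_const B)
      (Eventually.of_forall fun y => (hψ y).const_mul _)
    rw [norm_mul]
    exact mul_le_mul_of_nonneg_left (hB i y) (norm_nonneg _)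
  have h2 : Tendsto (fun i => (∫ y, u i y * ψ i y ∂(densityMeasure ρ)) -
      ∫ y, u₀ y * ψ i y ∂(densityMeasure ρ)) l (𝓝 0) := by
    refine squeeze_zero_norm (fun i => abs_integral_mul_sub_le (u i) u₀ (hm i) (hB i)) ?_
    simpa using (tendsto_iff_norm_sub_tendsto_zero.1 hu).const_mul B
  simpa using h2.add h1

theorem integrable_evolutionIntegrand (hρ : IsDataDensity ρ) {v : ℝ → L1 ρ} {φ : ℝ → Ed d → ℝ}
    (hφ : IsTestC12 φ) {t : ℝ} (hv : v t ∈ orderInterval ρ β) :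
    Integrable (fun y => v t y * deriv (fun s => φ s y) t) (densityMeasure ρ) ∧
    Integrable (evolutionIntegrand ρ v φ t) (densityMeasure ρ) := by
  obtain ⟨B, -, hB⟩ := hφ.exists_bound
  have hc : Continuous fun y => deriv (fun s => φ s y) t :=
    hφ.continuous_deriv_time.comp (Continuous.prodMk_right t)
  have i : Integrable (fun y => v t y * deriv (fun s => φ s y) t) (densityMeasure ρ) :=
    (L1.integrable_coeFn (v t)).mul_bdd (hρ.aestronglyMeasurable_iff.2 hc.aestronglyMeasurable)
      (Eventually.of_forall fun y => (hB t y).1)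
  exact ⟨i, i.add ((integrable_log_mul hv hρ (hφ.contDiff_space t)
    (hφ.hasCompactSupport_slice t)).const_mul _)⟩

/-- The product rule for the pairing of the flow with a time dependent test function. -/
theorem hasDerivAt_integral_flow_mul_test (hρ : IsDataDensity ρ) (hβ : 0 < β)
    {φ : ℝ → Ed d → ℝ} (hφ : IsTestC12 φ) {x : L1 ρ} (hx : x ∈ orderInterval ρ β)
    {t : ℝ} (ht : 0 < t) :
    HasDerivAt
      (fun s => ∫ y, IsResolventFamily.flow (resolventA ρ β) x s y * φ s y ∂(densityMeasure ρ))
      (∫ y, evolutionIntegrand ρ (IsResolventFamily.flow (resolventA ρ β) x) φ t y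
        ∂(densityMeasure ρ)) t := by
  have hfam := isResolventFamily_resolventA hρ hβ
  set v := IsResolventFamily.flow (resolventA ρ β) x with hv
  have hvt : v t ∈ orderInterval ρ β := hfam.flow_mem hx ht.le
  have hcv : ContinuousAt v t := (hfam.continuousOn_flow hx).continuousAt (Ici_mem_nhds ht)
  obtain ⟨B, hB0, hB⟩ := hφ.exists_bound
  have hi := integrable_evolutionIntegrand (v := v) hρ hφ hvt
  have hsl (s : ℝ) : Continuous (φ s) := (hφ.contDiff_space s).continuous
  have hiφ (s r : ℝ) : Integrable (fun y => v s y * φ r y) (densityMeasure ρ) :=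
    integrable_mul_of_continuous hρ (L1.integrable_coeFn _) (hsl r) (hφ.hasCompactSupport_slice r)
  have h1 := hasDerivAt_integral_flow_mul hρ hβ (hφ.contDiff_space t)
    (hφ.hasCompactSupport_slice t) hx ht
  rw [← hv] at h1
  have hq (s : ℝ) (y : Ed d) : |(s - t)⁻¹ * (φ s y - φ t y)| ≤ B := by
    have := Convex.norm_image_sub_le_of_norm_deriv_le (f := fun s => φ s y) (s := univ) (C := B)
      (fun r _ => hφ.differentiable_time y r) (fun r _ => (hB r y).1) convex_univ
      (mem_univ t) (mem_univ s)
    rw [abs_mul, abs_inv]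
    rcases eq_or_ne s t with rfl | hst
    · simpa using hB0
    · rw [inv_mul_le_iff₀ (abs_pos.2 (sub_ne_zero.2 hst)), mul_comm]
      exact this
  -- the difference quotients of `φ` are bounded and converge pointwise, while `v` is
  -- continuous at `t`
  have h2 : HasDerivAt (fun s => (∫ y, v s y * φ s y ∂(densityMeasure ρ)) -
      ∫ y, v s y * φ t y ∂(densityMeasure ρ))
      (∫ y, v t y * deriv (fun s => φ s y) t ∂(densityMeasure ρ)) t := by
    rw [hasDerivAt_iff_tendsto_slope]
    refine (tendsto_integral_mul (u := v) (hcv.mono_left nhdsWithin_le_nhds)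
      (ψ := fun s y => (s - t)⁻¹ * (φ s y - φ t y)) (fun s => hρ.aestronglyMeasurable_iff.2
        (continuous_const.mul ((hsl s).sub (hsl t))).aestronglyMeasurable) hq
        (ψ₀ := fun y => deriv (fun s => φ s y) t)
        (fun y => ?_)).congr fun s => ?_
    · have := hasDerivAt_iff_tendsto_slope.1 (hφ.differentiable_time y t).hasDerivAt
      exact this.congr fun s => by rw [slope_def_module, smul_eq_mul]
    · rw [slope_def_module, sub_self, sub_zero, ← integral_sub (hiφ s s) (hiφ s t), smul_eq_mul,
        ← integral_const_mul]
      congr 1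
      ext y
      ring
  have h3 := h2.add h1
  have e : ∫ y, evolutionIntegrand ρ v φ t y ∂(densityMeasure ρ) =
      (∫ y, v t y * deriv (fun s => φ s y) t ∂(densityMeasure ρ)) +
        1 / 2 * ∫ y, Real.log (1 + v t y) * weightedLaplacian ρ (φ t) y ∂(densityMeasure ρ) := by
    rw [← integral_const_mul, ← integral_add hi.1 ((integrable_log_mul hvt hρ (hφ.contDiff_space t)
      (hφ.hasCompactSupport_slice t)).const_mul _)]
    rfl
  rw [e]
  refine h3.congr_of_eventuallyEq (Eventually.of_forall fun s => ?_)
  simp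

/-- The space integral of the evolution integrand is bounded uniformly in time, since `∇ ln ρ` is
integrable and the derivatives of the test function are bounded. -/
theorem exists_abs_integral_evolutionIntegrand_le (hρ : IsDataDensity ρ) {v : ℝ → L1 ρ}
    {φ : ℝ → Ed d → ℝ} (hφ : IsTestC12 φ) : ∃ C, ∀ t, v t ∈ orderInterval ρ β →
      ‖∫ y, evolutionIntegrand ρ v φ t y ∂(densityMeasure ρ)‖ ≤ C := by
  have := hρ.isProbabilityMeasure
  obtain ⟨B, hB0, hB⟩ := hφ.exists_bound
  have hG : Integrable (fun y => ‖weakGradient (fun z => Real.log (ρ z)) y‖) (densityMeasure ρ) :=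
    (hρ.memLp_weakGradient_log.integrable (by norm_num)).norm
  have hint : Integrable (fun y => β * B + 1 / 2 * (β * (d * B +
      ‖weakGradient (fun z => Real.log (ρ z)) y‖ * B))) (densityMeasure ρ) :=
    (integrable_const _).add ((((integrable_const _).add (hG.mul_const B)).const_mul _).const_mul _)
  refine ⟨_, fun t ht => norm_integral_le_of_norm_le hint ?_⟩
  filter_upwards [ht] with y hy
  have hlog0 : 0 ≤ Real.log (1 + v t y) := Real.log_nonneg (by linarith [hy.1])
  have hlog : Real.log (1 + v t y) ≤ β := by
    have := Real.log_le_sub_one_of_pos (show 0 < 1 + v t y by linarith [hy.1])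
    linarith [hy.2]
  have hW := abs_weightedLaplacian_le ρ (hB t y).2.1 (hB t y).2.2
  rw [evolutionIntegrand, Real.norm_eq_abs]
  refine (abs_add_le _ _).trans (add_le_add ?_ ?_)
  · rw [abs_mul, abs_of_nonneg hy.1]
    exact mul_le_mul hy.2 (hB t y).1 (abs_nonneg _) (hy.1.trans hy.2)
  · rw [abs_mul, abs_mul, abs_of_nonneg hlog0, abs_of_pos (by norm_num : (0 : ℝ) < 1 / 2)]
    exact mul_le_mul_of_nonneg_left (mul_le_mul hlog hW (abs_nonneg _) (hlog0.trans hlog))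
      (by norm_num)

/-- The flow is a weak solution: the tested equation says that the space-time integrand is the
derivative of a function of time with compact support. -/
theorem isWeakEvolutionSol_flow (hρ : IsDataDensity ρ) (hβ : 0 < β) {x : L1 ρ}
    (hx : x ∈ orderInterval ρ β) :
    IsWeakEvolutionSol ρ (IsResolventFamily.flow (resolventA ρ β) x) := by
  intro φ hφ
  have hfam := isResolventFamily_resolventA hρ hβ
  set v := IsResolventFamily.flow (resolventA ρ β) x with hv
  have hvK : ∀ t, 0 < t → v t ∈ orderInterval ρ β := fun t ht => hfam.flow_mem hx ht.le
  refine ⟨fun t ht => (integrable_evolutionIntegrand hρ hφ (hvK t ht)).2, ?_⟩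
  obtain ⟨a, b, ha, hab, hout⟩ := hφ.exists_notMem_tsupport
  obtain ⟨C, hC⟩ := exists_abs_integral_evolutionIntegrand_le (v := v) (β := β) hρ hφ
  set E : ℝ → ℝ := fun t => ∫ y, evolutionIntegrand ρ v φ t y ∂(densityMeasure ρ) with hE
  set H : ℝ → ℝ := fun s => ∫ y, v s y * φ s y ∂(densityMeasure ρ) with hH
  have hder : ∀ t, 0 < t → HasDerivAt H (E t) t := fun t ht =>
    hasDerivAt_integral_flow_mul_test hρ hβ hφ hx ht
  have hE0 : ∀ t ∈ Ioi (0 : ℝ) \ Ioc a b, E t = 0 := by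
    intro t ht
    have h : t ≤ a ∨ b ≤ t := by
      by_contra! h
      exact ht.2 ⟨h.1, h.2.le⟩
    rw [hE]
    refine integral_eq_zero_of_ae (Eventually.of_forall fun y => ?_)
    change evolutionIntegrand ρ v φ t y = 0
    rw [evolutionIntegrand, IsTestC12.deriv_eq_zero (hout t y h),
      IsTestC12.weightedLaplacian_eq_zero ρ (hout t y h)]
    simp
  have hH0 : ∀ t, (t ≤ a ∨ b ≤ t) → H t = 0 := by
    intro t h
    refine integral_eq_zero_of_ae (Eventually.of_forall fun y => ?_)
    have : φ t y = 0 := image_eq_zero_of_notMem_tsupport (f := fun p : ℝ × Ed d => φ p.1 p.2)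
      (hout t y h)
    simp [this]
  have hpos : ∀ t ∈ Ioc a b, 0 < t := fun t ht => ha.trans ht.1
  -- `E` is measurable because it is a derivative
  have hI : IntegrableOn E (Ioc a b) := by
    refine Integrable.of_bound ?_ C ?_
    · refine (measurable_deriv H).aestronglyMeasurable.congr ?_
      exact (ae_restrict_iff' measurableSet_Ioc).2
        (Eventually.of_forall fun t ht => (hder t (hpos t ht)).deriv)
    · exact (ae_restrict_iff' measurableSet_Ioc).2
        (Eventually.of_forall fun t ht => hC t (hvK t (hpos t ht)))
  refine ⟨hI.of_forall_sdiff_eq_zero measurableSet_Ioi hE0, ?_⟩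
  rw [setIntegral_eq_of_subset_of_forall_sdiff_eq_zero measurableSet_Ioi
    (fun t ht => hpos t ht) hE0, ← intervalIntegral.integral_of_le hab,
    intervalIntegral.integral_eq_sub_of_hasDerivAt (f := H) (f' := E)
      (fun t ht => hder t (ha.trans_le (uIcc_of_le hab ▸ ht).1))
      ((intervalIntegrable_iff_integrableOn_Ioc_of_le hab).2 hI),
    hH0 b (Or.inr le_rfl), hH0 a (Or.inl le_rfl), sub_zero]

end Evolution

end

theorem proposition4p1 {d : ℕ} (hd : 1 ≤ d) (ρ : Ed d → ℝ) (hρ : IsDataDensity ρ)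
    (β : ℝ) (hβ : 0 < β) :
    -- `A` is accretive in `L¹(μ)`
    (∀ v₁ ∈ domA ρ β, ∀ v₂ ∈ domA ρ β, ∀ lam : ℝ, 0 < lam →
      ‖v₁ - v₂‖ ≤ ‖(v₁ + lam • opA ρ v₁) - (v₂ + lam • opA ρ v₂)‖) ∧
    -- the range condition, for every `lam > 0`
    (∀ lam : ℝ, 0 < lam → closure (domA ρ β) ⊆ rangeIA ρ β lam) ∧
    -- `(I + lam A) v = f` has at most one weak solution, so that `(I + lam A)⁻¹` is well defined
    (∀ lam : ℝ, 0 < lam → ∀ f v₁ v₂ : L1 ρ,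
      IsWeakResolventSol ρ β lam f v₁ → IsWeakResolventSol ρ β lam f v₂ → v₁ = v₂) ∧
    -- existence of a continuous weak solution given by the exponential formula
    (∀ ρ₀ : Ed d → ℝ, IsProbDensity ρ₀ → (∀ᵐ y, ρ₀ y ≤ β * ρ y) →
      ∃ v : ℝ → L1 ρ,
        (v 0 : Ed d → ℝ) =ᵐ[densityMeasure ρ] (fun y => ρ₀ y / ρ y) ∧
        (∀ t, 0 ≤ t → v t ∈ closure (domA ρ β)) ∧
        ContinuousOn v (Ici 0) ∧
        IsWeakEvolutionSol ρ v ∧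
        ∀ T : ℝ, 0 ≤ T →
          TendstoUniformlyOn (fun (n : ℕ) (t : ℝ) => (resolventA ρ β (t / n))^[n] (v 0))
            v atTop (Icc 0 T)) := by
  refine ⟨fun v₁ h₁ v₂ h₂ lam hl => ?_, fun lam hl f hf => ?_, fun lam hl f v₁ v₂ h₁ h₂ => ?_,
    fun ρ₀ h₀ hle => ?_⟩
  · have e : (v₁ + lam • opA ρ v₁) - (v₂ + lam • opA ρ v₂) =
        v₁ - v₂ + lam • (opA ρ v₁ - opA ρ v₂) := by
      rw [smul_sub]
      abel
    rw [e]
    exact norm_sub_le_of_isWeakA hρ hβ h₁ h₂ (isWeakA_opA h₁) (isWeakA_opA h₂) hl.le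
  · rw [closure_domA hρ hβ] at hf
    exact exists_isWeakResolventSol hρ hβ hl hf
  · have h := h₁.norm_sub_le hρ hβ hl h₂
    rw [sub_self, norm_zero] at h
    exact sub_eq_zero.1 (norm_le_zero_iff.1 h)
  · have := hρ.isProbabilityMeasure
    have hb : ∀ᵐ y ∂(densityMeasure ρ), 0 ≤ ρ₀ y / ρ y ∧ ρ₀ y / ρ y ≤ β := by
      refine hρ.ae_iff.2 ?_
      filter_upwards [hle] with y hy
      exact ⟨div_nonneg (h₀.nonneg y) (hρ.pos y).le, (div_le_iff₀ (hρ.pos y)).2 hy⟩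
    have hm : MemLp (fun y => ρ₀ y / ρ y) 1 (densityMeasure ρ) := by
      refine MemLp.of_bound
        (h₀.measurable.div hρ.isProbDensity.measurable).aestronglyMeasurable β ?_
      filter_upwards [hb] with y hy
      rw [Real.norm_of_nonneg hy.1]
      exact hy.2
    have hx : hm.toLp _ ∈ orderInterval ρ β := by
      filter_upwards [hb, hm.coeFn_toLp] with y hy e
      rwa [e]
    have hfam := isResolventFamily_resolventA hρ hβ
    refine ⟨IsResolventFamily.flow (resolventA ρ β) (hm.toLp _), ?_, fun t ht => ?_,
      hfam.continuousOn_flow hx, isWeakEvolutionSol_flow hρ hβ hx, fun T hT => ?_⟩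
    · rw [hfam.flow_zero hx]
      exact hm.coeFn_toLp
    · rw [closure_domA hρ hβ]
      exact hfam.flow_mem hx ht
    · rw [hfam.flow_zero hx]
      exact hfam.tendstoUniformlyOn_flow hx hT
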